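/- \textbf{Theorem (Diagonalization for $m=1$).} Let $n\ge 1$. Fix real couplings $\mathrm g>0$, $\mathrm g\neq 1$, and $\mathrm g_r,\mathrm g_r'$ ($1\le r\le 4$) with $\mathrm g_r>0$ and $|\mathrm g'_r|<\mathrm g_r+\frac12$ for $r=1,2$. Put $\alpha=\frac{\pi}{1+(n-1)\mathrm g+\mathrm g_1+\mathrm g_2}$, and if $n=1$ assume also $\sin(\frac\alpha2\mathrm g)\sin(\frac\alpha2(\mathrm g-1))\ne0$. For $-1<p<1$ put $$[z]_1=\tfrac{\vartheta_1(\frac\alpha2 z;p)}{\sin(\frac\alpha2)\,\vartheta_1'(0;p)},\qquad [z]_r=\tfrac{\vartheta_r(\frac\alpha2 z;p)}{\vartheta_r(0;p)}\quad (r=2,3,4),$$ (Jacobi theta functions, extended analytically from $0<p<1$), $[z_1,\dots,z_N]_r=\prod_i[z_i]_r$ and $[z_1,\dots,z_N]_{r,l}=\prod_{i}\prod_{0\le k<l}[z_i+k]_r$. Let $\rho_j=(n-j)\mathrm g+\mathrm g_1$, $\hat\rho_j=(n-j)\mathrm g+\frac12(\mathrm g_1+\mathrm g_2+\mathrm g_1'+\mathrm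 g_2')$, and let $\Lambda=\{\lambda\in\mathbb Z^n\mid 1\ge\lambda_1\ge\dots\ge\lambda_n\ge0\}$ be the set of the columns $(1^k)=(1,\dots,1,0,\dots,0)$ ($k$ ones, $0\le k\le n$). On $\mathcal C(\Lambda)=\{f:\Lambda\to\mathbb C\}$ let $$(Hf)_\lambda=A_\lambda f_\lambda+\sum_{\substack{1\le j\le n,\ \varepsilon=\pm1\\ \lambda+\varepsilon e_j\in\Lambda}}B_{\lambda,\varepsilon j}f_{\lambda+\varepsilon e_j},$$ where $$A_\lambda=\sum_{r=1}^4\mathrm c_r\Bigl(\prod_{j=1}^n\tfrac{[\rho_j+\lambda_j+\frac12-\mathrm g]_r}{[\rho_j+\lambda_j+\frac12]_r}\tfrac{[\rho_j+\lambda_j-\frac12+\mathrm g]_r}{[\rho_j+\lambda_j-\frac12]_r}-1\Bigr),\qquad \mathrm c_r=\tfrac{2}{[\mathrm g]_1[\mathrm g-1]_1}\prod_{s=1}^4[\mathrm g_{\pi_r(s)}-\tfrac12]_s[\mathrm g'_{\pi_r(s)}]_s,$$ $$B_{\lambda,\varepsilon j}=\prod_{r=1}^4\tfrac{[\rho_j+\lambda_j+\varepsilon\mathrm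 g_r]_r[\rho_j+\lambda_j+\varepsilon(\mathrm g_r'+\frac12)]_r}{[\rho_j+\lambda_j]_r[\rho_j+\lambda_j+\frac\varepsilon2]_r}\prod_{k\neq j,\ \delta=\pm1}\tfrac{[\rho_j+\delta\rho_k+\lambda_j+\delta\lambda_k+\varepsilon\mathrm g]_1}{[\rho_j+\delta\rho_k+\lambda_j+\delta\lambda_k]_1},$$ with $\pi_1=\mathrm{id}$, $\pi_2=(12)(34)$, $\pi_3=(13)(24)$, $\pi_4=(14)(23)$. (Where a denominator of $A_\lambda$ vanishes the singularity is removable, and $A_\lambda$ is the limit for $s\to0$ of its values at the couplings $\mathrm g_1+s$, $\mathrm g_2-s$.) Let $$\Delta_\lambda=\prod_{j,\,r}\tfrac{[\rho_j+1,\rho_j+\mathrm g_r,\rho_j+\mathrm g_r'+\frac12]_{r,\lambda_j}}{[\rho_j,\rho_j+1-\mathrm g_r,\rho_j-\mathrm g_r'+\frac12]_{r,\lambda_j}}\prod_{j<k,\ \delta=\pm1}\tfrac{[\rho_j+\delta\rho_k+\mathrm g,\rho_j+\delta\rho_k+1]_{1,\lambda_j+\delta\lambda_k}}{[\rho_j+\delta\rho_k,\rho_j+\delta\rho_k+1-\mathrm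 g]_{1,\lambda_j+\delta\lambda_k}},\qquad \langle f,f'\rangle_\Delta=\sum_{\lambda\in\Lambda}f_\lambda\overline{f'_\lambda}\Delta_\lambda .$$ Write $A_k=A_{(1^k)}$ for $0\le k\le n$, and $B_k=B_{(1^{k-1}),k}$, $B_{-k}=B_{(1^k),-k}$ for $1\le k\le n$. Let $P_{(1^0)}=1$ and, for $1\le k\le n+1$, let $P_{(1^k)}(E)=\det(E-T_k)$, where $T_k$ is the $k\times k$ tridiagonal matrix with diagonal $A_0,\dots,A_{k-1}$, superdiagonal $B_1,\dots,B_{k-1}$ and subdiagonal $B_{-1},\dots,B_{-(k-1)}$. Then the following hold. (i) There are real-analytic functions $E_{(1^l)}$ ($0\le l\le n$) of $p\in(-1,1)$ that are the eigenvalues of $H$ (with multiplicities) for every $p$, and satisfy $E_{(1^l)}|_{p=0}=2\sum_{j=1}^n\cos(\alpha(\hat\rho_j+(1^l)_j))$. For every such family and every $p\in(-1,1)$, $$E_{(1^0)}>E_{(1^1)}>\dots>E_{(1^n)}$$ and these are the roots of $P_{(1^{n+1})}$, all of them simple. (ii) For every $p\in(-1,1)$ let $\chi\in\mathcal C(\Lambda)$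 be given by $\chi_{(1^0)}=1$ and $\chi_{(1^k)}=0$ for $k\ge1$, and put $$h^{(1^l)}=\Bigl(\prod_{0\le j\le n,\ j\ne l}\tfrac{H-E_{(1^j)}}{E_{(1^l)}-E_{(1^j)}}\Bigr)\chi .$$ Then $Hh^{(1^l)}=E_{(1^l)}h^{(1^l)}$, $\langle h^{(1^k)},h^{(1^l)}\rangle_\Delta$ equals $h^{(1^l)}_{(1^0)}$ if $k=l$ and $0$ otherwise, and $$h^{(1^l)}_{(1^k)}=\frac{\textsc c_{(1^k)}}{\textsc n_{(1^l)}}P_{(1^k)}(E_{(1^l)})\qquad(0\le k,l\le n),$$ where $$\textsc c_{(1^k)}=\prod_{j=1}^kB_j^{-1}=\prod_{\substack{1\le j\le k\\1\le r\le4}}\tfrac{[\rho_j,\rho_j+\frac12]_r}{[\rho_j+\mathrm g_r,\rho_j+\mathrm g_r'+\frac12]_r}\prod_{1\le j<l\le k}\tfrac{[\rho_j+\rho_l,\rho_j+\rho_l+1]_1}{[\rho_j+\rho_l+\mathrm g,\rho_j+\rho_l+1+\mathrm g]_1}\tfrac{[\rho_j-\rho_l,\rho_j-\rho_l+1]_1}{[\rho_j-\rho_l+\mathrm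 g,\rho_j-\rho_l+1-\mathrm g]_1}\prod_{\substack{1\le j\le k\\k<l\le n}}\tfrac{[\rho_j+\rho_l,\rho_j-\rho_l]_1}{[\rho_j+\rho_l+\mathrm g,\rho_j-\rho_l+\mathrm g]_1}>0$$ and $$\textsc n_{(1^l)}=\sum_{k=0}^n\textsc c_{(1^k)}^2P_{(1^k)}(E_{(1^l)})^2\Delta_{(1^k)}=\textsc c_{(1^n)}^2\Delta_{(1^n)}P_{(1^n)}(E_{(1^l)})\prod_{\substack{0\le j\le n\\j\ne l}}\bigl(E_{(1^l)}-E_{(1^j)}\bigr)>0 .$$ -/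

import Mathlib

namespace EllipticRacah

/-- The nine real coupling parameters `g`, `g_1, …, g_4`, `g'_1, …, g'_4`.  The indices
`1, 2, 3, 4` are represented by `0, 1, 2, 3 : Fin 4`. -/
structure Couplings where
  g : ℝ
  gr : Fin 4 → ℝ
  gr' : Fin 4 → ℝ

/-- The scaled theta function `[z]_{r+1} = [z; p]_{r+1}` with scaling parameter `α`:
`[z]_1 = ϑ₁(α z / 2; p) / (sin (α / 2) ϑ₁'(0; p))` and `[z]_r = ϑ_r(α z / 2; p) / ϑ_r(0; p)` for
`r = 2, 3, 4`, in terms of the product expansions of the Jacobi theta functions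
(e.g. `ϑ₁(x; p) = 2 p^{1/4} sin x ∏_{l ≥ 1} (1 - p^{2l}) (1 - 2 p^{2l} cos 2x + p^{4l})`, so that
`ϑ₁'(0; p) = 2 p^{1/4} ∏_{l ≥ 1} (1 - p^{2l})^3`).  The common factors of numerator and denominator
are cancelled, which gives the analytic extension from `0 < p < 1` to `-1 < p < 1`. -/
noncomputable def bracket (α p : ℝ) (r : Fin 4) (z : ℝ) : ℝ :=
  ![(Real.sin (α / 2 * z) / Real.sin (α / 2)) *
      ∏' l : ℕ, (1 - 2 * p ^ (2 * (l + 1)) * Real.cos (α * z) + p ^ (4 * (l + 1))) /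
        (1 - p ^ (2 * (l + 1))) ^ 2,
    Real.cos (α / 2 * z) *
      ∏' l : ℕ, (1 + 2 * p ^ (2 * (l + 1)) * Real.cos (α * z) + p ^ (4 * (l + 1))) /
        (1 + p ^ (2 * (l + 1))) ^ 2,
    ∏' l : ℕ, (1 + 2 * p ^ (2 * l + 1) * Real.cos (α * z) + p ^ (4 * l + 2)) /
        (1 + p ^ (2 * l + 1)) ^ 2,
    ∏' l : ℕ, (1 - 2 * p ^ (2 * l + 1) * Real.cos (α * z) + p ^ (4 * l + 2)) /
        (1 - p ^ (2 * l + 1)) ^ 2] r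

/-- The elliptic shifted factorial `[z]_{r,l} = ∏_{0 ≤ k < l} [z + k]_r`. -/
noncomputable def ellFactorial (α p : ℝ) (r : Fin 4) (z : ℝ) (l : ℕ) : ℝ :=
  ∏ k ∈ Finset.range l, bracket α p r (z + k)

/-- The permutations `π_1 = id`, `π_2 = (12)(34)`, `π_3 = (13)(24)`, `π_4 = (14)(23)`. -/
def perm4 : Fin 4 → Fin 4 → Fin 4 :=
  ![![0, 1, 2, 3], ![1, 0, 3, 2], ![2, 3, 0, 1], ![3, 2, 1, 0]]

/-- The truncation condition `α = π / (m + (n - 1) g + g_1 + g_2)`. -/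
noncomputable def alpha (n m : ℕ) (C : Couplings) : ℝ :=
  Real.pi / (m + ((n : ℝ) - 1) * C.g + C.gr 0 + C.gr 1)

/-- `ρ_j = (n - j) g + g_1`, with `j` counted from `1`. -/
noncomputable def rho (n : ℕ) (C : Couplings) (j : ℕ) : ℝ :=
  ((n : ℝ) - j) * C.g + C.gr 0

/-- `ρ̂_j = (n - j) g + (g_1 + g_2 + g'_1 + g'_2) / 2`, with `j` counted from `1`. -/
noncomputable def rhoHat (n : ℕ) (C : Couplings) (j : ℕ) : ℝ :=
  ((n : ℝ) - j) * C.g + (C.gr 0 + C.gr 1 + C.gr' 0 + C.gr' 1) / 2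

open Classical in
/-- The set `Λ^{(n,m)}` of the partitions `m ≥ λ_1 ≥ … ≥ λ_n ≥ 0`. -/
noncomputable def boundedPartitions (n m : ℕ) : Finset (Fin n → ℤ) :=
  (Fintype.piFinset fun _ => Finset.Icc (0 : ℤ) m).filter Antitone

theorem mem_boundedPartitions {n m : ℕ} {lam : Fin n → ℤ} :
    lam ∈ boundedPartitions n m ↔ (∀ j, 0 ≤ lam j ∧ lam j ≤ m) ∧ Antitone lam := by
  simp [boundedPartitions]

abbrev BPart (n m : ℕ) : Type := {lam : Fin n → ℤ // lam ∈ boundedPartitions n m}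

/-- The constants `c_r`. -/
noncomputable def cConst (n m : ℕ) (C : Couplings) (p : ℝ) (r : Fin 4) : ℝ :=
  2 / (bracket (alpha n m C) p 0 C.g * bracket (alpha n m C) p 0 (C.g - 1)) *
    ∏ s : Fin 4, bracket (alpha n m C) p s (C.gr (perm4 r s) - 1 / 2) *
      bracket (alpha n m C) p s (C.gr' (perm4 r s))

/-- The formula for `A_λ`, at couplings for which none of its denominators vanishes. -/
noncomputable def coeffARaw (n m : ℕ) (C : Couplings) (p : ℝ) (lam : Fin n → ℤ) : ℝ :=
  ∑ r : Fin 4, cConst n m C p r *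
    ((∏ j : Fin n,
      (bracket (alpha n m C) p r (rho n C ((j : ℕ) + 1) + lam j + 1 / 2 - C.g) /
        bracket (alpha n m C) p r (rho n C ((j : ℕ) + 1) + lam j + 1 / 2)) *
      (bracket (alpha n m C) p r (rho n C ((j : ℕ) + 1) + lam j - 1 / 2 + C.g) /
        bracket (alpha n m C) p r (rho n C ((j : ℕ) + 1) + lam j - 1 / 2))) - 1)

/-- The shift `g_1 ↦ g_1 + s`, `g_2 ↦ g_2 - s` of the couplings; it leaves `α` unchanged. -/
noncomputable def Couplings.shift (C : Couplings) (s : ℝ) : Couplings where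
  g := C.g
  gr := ![C.gr 0 + s, C.gr 1 - s, C.gr 2, C.gr 3]
  gr' := C.gr'

/-- The coefficient `A_λ`.  On exceptional couplings of the domain (such as `g_1 = 1/2`) the formula
for `A_λ` takes the form `0/0`; these singularities are removable, and there `A_λ` is the value by
continuity in the couplings.  Everywhere else this limit is just the value of the formula. -/
noncomputable def coeffA (n m : ℕ) (C : Couplings) (p : ℝ) (lam : Fin n → ℤ) : ℝ :=
  Filter.limUnder (nhdsWithin (0 : ℝ) {0}ᶜ) fun s => coeffARaw n m (C.shift s) p lam

/-- The coefficient `B_{λ, ε j}`, where `ε = ±1`. -/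
noncomputable def coeffB (n m : ℕ) (C : Couplings) (p : ℝ) (lam : Fin n → ℤ) (ε : ℤ) (j : Fin n) :
    ℝ :=
  (∏ r : Fin 4,
    (bracket (alpha n m C) p r (rho n C ((j : ℕ) + 1) + lam j + ε * C.gr r) *
      bracket (alpha n m C) p r (rho n C ((j : ℕ) + 1) + lam j + ε * (C.gr' r + 1 / 2))) /
    (bracket (alpha n m C) p r (rho n C ((j : ℕ) + 1) + lam j) *
      bracket (alpha n m C) p r (rho n C ((j : ℕ) + 1) + lam j + ε / 2))) *
  ∏ k ∈ Finset.univ.erase j, ∏ δ ∈ ({1, -1} : Finset ℤ),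
    bracket (alpha n m C) p 0
        (rho n C ((j : ℕ) + 1) + δ * rho n C ((k : ℕ) + 1) + lam j + δ * lam k + ε * C.g) /
      bracket (alpha n m C) p 0 (rho n C ((j : ℕ) + 1) + δ * rho n C ((k : ℕ) + 1) + lam j + δ * lam k)

/-- The difference operator `H`, acting on complex functions on `Λ^{(n,m)}`. -/
noncomputable def hamiltonian (n m : ℕ) (C : Couplings) (p : ℝ) :
    (BPart n m → ℂ) →ₗ[ℂ] (BPart n m → ℂ) where
  toFun f := fun lam =>
    (coeffA n m C p lam.1 : ℂ) * f lam +
      ∑ j : Fin n, ∑ ε ∈ ({1, -1} : Finset ℤ),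
        if h : lam.1 + ε • Pi.single j 1 ∈ boundedPartitions n m then
          (coeffB n m C p lam.1 ε j : ℂ) * f ⟨lam.1 + ε • Pi.single j 1, h⟩
        else 0
  map_add' f f' := by
    funext lam
    simp only [Pi.add_apply]
    rw [mul_add, add_add_add_comm, ← Finset.sum_add_distrib]
    congr 1
    refine Finset.sum_congr rfl fun j _ => ?_
    rw [← Finset.sum_add_distrib]
    refine Finset.sum_congr rfl fun ε _ => ?_
    split_ifs
    · ring
    · simp
  map_smul' c f := by
    funext lam
    simp only [Pi.smul_apply, smul_eq_mul, RingHom.id_apply]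
    rw [mul_add, Finset.mul_sum]
    congr 1
    · ring
    refine Finset.sum_congr rfl fun j _ => ?_
    rw [Finset.mul_sum]
    refine Finset.sum_congr rfl fun ε _ => ?_
    split_ifs
    · ring
    · simp

/-- The elliptic weights `Δ_λ`. -/
noncomputable def weight (n m : ℕ) (C : Couplings) (p : ℝ) (lam : Fin n → ℤ) : ℝ :=
  (∏ j : Fin n, ∏ r : Fin 4,
    (ellFactorial (alpha n m C) p r (rho n C ((j : ℕ) + 1) + 1) (lam j).toNat *
      ellFactorial (alpha n m C) p r (rho n C ((j : ℕ) + 1) + C.gr r) (lam j).toNat *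
      ellFactorial (alpha n m C) p r (rho n C ((j : ℕ) + 1) + C.gr' r + 1 / 2) (lam j).toNat) /
    (ellFactorial (alpha n m C) p r (rho n C ((j : ℕ) + 1)) (lam j).toNat *
      ellFactorial (alpha n m C) p r (rho n C ((j : ℕ) + 1) + 1 - C.gr r) (lam j).toNat *
      ellFactorial (alpha n m C) p r (rho n C ((j : ℕ) + 1) - C.gr' r + 1 / 2) (lam j).toNat)) *
  ∏ j : Fin n, ∏ k ∈ Finset.Ioi j, ∏ δ ∈ ({1, -1} : Finset ℤ),
    (ellFactorial (alpha n m C) p 0 (rho n C ((j : ℕ) + 1) + δ * rho n C ((k : ℕ) + 1) + C.g)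
        (lam j + δ * lam k).toNat *
      ellFactorial (alpha n m C) p 0 (rho n C ((j : ℕ) + 1) + δ * rho n C ((k : ℕ) + 1) + 1)
        (lam j + δ * lam k).toNat) /
    (ellFactorial (alpha n m C) p 0 (rho n C ((j : ℕ) + 1) + δ * rho n C ((k : ℕ) + 1))
        (lam j + δ * lam k).toNat *
      ellFactorial (alpha n m C) p 0 (rho n C ((j : ℕ) + 1) + δ * rho n C ((k : ℕ) + 1) + 1 - C.g)
        (lam j + δ * lam k).toNat)

/-- The inner product `⟨f, f'⟩_Δ = ∑_λ f_λ conj(f'_λ) Δ_λ`. -/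
noncomputable def innerDelta (n m : ℕ) (C : Couplings) (p : ℝ) (f f' : BPart n m → ℂ) : ℂ :=
  ∑ lam : BPart n m, f lam * (starRingEnd ℂ) (f' lam) * (weight n m C p lam.1 : ℂ)

/-- `E_ν(p)`, `ν ∈ Λ^{(n,m)}`, are the eigenvalues of `H` (with multiplicities), labelled such that
they are real-analytic in `p ∈ (-1, 1)` with
`E_ν(0) = 2 ∑_j cos (α (ρ̂_j + ν_j))`. -/
structure IsEigenvalueFamily (n m : ℕ) (C : Couplings) (E : BPart n m → ℝ → ℝ) : Prop where
  analytic : ∀ ν, AnalyticOnNhd ℝ (E ν) (Set.Ioo (-1) 1)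
  charpoly_eq : ∀ p ∈ Set.Ioo (-1 : ℝ) 1,
    (hamiltonian n m C p).charpoly =
      ∏ ν : BPart n m, (Polynomial.X - Polynomial.C ((E ν p : ℝ) : ℂ))
  at_zero : ∀ ν, E ν 0 =
    2 * ∑ j : Fin n, Real.cos (alpha n m C * (rhoHat n C ((j : ℕ) + 1) + (ν.1 j : ℝ)))

open Classical in
/-- The function `χ`: `χ_0 = 1` and `χ_λ = 0` for `λ ≠ 0`. -/
noncomputable def chi (n m : ℕ) : BPart n m → ℂ := fun lam => if lam.1 = 0 then 1 else 0

open Classical in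
/-- `h^{(ν)} = (∏_{μ ≠ ν} (H - E_μ) / (E_ν - E_μ)) χ` (at the value `p`, for distinct `E_μ`). -/
noncomputable def eigenfunction (n m : ℕ) (C : Couplings) (E : BPart n m → ℝ → ℝ) (p : ℝ)
    (ν : BPart n m) : BPart n m → ℂ :=
  Polynomial.aeval (hamiltonian n m C p)
    (∏ μ ∈ Finset.univ.erase ν, Polynomial.C ((((E ν p - E μ p : ℝ) : ℂ))⁻¹) *
      (Polynomial.X - Polynomial.C ((E μ p : ℝ) : ℂ))) (chi n m)

/-- The column `(1^k) = (1, …, 1, 0, …, 0)` with `k` ones. -/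
def columnFun (n k : ℕ) : Fin n → ℤ := fun j => if (j : ℕ) < k then 1 else 0

theorem columnFun_mem (n k : ℕ) : columnFun n k ∈ boundedPartitions n 1 := by
  rw [mem_boundedPartitions]
  refine ⟨fun j => ?_, fun i j hij => ?_⟩
  · unfold columnFun
    split_ifs <;> simp
  · have : (i : ℕ) ≤ j := hij
    unfold columnFun
    split_ifs <;> omega

def column (n k : ℕ) : BPart n 1 := ⟨columnFun n k, columnFun_mem n k⟩

/-- `A_k = A_{(1^k)}` at `m = 1`. -/
noncomputable def colA (n : ℕ) (C : Couplings) (p : ℝ) (k : ℕ) : ℝ :=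
  coeffA n 1 C p (columnFun n k)

/-- `B_k = B_{(1^{k-1}), k}` for `1 ≤ k ≤ n` at `m = 1`, with `B_0 = B_{n+1} = 0`. -/
noncomputable def colBPlus (n : ℕ) (C : Couplings) (p : ℝ) (k : ℕ) : ℝ :=
  if h : 1 ≤ k ∧ k ≤ n then coeffB n 1 C p (columnFun n (k - 1)) 1 ⟨k - 1, by omega⟩ else 0

/-- `B_{-k} = B_{(1^k), -k}` for `1 ≤ k ≤ n` at `m = 1`, and `0` for other `k`. -/
noncomputable def colBMinus (n : ℕ) (C : Couplings) (p : ℝ) (k : ℕ) : ℝ :=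
  if h : 1 ≤ k ∧ k ≤ n then coeffB n 1 C p (columnFun n k) (-1) ⟨k - 1, by omega⟩ else 0

/-- The `k × k` tridiagonal matrix with diagonal `A_0, …, A_{k-1}`, superdiagonal
`B_1, …, B_{k-1}` and subdiagonal `B_{-1}, …, B_{-(k-1)}`. -/
noncomputable def tridiag (n : ℕ) (C : Couplings) (p : ℝ) (k : ℕ) : Matrix (Fin k) (Fin k) ℝ :=
  Matrix.of fun i j =>
    if (j : ℕ) = i then colA n C p i
    else if (j : ℕ) = i + 1 then colBPlus n C p j
    else if (i : ℕ) = j + 1 then colBMinus n C p i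
    else 0

/-- `P_{(1^k)}(E)`, the determinant of `E - tridiag k`. -/
noncomputable def colPoly (n : ℕ) (C : Couplings) (p : ℝ) (k : ℕ) : Polynomial ℝ :=
  (tridiag n C p k).charpoly

/-- The theta-product formula for `c_{(1^k)}`. -/
noncomputable def colC (n : ℕ) (C : Couplings) (p : ℝ) (k : ℕ) : ℝ :=
  (∏ j ∈ Finset.Icc 1 k, ∏ r : Fin 4,
    (bracket (alpha n 1 C) p r (rho n C j) * bracket (alpha n 1 C) p r (rho n C j + 1 / 2)) /
    (bracket (alpha n 1 C) p r (rho n C j + C.gr r) *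
      bracket (alpha n 1 C) p r (rho n C j + C.gr' r + 1 / 2))) *
  (∏ j ∈ Finset.Icc 1 k, ∏ l ∈ Finset.Icc (j + 1) k,
    (bracket (alpha n 1 C) p 0 (rho n C j + rho n C l) *
      bracket (alpha n 1 C) p 0 (rho n C j + rho n C l + 1)) /
    (bracket (alpha n 1 C) p 0 (rho n C j + rho n C l + C.g) *
      bracket (alpha n 1 C) p 0 (rho n C j + rho n C l + 1 + C.g))) *
  (∏ j ∈ Finset.Icc 1 k, ∏ l ∈ Finset.Icc (j + 1) k,
    (bracket (alpha n 1 C) p 0 (rho n C j - rho n C l) *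
      bracket (alpha n 1 C) p 0 (rho n C j - rho n C l + 1)) /
    (bracket (alpha n 1 C) p 0 (rho n C j - rho n C l + C.g) *
      bracket (alpha n 1 C) p 0 (rho n C j - rho n C l + 1 - C.g))) *
  ∏ j ∈ Finset.Icc 1 k, ∏ l ∈ Finset.Icc (k + 1) n,
    (bracket (alpha n 1 C) p 0 (rho n C j + rho n C l) *
      bracket (alpha n 1 C) p 0 (rho n C j - rho n C l)) /
    (bracket (alpha n 1 C) p 0 (rho n C j + rho n C l + C.g) *
      bracket (alpha n 1 C) p 0 (rho n C j - rho n C l + C.g))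

/-- `N = ∑_{0 ≤ k ≤ n} c_{(1^k)}^2 P_{(1^k)}(x)^2 Δ_{(1^k)}` at the point `x`. -/
noncomputable def colN (n : ℕ) (C : Couplings) (p : ℝ) (x : ℝ) : ℝ :=
  ∑ k ∈ Finset.range (n + 1),
    colC n C p k ^ 2 * (colPoly n C p k).eval x ^ 2 * weight n 1 C p (columnFun n k)

end EllipticRacah

/-! For `m = 1` the partitions form a chain, so `H` is a tridiagonal matrix of size `n + 1`, and its
characteristic polynomial is `colPoly (n + 1)` (`hamiltonian_charpoly`). The truncation value of `α`
and the inequalities on the couplings keep every bracket in the off-diagonal coefficients inside its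
range of positivity (`one_var_pos`, `two_var_pos`). Hence `B_k` and `B_{-k}` are positive, and the
matrix is a Jacobi matrix up to rescaling of the basis.

Most of the theorem is then Jacobi matrix theory. The characteristic polynomial depends only on the
products `B_k B_{-k}`, so it is that of a symmetric matrix and splits over the reals; the confluent
Christoffel–Darboux formula excludes double roots (`triPoly_exists_roots`). The three-term
recurrence makes `c_k P_k(E)` an eigenvector (`eval_triPoly_row`). Christoffel–Darboux gives
orthogonality of the eigenvectors and both forms of their norms. To translate this into the stated
theta products, two quotients are computed: `c_{k+1} / c_k = 1 / B_{k+1}` (`colC_succ`) and `Δ_{k+1}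
/ Δ_k = B_{k+1} / B_{-(k+1)}` (`weight_succ`). The Lagrange polynomial in `H` that defines `h` is a
spectral projection, and the dual orthogonality relations expand `χ` in eigenvectors (`chi_eq_sum`),
which yields `h`.

Two points need more. First, analyticity in `p`: the theta products are holomorphic in the nome, the
removable singularities of the diagonal coefficients cancel explicitly (`colA_eq`), and simple roots
depend analytically on the matrix by the implicit function theorem (`analyticAt_roots`).

Second, the spectrum at `p = 0`. There the matrix is a trigonometric difference operator of
Askey–Wilson type with constant row sums (`diagonal_sum`). In the basis of interpolation products
`nodeProd` it becomes upper bidiagonal (`IsTrigonometric.row`), so the eigenvalues can be read off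
the diagonal (`triPoly_eq`), and they equal the prescribed cosine sums (`eig_eq_trigValue`), which
strictly decrease. Since eigenvalues are simple for every `p`, analytic branches never cross, and
the order at `p = 0` persists for any eigenvalue family. -/

namespace EllipticRacah

open Filter Topology Polynomial

/-! ### Theta products -/

/-- The infinite product part of a normalized Jacobi theta function with nome exponents `e l`, as a
function of the nome `p` and of the cosine `c` of the argument. -/
noncomputable def thetaProd (s : ℝ) (e : ℕ → ℕ) (p c : ℝ) : ℝ :=
  ∏' l : ℕ, (1 + 2 * s * p ^ e l * (c - 1) / (1 + s * p ^ e l) ^ 2)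

section thetaProd

variable {s : ℝ} {e : ℕ → ℕ}

theorem one_sub_le_norm_one_add {q s : ℂ} {R : ℝ} (hs : ‖s‖ = 1) (hR : R < 1) (hq : ‖q‖ ≤ R) {m : ℕ}
    (hm : 1 ≤ m) : 1 - R ≤ ‖1 + s * q ^ m‖ := by
  have h1 : ‖s * q ^ m‖ ≤ R := by
    rw [norm_mul, hs, one_mul, norm_pow]
    calc ‖q‖ ^ m ≤ ‖q‖ ^ 1 := pow_le_pow_of_le_one (norm_nonneg _) (hq.trans hR.le) hm
      _ ≤ R := by simpa using hq
  have h2 : ‖(1 : ℂ)‖ ≤ ‖1 + s * q ^ m‖ + ‖s * q ^ m‖ := by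
    simpa using norm_sub_le (1 + s * q ^ m) (s * q ^ m)
  rw [norm_one] at h2
  linarith

/-- A geometric majorant, uniform for `‖q‖ ≤ R` and `‖c‖ ≤ M`. Assuming only `l ≤ m` and `1 ≤ m` on
the exponent covers the even and the odd nome exponents at once; the complex nome is what gives
holomorphy later. -/
theorem norm_theta_term_le {q s c : ℂ} {R M : ℝ} (hs : ‖s‖ = 1) (hR : R < 1) (hq : ‖q‖ ≤ R)
    (hc : ‖c‖ ≤ M) {m l : ℕ} (hm : 1 ≤ m) (hl : l ≤ m) :
    ‖2 * s * q ^ m * (c - 1) / (1 + s * q ^ m) ^ 2‖ ≤ R ^ l * (2 * (M + 1) / (1 - R) ^ 2) := by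
  have hR0 : 0 ≤ R := (norm_nonneg _).trans hq
  have hM0 : 0 ≤ M := (norm_nonneg _).trans hc
  have h1 := one_sub_le_norm_one_add hs hR hq hm
  have h2 : ‖q‖ ^ m ≤ R ^ l :=
    (pow_le_pow_left₀ (norm_nonneg _) hq m).trans (pow_le_pow_of_le_one hR0 hR.le hl)
  have h3 : ‖c - 1‖ ≤ M + 1 := (norm_sub_le _ _).trans (by simpa using hc)
  have h4 : 0 < 1 - R := by linarith
  rw [norm_div, norm_mul, norm_mul, norm_mul, hs, norm_pow, norm_pow, Complex.norm_ofNat]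
  calc 2 * 1 * ‖q‖ ^ m * ‖c - 1‖ / ‖1 + s * q ^ m‖ ^ 2
      ≤ 2 * 1 * R ^ l * (M + 1) / (1 - R) ^ 2 := by gcongr
    _ = _ := by ring

theorem summable_theta_bound {R M : ℝ} (hR0 : 0 ≤ R) (hR : R < 1) :
    Summable fun l : ℕ => R ^ l * (2 * (M + 1) / (1 - R) ^ 2) :=
  (summable_geometric_of_lt_one hR0 hR).mul_right _

theorem abs_theta_term_le {p c R M : ℝ} (hs : |s| = 1) (hR : R < 1) (hq : |p| ≤ R)
    (hc : |c| ≤ M) {m l : ℕ} (hm : 1 ≤ m) (hl : l ≤ m) :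
    |2 * s * p ^ m * (c - 1) / (1 + s * p ^ m) ^ 2| ≤ R ^ l * (2 * (M + 1) / (1 - R) ^ 2) := by
  have h := norm_theta_term_le (q := (p : ℂ)) (s := (s : ℂ)) (c := (c : ℂ)) (by simpa using hs) hR
    (by simpa using hq) (by simpa using hc) hm hl
  rw [← Real.norm_eq_abs, ← Complex.norm_real]
  simpa using h

/-- For a complex nome in a disc of radius `R < 1` the factors are holomorphic and the product
converges locally uniformly, so the limit is holomorphic. On real nomes it is real and equals
`thetaProd`, hence taking real parts loses nothing. -/
theorem thetaProd_analyticAt (hs : |s| = 1) (he : ∀ l, l ≤ e l) (he1 : ∀ l, 1 ≤ e l) {p c : ℝ}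
    (hp : |p| < 1) : AnalyticAt ℝ (fun p => thetaProd s e p c) p := by
  obtain ⟨R, hpR, hR⟩ := exists_between hp
  have hR0 : 0 ≤ R := (abs_nonneg _).trans hpR.le
  have hs' : ‖(s : ℂ)‖ = 1 := by simpa using hs
  set f : ℕ → ℂ → ℂ := fun l q => 2 * s * q ^ e l * (c - 1) / (1 + s * q ^ e l) ^ 2 with hf
  have hdiff : ∀ l, DifferentiableOn ℂ (f l) (Metric.ball 0 R) := by
    intro l q hq
    have h1 := one_sub_le_norm_one_add hs' hR (by simpa using (mem_ball_zero_iff.1 hq).le) (he1 l)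
    have h2 : (1 + (s : ℂ) * q ^ e l) ^ 2 ≠ 0 := by
      apply pow_ne_zero
      rw [← norm_pos_iff]
      linarith
    have h3 : DifferentiableAt ℂ (fun q : ℂ => 2 * s * q ^ e l * (c - 1)) q := by fun_prop
    have h4 : DifferentiableAt ℂ (fun q : ℂ => (1 + s * q ^ e l) ^ 2) q := by fun_prop
    exact (h3.div h4 h2).differentiableWithinAt
  have hloc : HasProdLocallyUniformlyOn (fun l q => 1 + f l q) (fun q => ∏' l, (1 + f l q))
      (Metric.ball 0 R) := by
    refine Summable.hasProdLocallyUniformlyOn_nat_one_add Metric.isOpen_ball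
      (summable_theta_bound (M := |c|) hR0 hR) (.of_forall fun l q hq => ?_)
      fun l => (hdiff l).continuousOn
    exact norm_theta_term_le hs' hR (mem_ball_zero_iff.1 hq).le (by simp) (he1 l) (he l)
  have hD : DifferentiableOn ℂ (fun q => ∏' l, (1 + f l q)) (Metric.ball 0 R) :=
    hloc.differentiableOn (.of_forall fun t => by
      simpa [Finset.prod_fn] using
        DifferentiableOn.finsetProd (fun l _ => (hdiff l).const_add 1)) Metric.isOpen_ball
  have hA : AnalyticAt ℂ (fun q => ∏' l, (1 + f l q)) (p : ℂ) :=
    hD.analyticAt (Metric.isOpen_ball.mem_nhds (by simpa using hpR))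
  have hB : AnalyticAt ℝ (fun x : ℝ => (∏' l, (1 + f l (x : ℂ))).re) p :=
    (Complex.reCLM.analyticAt _).comp (hA.restrictScalars.comp (Complex.ofRealCLM.analyticAt p))
  refine hB.congr ?_
  have hnear : ∀ᶠ x : ℝ in 𝓝 p, |x| < R := (isOpen_lt continuous_abs continuous_const).mem_nhds hpR
  filter_upwards [hnear] with x hx
  have : (∏' l, (1 + f l (x : ℂ))) = ((thetaProd s e x c : ℝ) : ℂ) := by
    have hm : Multipliable fun l => 1 + 2 * s * x ^ e l * (c - 1) / (1 + s * x ^ e l) ^ 2 := by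
      refine Real.multipliable_one_add_of_summable (Summable.of_norm_bounded
        (summable_theta_bound (M := |c|) hR0 hR)
        fun l => abs_theta_term_le hs hR hx.le le_rfl (he1 l) (he l))
    have := hm.map_tprod Complex.ofRealHom Complex.continuous_ofReal
    simpa [hf, thetaProd] using this.symm
  rw [this, Complex.ofReal_re]

/-- Cosines of real arguments lie in `[-1, 1]`; the interval `(-2, 2)` is merely an open bounded
neighbourhood on which locally uniform convergence applies. -/
theorem thetaProd_continuousOn (hs : |s| = 1) (he : ∀ l, l ≤ e l) (he1 : ∀ l, 1 ≤ e l) {p : ℝ}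
    (hp : |p| < 1) : ContinuousOn (thetaProd s e p) (Set.Ioo (-2) 2) := by
  have hloc : HasProdLocallyUniformlyOn
      (fun l c => 1 + 2 * s * p ^ e l * (c - 1) / (1 + s * p ^ e l) ^ 2)
      (fun c => thetaProd s e p c) (Set.Ioo (-2) 2) := by
    refine Summable.hasProdLocallyUniformlyOn_nat_one_add isOpen_Ioo
      (summable_theta_bound (M := 2) (abs_nonneg p) hp) (.of_forall fun l q hq => ?_)
      fun l => by fun_prop
    exact abs_theta_term_le hs hp le_rfl (abs_le.2 ⟨hq.1.le, hq.2.le⟩) (he1 l) (he l)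
  refine hloc.continuousOn (.of_forall fun t => ?_)
  fun_prop

/-- With `x = s p ^ e l`, each factor is `(1 + 2 x c + x ^ 2) / (1 + x) ^ 2`, whose numerator is at
least `(1 - |x|) ^ 2`. Positivity survives in the limit because the product is the exponential of a
convergent sum of logarithms. -/
theorem thetaProd_pos (hs : |s| = 1) (he : ∀ l, l ≤ e l) (he1 : ∀ l, 1 ≤ e l) {p c : ℝ}
    (hp : |p| < 1) (hc : |c| ≤ 1) : 0 < thetaProd s e p c := by
  have hpos : ∀ l, 0 < 1 + 2 * s * p ^ e l * (c - 1) / (1 + s * p ^ e l) ^ 2 := by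
    intro l
    set x := s * p ^ e l with hx
    have hx1 : |x| < 1 := by
      rw [hx, abs_mul, hs, one_mul, abs_pow]
      exact pow_lt_one₀ (abs_nonneg _) hp (by have := he1 l; omega)
    have hx2 := abs_lt.1 hx1
    have hc2 := abs_le.1 hc
    have h3 : 0 < (1 + x) ^ 2 := by nlinarith
    have h4 : 0 < 1 + 2 * x * c + x ^ 2 := by
      have h6 : |x * c| ≤ |x| := by
        rw [abs_mul]
        exact mul_le_of_le_one_right (abs_nonneg _) hc
      nlinarith [(abs_le.1 h6).1, sq_abs x]
    have h5 : 1 + 2 * s * p ^ e l * (c - 1) / (1 + x) ^ 2 = (1 + 2 * x * c + x ^ 2) / (1 + x) ^ 2 := by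
      rw [eq_div_iff h3.ne', add_mul, div_mul_cancel₀ _ h3.ne', hx]
      ring
    rw [h5]
    positivity
  have hsum : Summable fun l => 2 * s * p ^ e l * (c - 1) / (1 + s * p ^ e l) ^ 2 :=
    Summable.of_norm_bounded (summable_theta_bound (M := 1) (abs_nonneg p) hp)
      fun l => abs_theta_term_le hs hp le_rfl hc (he1 l) (he l)
  rw [thetaProd, ← Real.rexp_tsum_eq_tprod hpos (Real.summable_log_one_add_of_summable hsum)]
  exact Real.exp_pos _

@[simp] theorem thetaProd_zero (he1 : ∀ l, 1 ≤ e l) (c : ℝ) : thetaProd s e 0 c = 1 := by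
  have : ∀ l, (0 : ℝ) ^ e l = 0 := fun l => zero_pow (by have := he1 l; omega)
  simp [thetaProd, this]

end thetaProd

/-- The trigonometric factor of `bracket`. -/
noncomputable def trigFactor (α : ℝ) (r : Fin 4) (z : ℝ) : ℝ :=
  ![Real.sin (α / 2 * z) / Real.sin (α / 2), Real.cos (α / 2 * z), 1, 1] r

/-- The infinite product factor of `bracket`. -/
noncomputable def prodFactor (α p : ℝ) (r : Fin 4) (z : ℝ) : ℝ :=
  thetaProd (![-1, 1, 1, -1] r)
    ((![fun l => 2 * (l + 1), fun l => 2 * (l + 1), fun l => 2 * l + 1, fun l => 2 * l + 1] :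
      Fin 4 → ℕ → ℕ) r) p (Real.cos (α * z))

/-- Passes between the usual theta factor and the form "one plus a summable term" that the
convergence theorems require. -/
theorem theta_term_eq {s x c : ℝ} (h : 1 + s * x ≠ 0) (hs : s ^ 2 = 1) :
    1 + 2 * s * x * (c - 1) / (1 + s * x) ^ 2 = (1 + 2 * s * x * c + x ^ 2) / (1 + s * x) ^ 2 := by
  rw [eq_div_iff (pow_ne_zero 2 h), add_mul, div_mul_cancel₀ _ (pow_ne_zero 2 h)]
  linear_combination x ^ 2 * hs

/-- The trigonometric factor carries all zeros and signs, while the other factor is positive for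
real arguments. Nonvanishing questions thereby become questions about sine and cosine, independent
of `p`. -/
theorem bracket_eq_mul {α p : ℝ} (hp : |p| < 1) (r : Fin 4) (z : ℝ) :
    bracket α p r z = trigFactor α r z * prodFactor α p r z := by
  have hx : ∀ m : ℕ, 1 ≤ m → |p ^ m| < 1 := fun m hm => by
    rw [abs_pow]
    exact pow_lt_one₀ (abs_nonneg _) hp (by omega)
  have h1 : ∀ m : ℕ, 1 ≤ m → 1 + 1 * p ^ m ≠ 0 := fun m hm => by
    have := (abs_lt.1 (hx m hm)).1
    linarith
  have h2 : ∀ m : ℕ, 1 ≤ m → 1 + (-1) * p ^ m ≠ 0 := fun m hm => by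
    have := (abs_lt.1 (hx m hm)).2
    linarith
  fin_cases r
  · simp only [bracket, trigFactor, prodFactor, thetaProd, Fin.zero_eta, Matrix.cons_val_zero]
    congr 1
    refine tprod_congr fun l => ?_
    rw [theta_term_eq (h2 _ (by omega)) (by norm_num)]
    congr 1 <;> ring
  · simp only [bracket, trigFactor, prodFactor, thetaProd, Fin.mk_one, Matrix.cons_val_one,
      Matrix.cons_val_zero]
    congr 1
    refine tprod_congr fun l => ?_
    rw [theta_term_eq (h1 _ (by omega)) (by norm_num)]
    congr 1 <;> ring
  · simp only [bracket, trigFactor, prodFactor, thetaProd, Fin.reduceFinMk, Matrix.cons_val, one_mul]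
    refine tprod_congr fun l => ?_
    have h := theta_term_eq (c := Real.cos (α * z)) (h1 (2 * l + 1) (by omega)) (by norm_num)
    rw [one_mul, mul_one] at h
    rw [mul_one, h]
    (congr 1; ring)
  · simp only [bracket, trigFactor, prodFactor, thetaProd, Fin.reduceFinMk, Matrix.cons_val, one_mul]
    refine tprod_congr fun l => ?_
    rw [theta_term_eq (h2 _ (by omega)) (by norm_num)]
    congr 1 <;> ring

theorem prodFactor_pos {α p : ℝ} (hp : |p| < 1) (r : Fin 4) (z : ℝ) : 0 < prodFactor α p r z := by
  fin_cases r <;>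
    exact thetaProd_pos (by simp) (fun l => by simp; omega) (fun l => by simp; try omega) hp
      (Real.abs_cos_le_one _)

theorem prodFactor_analyticAt {α p : ℝ} (hp : |p| < 1) (r : Fin 4) (z : ℝ) :
    AnalyticAt ℝ (fun p => prodFactor α p r z) p := by
  fin_cases r <;>
    exact thetaProd_analyticAt (by simp) (fun l => by simp; omega) (fun l => by simp; try omega) hp

theorem prodFactor_continuous {α p : ℝ} (hp : |p| < 1) (r : Fin 4) :
    Continuous (prodFactor α p r) := by
  have hmem : ∀ z, Real.cos (α * z) ∈ Set.Ioo (-2 : ℝ) 2 := fun z =>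
    ⟨by linarith [Real.neg_one_le_cos (α * z)], by linarith [Real.cos_le_one (α * z)]⟩
  fin_cases r <;>
    exact (thetaProd_continuousOn (by simp) (fun l => by simp; omega)
      (fun l => by simp; try omega) hp).comp_continuous (by fun_prop) hmem

theorem prodFactor_zero (α : ℝ) (r : Fin 4) (z : ℝ) : prodFactor α 0 r z = 1 := by
  fin_cases r <;> exact thetaProd_zero (fun l => by simp; try omega) _

theorem trigFactor_continuous (α : ℝ) (r : Fin 4) : Continuous (trigFactor α r) := by
  fin_cases r
  · exact (Real.continuous_sin.comp (continuous_const.mul continuous_id)).div_const _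
  · exact Real.continuous_cos.comp (continuous_const.mul continuous_id)
  · exact continuous_const
  · exact continuous_const

theorem bracket_continuous {α p : ℝ} (hp : |p| < 1) (r : Fin 4) : Continuous (bracket α p r) := by
  rw [funext (bracket_eq_mul hp r)]
  exact (trigFactor_continuous α r).mul (prodFactor_continuous hp r)

theorem bracket_analyticAt {α p : ℝ} (hp : |p| < 1) (r : Fin 4) (z : ℝ) :
    AnalyticAt ℝ (fun p => bracket α p r z) p := by
  have h : AnalyticAt ℝ (fun p => trigFactor α r z * prodFactor α p r z) p :=
    analyticAt_const.mul (prodFactor_analyticAt hp r z)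
  refine h.congr ?_
  filter_upwards [(isOpen_lt continuous_abs continuous_const).mem_nhds hp] with x hx
  exact (bracket_eq_mul hx r z).symm

theorem bracket_at_zero (α : ℝ) (r : Fin 4) (z : ℝ) : bracket α 0 r z = trigFactor α r z := by
  rw [bracket_eq_mul (by simp), prodFactor_zero, mul_one]

theorem bracket_zero_neg (α p : ℝ) (z : ℝ) : bracket α p 0 (-z) = -bracket α p 0 z := by
  simp [bracket, neg_div]

theorem bracket_zero_pos {α p : ℝ} (hα : 0 < α) (hα' : α < Real.pi) (hp : |p| < 1) {z : ℝ}
    (h0 : 0 < z) (h1 : z < 2 * (Real.pi / α)) : 0 < bracket α p 0 z := by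
  rw [bracket_eq_mul hp]
  refine mul_pos (div_pos (Real.sin_pos_of_pos_of_lt_pi (by positivity) ?_)
    (Real.sin_pos_of_pos_of_lt_pi (by positivity) (by linarith))) (prodFactor_pos hp _ _)
  calc α / 2 * z < α / 2 * (2 * (Real.pi / α)) := by gcongr
    _ = Real.pi := by field_simp

theorem bracket_one_pos {α p : ℝ} (hα : 0 < α) (hp : |p| < 1) {z : ℝ}
    (h0 : -(Real.pi / α) < z) (h1 : z < Real.pi / α) : 0 < bracket α p 1 z := by
  rw [bracket_eq_mul hp]
  refine mul_pos (Real.cos_pos_of_mem_Ioo ⟨?_, ?_⟩) (prodFactor_pos hp _ _)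
  · calc -(Real.pi / 2) = α / 2 * (-(Real.pi / α)) := by field_simp
      _ < α / 2 * z := by gcongr
  · calc α / 2 * z < α / 2 * (Real.pi / α) := by gcongr
      _ = Real.pi / 2 := by field_simp

theorem bracket_two_three_pos {α p : ℝ} (hp : |p| < 1) {r : Fin 4} (hr : 2 ≤ r) (z : ℝ) :
    0 < bracket α p r z := by
  rw [bracket_eq_mul hp]
  fin_cases r
  · simp at hr
  · simp at hr
  · simpa [trigFactor] using prodFactor_pos hp 2 z
  · simpa [trigFactor] using prodFactor_pos hp 3 z

end EllipticRacah

namespace EllipticRacah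

open Filter Topology Polynomial

/-! ### Tridiagonal matrices -/

/-- The `k × k` tridiagonal matrix with diagonal `A 0, …, A (k - 1)`, superdiagonal
`B 1, …, B (k - 1)` and subdiagonal `D 1, …, D (k - 1)`. -/
def tri {R : Type*} [Zero R] (A B D : ℕ → R) (k : ℕ) : Matrix (Fin k) (Fin k) R :=
  Matrix.of fun i j =>
    if (j : ℕ) = i then A i
    else if (j : ℕ) = i + 1 then B j
    else if (i : ℕ) = j + 1 then D i
    else 0

theorem tri_submatrix {R : Type*} [Zero R] (A B D : ℕ → R) {k m : ℕ} {f g : Fin m → Fin k}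
    (hf : ∀ i, (f i : ℕ) = i) (hg : ∀ i, (g i : ℕ) = i) :
    (tri A B D k).submatrix f g = tri A B D m := by
  ext i j
  simp [tri, hf, hg]

/-- Laplace expansion along the last row leaves two entries. The minor belonging to the subdiagonal
entry has a single nonzero entry in its last column, and expanding there gives `B (k + 1)` times the
determinant two sizes down. -/
theorem det_tri_add_two {R : Type*} [CommRing R] (A B D : ℕ → R) (k : ℕ) :
    (tri A B D (k + 2)).det =
      A (k + 1) * (tri A B D (k + 1)).det - B (k + 1) * D (k + 1) * (tri A B D k).det := by
  have hminor : ((tri A B D (k + 2)).submatrix (Fin.last (k + 1)).succAbove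
      (Fin.last k).castSucc.succAbove).det = B (k + 1) * (tri A B D k).det := by
    have h1 : (Fin.last k).castSucc.succAbove (Fin.last k) = Fin.last (k + 1) := by
      rw [Fin.succAbove_of_le_castSucc _ _ le_rfl, Fin.succ_last]
    have h2 : ∀ i : Fin k, (((Fin.last k).castSucc.succAbove i.castSucc : Fin (k + 2)) : ℕ) = i := by
      intro i
      rw [Fin.succAbove_of_castSucc_lt _ _ (by simp [Fin.lt_def])]
      simp
    have h4 : ∀ i : Fin k, ((((Fin.last k).castSucc.succAbove ∘ (Fin.last k).succAbove) i :
        Fin (k + 2)) : ℕ) = i := by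
      intro i
      rw [Function.comp_apply, Fin.succAbove_last, h2]
    rw [Matrix.det_succ_column _ (Fin.last k), Fin.sum_univ_castSucc, Finset.sum_eq_zero, zero_add,
      Matrix.submatrix_submatrix,
      tri_submatrix A B D (m := k) (f := (Fin.last (k + 1)).succAbove ∘ (Fin.last k).succAbove)
        (g := (Fin.last k).castSucc.succAbove ∘ (Fin.last k).succAbove) (by simp) h4]
    · have h3 : tri A B D (k + 2) (Fin.last k).castSucc (Fin.last (k + 1)) = B (k + 1) := by
        simp [tri]
      rw [Matrix.submatrix_apply, h1, Fin.succAbove_last, h3]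
      simp [← two_mul]
    · intro i _
      have h1 : (Fin.last k).castSucc.succAbove (Fin.last k) = Fin.last (k + 1) := by
        rw [Fin.succAbove_of_le_castSucc _ _ le_rfl, Fin.succ_last]
      have hi := i.2
      have h2 : ¬ (k + 1 = (i : ℕ)) := by omega
      have h3 : ¬ (k = (i : ℕ)) := by omega
      have h4 : ¬ ((i : ℕ) = k + 1 + 1) := by omega
      simp [tri, h1, h2, h3, h4]
  rw [Matrix.det_succ_row _ (Fin.last (k + 1)), Fin.sum_univ_castSucc, Fin.sum_univ_castSucc,
    Finset.sum_eq_zero, zero_add, hminor, tri_submatrix _ _ _ (by simp) (by simp)]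
  · have h2 : ¬ (k = k + 1 + 1) := by omega
    have h3 : (-1 : R) ^ (k + 1 + k) = -1 := by
      rw [show k + 1 + k = 2 * k + 1 by ring]
      simp [pow_succ, pow_mul]
    simp [tri, h2, h3, ← two_mul]
    ring
  · intro i _
    have hi := i.2
    have h2 : ¬ ((i : ℕ) = k + 1) := by omega
    have h3 : ¬ ((i : ℕ) = k + 1 + 1) := by omega
    have h4 : ¬ (k = (i : ℕ)) := by omega
    simp [tri, h2, h3, h4]

/-- The characteristic polynomial of `tri A B D k`. -/
noncomputable def triPoly (A B D : ℕ → ℝ) (k : ℕ) : ℝ[X] := (tri A B D k).charpoly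

theorem charmatrix_tri (A B D : ℕ → ℝ) (k : ℕ) :
    (tri A B D k).charmatrix =
      tri (fun i => X - C (A i)) (fun i => -C (B i)) (fun i => -C (D i)) k := by
  ext1 i j
  rw [Matrix.charmatrix_apply]
  by_cases hij : i = j
  · subst hij
    simp [tri]
  · have h1 : ¬ ((j : ℕ) = i) := fun h => hij (Fin.ext h.symm)
    simp only [tri, Matrix.of_apply, h1, if_false, Matrix.diagonal_apply_ne _ hij, zero_sub]
    split_ifs <;> simp

variable {A B D : ℕ → ℝ}

@[simp] theorem triPoly_zero : triPoly A B D 0 = 1 := by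
  simp [triPoly, Matrix.charpoly]

@[simp] theorem triPoly_one : triPoly A B D 1 = X - C (A 0) := by
  rw [triPoly, Matrix.charpoly, charmatrix_tri, Matrix.det_fin_one]
  simp [tri]

theorem triPoly_add_two (k : ℕ) :
    triPoly A B D (k + 2) = (X - C (A (k + 1))) * triPoly A B D (k + 1) -
      C (B (k + 1) * D (k + 1)) * triPoly A B D k := by
  simp only [triPoly, Matrix.charpoly, charmatrix_tri, det_tri_add_two, C_mul, neg_mul_neg]

/-- The recurrence sees the off-diagonals only through the products `B j * D j`. Two consecutive
degrees are carried along because the recurrence has order two. -/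
theorem triPoly_congr {B' D' : ℕ → ℝ} {n : ℕ}
    (h : ∀ j, 1 ≤ j → j ≤ n → B j * D j = B' j * D' j) :
    ∀ k ≤ n, triPoly A B D k = triPoly A B' D' k ∧
      triPoly A B D (k + 1) = triPoly A B' D' (k + 1)
  | 0, _ => by simp
  | k + 1, hk => by
    obtain ⟨h1, h2⟩ := triPoly_congr h k (by omega)
    refine ⟨h2, ?_⟩
    rw [triPoly_add_two, triPoly_add_two, h1, h2, h (k + 1) (by omega) hk]

theorem tri_isHermitian (A b : ℕ → ℝ) (k : ℕ) : (tri A b b k).IsHermitian := by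
  ext i j
  simp only [Matrix.conjTranspose_apply, tri, Matrix.of_apply, star_trivial]
  by_cases h1 : (i : ℕ) = j
  · simp [h1]
  · have h1' : ¬ ((j : ℕ) = i) := fun h => h1 h.symm
    simp only [h1, h1', if_false]
    by_cases h2 : (i : ℕ) = j + 1
    · have h3 : ¬ ((j : ℕ) = i + 1) := by omega
      rw [if_pos h2, if_neg h3, if_pos h2]
    · by_cases h3 : (j : ℕ) = i + 1
      · rw [if_neg h2, if_pos h3, if_pos h3]
      · simp [h2, h3]

/-- Replacing both off-diagonals by `√(B j * D j)` keeps the characteristic polynomial and makes the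
matrix symmetric, so the spectral theorem applies. -/
theorem triPoly_splits {n : ℕ} (h : ∀ j, 1 ≤ j → j ≤ n → 0 < B j * D j) :
    (triPoly A B D (n + 1)).Splits := by
  rw [(triPoly_congr (B' := fun j => Real.sqrt (B j * D j)) (D' := fun j => Real.sqrt (B j * D j))
    (fun j h1 h2 => (Real.mul_self_sqrt (h j h1 h2).le).symm) n le_rfl).2]
  exact (tri_isHermitian A (fun j => Real.sqrt (B j * D j)) (n + 1)).splits_charpoly

section ChristoffelDarboux

variable {n : ℕ} {w : ℕ → ℝ}

/-- The weights are `w k = ∏_{j ≤ k} (B j * D j)⁻¹`, written as a recursion without division.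
Induction on `k`: the recurrence at `x` and at `y` makes the diagonal coefficients cancel. -/
theorem christoffel_darboux (hw0 : w 0 = 1)
    (hw : ∀ k < n, w (k + 1) * (B (k + 1) * D (k + 1)) = w k) (x y : ℝ) :
    ∀ k ≤ n, (x - y) * ∑ i ∈ Finset.range (k + 1),
      w i * ((triPoly A B D i).eval x * (triPoly A B D i).eval y) =
      w k * ((triPoly A B D (k + 1)).eval x * (triPoly A B D k).eval y -
        (triPoly A B D k).eval x * (triPoly A B D (k + 1)).eval y)
  | 0, _ => by simp [hw0]
  | k + 1, hk => by
    rw [Finset.sum_range_succ, mul_add, christoffel_darboux hw0 hw x y k (by omega),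
      triPoly_add_two, ← hw k (by omega)]
    simp only [eval_sub, eval_mul, eval_X, eval_C]
    ring

theorem christoffel_darboux_confluent (hw0 : w 0 = 1)
    (hw : ∀ k < n, w (k + 1) * (B (k + 1) * D (k + 1)) = w k) (x : ℝ) :
    ∀ k ≤ n, ∑ i ∈ Finset.range (k + 1), w i * (triPoly A B D i).eval x ^ 2 =
      w k * ((derivative (triPoly A B D (k + 1))).eval x * (triPoly A B D k).eval x -
        (derivative (triPoly A B D k)).eval x * (triPoly A B D (k + 1)).eval x)
  | 0, _ => by simp [hw0]
  | k + 1, hk => by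
    rw [Finset.sum_range_succ, christoffel_darboux_confluent hw0 hw x k (by omega),
      triPoly_add_two, ← hw k (by omega)]
    simp only [eval_sub, eval_mul, eval_X, eval_C, derivative_sub, derivative_mul, derivative_X,
      derivative_C, eval_add, eval_one, eval_zero]
    ring

end ChristoffelDarboux

theorem triPoly_monic (k : ℕ) : (triPoly A B D k).Monic := Matrix.charpoly_monic _

theorem triPoly_natDegree (k : ℕ) : (triPoly A B D k).natDegree = k := by
  simp [triPoly]

/-- The norms of the eigenvectors of a Jacobi matrix are positive. -/
theorem sum_weight_pos {n : ℕ} {w : ℕ → ℝ} (hw0 : w 0 = 1) (hwpos : ∀ k ≤ n, 0 < w k) (x : ℝ) :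
    0 < ∑ i ∈ Finset.range (n + 1), w i * (triPoly A B D i).eval x ^ 2 := by
  refine Finset.sum_pos' (fun i hi => ?_) ⟨0, by simp, by simp [hw0]⟩
  exact mul_nonneg (hwpos i (by simpa [Nat.lt_succ_iff] using hi)).le (sq_nonneg _)

theorem exists_weights {n : ℕ} (h : ∀ j, 1 ≤ j → j ≤ n → 0 < B j * D j) :
    ∃ w : ℕ → ℝ, w 0 = 1 ∧ (∀ k ≤ n, 0 < w k) ∧
      ∀ k < n, w (k + 1) * (B (k + 1) * D (k + 1)) = w k := by
  refine ⟨fun k => ∏ j ∈ Finset.range k, (B (j + 1) * D (j + 1))⁻¹, by simp, fun k hk => ?_,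
    fun k hk => ?_⟩
  · refine Finset.prod_pos fun j hj => inv_pos.2 (h _ (by omega) ?_)
    have := Finset.mem_range.1 hj
    omega
  · simp only
    rw [Finset.prod_range_succ, mul_assoc, inv_mul_cancel₀ (h _ (by omega) (by omega)).ne', mul_one]

/-- The characteristic polynomial of a Jacobi matrix has simple real roots. -/
theorem triPoly_exists_roots {n : ℕ} (h : ∀ j, 1 ≤ j → j ≤ n → 0 < B j * D j) :
    ∃ r : Fin (n + 1) → ℝ, StrictAnti r ∧ triPoly A B D (n + 1) = ∏ i, (X - C (r i)) := by
  obtain ⟨w, hw0, hwpos, hw⟩ := exists_weights h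
  set P := triPoly A B D (n + 1) with hP
  have hP0 : P ≠ 0 := (triPoly_monic _).ne_zero
  have hnd : P.roots.Nodup := by
    rw [Multiset.nodup_iff_count_le_one]
    intro a
    rw [count_roots]
    -- At a double root both `P` and its derivative vanish, so the confluent Christoffel–Darboux
    -- formula would make a positive sum equal to zero.
    by_contra! hlt
    obtain ⟨h1, h2⟩ := (one_lt_rootMultiplicity_iff_isRoot hP0).1 hlt
    have h3 := christoffel_darboux_confluent (A := A) hw0 hw a n le_rfl
    have h4 := sum_weight_pos (A := A) (B := B) (D := D) hw0 hwpos a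
    rw [h3, ← hP, h1.eq_zero, h2.eq_zero] at h4
    simp at h4
  have hsplit : P.Splits := triPoly_splits h
  have hcard : P.roots.toFinset.card = n + 1 := by
    rw [Multiset.toFinset_card_of_nodup hnd, ← hsplit.natDegree_eq_card_roots, hP,
      triPoly_natDegree]
  set f := P.roots.toFinset.orderEmbOfFin hcard
  -- The order embedding lists the roots increasingly; reversing the index gives the decreasing
  -- order.
  refine ⟨fun i => f i.rev, fun i j hij => f.strictMono (Fin.rev_lt_rev.2 hij), ?_⟩
  have h1 : ∏ i : Fin (n + 1), (X - C (f i.rev)) = ∏ a ∈ P.roots.toFinset, (X - C a) := by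
    rw [← Finset.image_orderEmbOfFin_univ P.roots.toFinset hcard,
      Finset.prod_image (fun i _ j _ hij => f.injective hij)]
    exact Equiv.prod_comp Fin.revPerm fun i => X - C (f i)
  rw [h1, Finset.prod, Multiset.toFinset_val, hnd.dedup]
  have := hsplit.eq_prod_roots
  rw [(triPoly_monic (n + 1)).leadingCoeff, C_1, one_mul] at this
  exact this

/-- The eigenvector equation of a tridiagonal matrix, in terms of the characteristic polynomials. -/
theorem eval_triPoly_row {n : ℕ} {x : ℝ} (hx : (triPoly A B D (n + 1)).eval x = 0)
    {c : ℕ → ℝ} (hc : ∀ k < n, c (k + 1) * B (k + 1) = c k) (k : ℕ) (hk : k ≤ n) :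
    A k * (c k * (triPoly A B D k).eval x) +
      ((if k < n then B (k + 1) * (c (k + 1) * (triPoly A B D (k + 1)).eval x) else 0) +
       (if 1 ≤ k then D k * (c (k - 1) * (triPoly A B D (k - 1)).eval x) else 0)) =
      x * (c k * (triPoly A B D k).eval x) := by
  have h1 : (if k < n then B (k + 1) * (c (k + 1) * (triPoly A B D (k + 1)).eval x) else 0) =
      c k * (triPoly A B D (k + 1)).eval x := by
    split_ifs with h
    · rw [← hc k h]
      ring
    · rw [show k = n by omega, hx, mul_zero]
  rw [h1]
  rcases k with _ | k
  · simp
    ring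
  · rw [if_pos (by omega), Nat.add_sub_cancel, triPoly_add_two, ← hc k (by omega)]
    simp only [eval_sub, eval_mul, eval_X, eval_C]
    ring

end EllipticRacah

namespace EllipticRacah

open Filter Topology Polynomial
open scoped ContDiff

/-! ### Analytic dependence of simple eigenvalues -/

/-- The index map `i ↦ j` is a strictly monotone self-map of `Fin N`, hence the identity. This
identifies two sorted lists of roots of one polynomial. -/
theorem strictAnti_unique_of_subset {N : ℕ} {f g : Fin N → ℝ} (hf : StrictAnti f) (hg : StrictAnti g)
    (h : ∀ i, ∃ j, f i = g j) : f = g := by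
  choose s hs using h
  have hsm : StrictMono s := fun i j hij => by
    rw [← hg.lt_iff_gt, ← hs, ← hs]
    exact hf hij
  have hsurj : Function.Surjective s := Finite.surjective_of_injective hsm.injective
  have hid : s = id := (hsm.range_inj strictMono_id).1 (by simp [hsurj.range_eq])
  funext i
  rw [hs, hid, id]

/-- This is the implicit function theorem in the smoothness class `ω`; in one unknown, invertibility
of the partial derivative means `d ≠ 0`. -/
theorem exists_analyticAt_root {f : ℝ × ℝ → ℝ} {p x d : ℝ} (hf : AnalyticAt ℝ f (p, x))
    (h0 : f (p, x) = 0) (hd : HasDerivAt (fun y => f (p, y)) d x) (hd0 : d ≠ 0) :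
    ∃ φ : ℝ → ℝ, AnalyticAt ℝ φ p ∧ φ p = x ∧ ∀ᶠ q in 𝓝 p, f (q, φ q) = 0 := by
  have hω : ContDiffAt ℝ ω f (p, x) := hf.contDiffAt
  have hinr : HasDerivAt (fun y : ℝ => (p, y)) ((0 : ℝ), (1 : ℝ)) x :=
    (hasDerivAt_const x p).prodMk (hasDerivAt_id x)
  have h1 : HasDerivAt (fun y => f (p, y)) (fderiv ℝ f (p, x) (0, 1)) x :=
    HasFDerivAt.comp_hasDerivAt x (f := fun y : ℝ => (p, y)) hf.differentiableAt.hasFDerivAt hinr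
  have hval : fderiv ℝ f (p, x) (0, 1) = d := h1.unique hd
  have hinv : (fderiv ℝ f (p, x) ∘L .inr ℝ ℝ ℝ).IsInvertible := by
    refine ⟨ContinuousLinearEquiv.unitsEquivAut ℝ (Units.mk0 d hd0), ?_⟩
    ext
    simp [hval]
  refine ⟨hω.implicitFunction (by simp) hinv, ?_, hω.implicitFunction_apply_self (by simp) hinv, ?_⟩
  · exact (hω.contDiffAt_implicitFunction (by simp) hinv).analyticAt
  · have := hω.eventually_apply_implicitFunction (by simp) hinv
    rwa [h0] at this

theorem analyticAt_eval_triPoly {A B D : ℕ → ℝ → ℝ} {n : ℕ} {p x : ℝ}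
    (hA : ∀ k ≤ n, AnalyticAt ℝ (A k) p)
    (hBD : ∀ k, 1 ≤ k → k ≤ n → AnalyticAt ℝ (fun q => B k q * D k q) p) :
    ∀ k ≤ n, AnalyticAt ℝ (fun z : ℝ × ℝ =>
        (triPoly (fun i => A i z.1) (fun i => B i z.1) (fun i => D i z.1) k).eval z.2) (p, x) ∧
      AnalyticAt ℝ (fun z : ℝ × ℝ =>
        (triPoly (fun i => A i z.1) (fun i => B i z.1) (fun i => D i z.1) (k + 1)).eval z.2) (p, x)
  | 0, _ => by
    have h0 : AnalyticAt ℝ (fun z : ℝ × ℝ => A 0 z.1) (p, x) :=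
      AnalyticAt.fun_comp (f := Prod.fst) (g := A 0) (x := (p, x)) (hA 0 (by omega)) analyticAt_fst
    simp only [triPoly_zero, eval_one, zero_add, triPoly_one, eval_sub, eval_X, eval_C]
    exact ⟨analyticAt_const, analyticAt_snd.sub h0⟩
  | k + 1, hk => by
    obtain ⟨h1, h2⟩ := analyticAt_eval_triPoly (x := x) hA hBD k (by omega)
    refine ⟨h2, ?_⟩
    have h3 : AnalyticAt ℝ (fun z : ℝ × ℝ => A (k + 1) z.1) (p, x) :=
      AnalyticAt.fun_comp (f := Prod.fst) (g := A (k + 1)) (x := (p, x)) (hA _ hk) analyticAt_fst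
    have h4 : AnalyticAt ℝ (fun z : ℝ × ℝ => B (k + 1) z.1 * D (k + 1) z.1) (p, x) :=
      AnalyticAt.fun_comp (f := Prod.fst) (g := fun q => B (k + 1) q * D (k + 1) q) (x := (p, x))
        (hBD _ (by omega) hk) analyticAt_fst
    simp only [triPoly_add_two, eval_sub, eval_mul, eval_X, eval_C]
    exact ((analyticAt_snd.sub h3).mul h2).sub (h4.mul h1)

/-- Simple real roots, ordered by size, of a polynomial that depends analytically on a parameter,
depend analytically on the parameter. -/
theorem analyticAt_roots {N : ℕ} {P : ℝ → ℝ[X]} {r : Fin N → ℝ → ℝ} {p : ℝ}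
    (hP : ∀ x, AnalyticAt ℝ (fun z : ℝ × ℝ => (P z.1).eval z.2) (p, x))
    (hr : ∀ᶠ q in 𝓝 p, (StrictAnti fun i => r i q) ∧ P q = ∏ i, (X - C (r i q))) (i : Fin N) :
    AnalyticAt ℝ (r i) p := by
  obtain ⟨hanti, hprod⟩ := hr.self_of_nhds
  have key : ∀ i, ∃ φ : ℝ → ℝ, AnalyticAt ℝ φ p ∧ φ p = r i p ∧ ∀ᶠ q in 𝓝 p, (P q).eval (φ q) = 0 := by
    intro i
    -- The derivative at the root is the product of its differences with the other roots, nonzero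
    -- because the roots are distinct.
    refine exists_analyticAt_root (hP (r i p)) ?_ ((P p).hasDerivAt (r i p)) ?_
    · simp only [hprod, eval_prod]
      exact Finset.prod_eq_zero (Finset.mem_univ i) (by simp)
    · rw [hprod, derivative_prod_finset, eval_finsetSum, Finset.sum_eq_single i]
      · rw [eval_mul, eval_prod]
        simp only [derivative_sub, derivative_X, derivative_C, sub_zero, eval_one, mul_one, eval_sub,
          eval_X, eval_C]
        refine Finset.prod_ne_zero_iff.2 fun j hj => sub_ne_zero.2 fun h => ?_
        exact (Finset.ne_of_mem_erase hj) (hanti.injective h.symm)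
      · intro j _ hj
        rw [eval_mul, eval_prod, Finset.prod_eq_zero (Finset.mem_erase.2 ⟨hj.symm, Finset.mem_univ i⟩),
          zero_mul]
        simp
      · simp
  choose φ hφ hφp hφ0 using key
  refine (hφ i).congr ?_
  -- By continuity the local branches remain strictly ordered near `p`; being sorted roots of `P q`,
  -- they must coincide with `r`.
  have hlt : ∀ᶠ q in 𝓝 p, StrictAnti fun i => φ i q := by
    have h1 : ∀ a b : Fin N, a < b → ∀ᶠ q in 𝓝 p, φ b q < φ a q := fun a b hab =>
      (hφ b).continuousAt.eventually_lt (hφ a).continuousAt (by rw [hφp, hφp]; exact hanti hab)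
    have h2 : ∀ᶠ q in 𝓝 p, ∀ a b : Fin N, a < b → φ b q < φ a q := by
      simp only [eventually_all]
      exact h1
    filter_upwards [h2] with q hq
    exact fun a b hab => hq a b hab
  filter_upwards [hlt, hr, eventually_all.2 hφ0] with q h1 h2 h3
  refine congrFun (strictAnti_unique_of_subset h1 h2.1 fun j => ?_) i
  have h4 := h3 j
  rw [h2.2, eval_prod, Finset.prod_eq_zero_iff] at h4
  obtain ⟨k, _, hk⟩ := h4
  exact ⟨k, by simpa [sub_eq_zero] using hk⟩

end EllipticRacah

namespace EllipticRacah

open Filter Topology Polynomial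

/-! ### Products over index ranges -/

section ProductRanges

variable {M : Type*} [CommMonoid M]

theorem prod_fin_eq_prod_Icc (n : ℕ) (F : ℕ → M) :
    ∏ i : Fin n, F ((i : ℕ) + 1) = ∏ j ∈ Finset.Icc 1 n, F j := by
  refine Finset.prod_bij (fun i _ => (i : ℕ) + 1) (fun i _ => ?_) (fun i _ j _ h => ?_)
    (fun b hb => ?_) fun i _ => rfl
  · have := i.2
    simp only [Finset.mem_Icc]
    omega
  · exact Fin.ext (by simpa using h)
  · rw [Finset.mem_Icc] at hb
    exact ⟨⟨b - 1, by omega⟩, Finset.mem_univ _, by simp; omega⟩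

theorem prod_erase_eq_prod_Icc {n k : ℕ} (hk : k < n) (F : ℕ → M) :
    ∏ i ∈ Finset.univ.erase (⟨k, hk⟩ : Fin n), F ((i : ℕ) + 1) =
      (∏ j ∈ Finset.Icc 1 k, F j) * ∏ j ∈ Finset.Icc (k + 2) n, F j := by
  rw [← Finset.prod_union (by
    rw [Finset.disjoint_left]
    intro j h1 h2
    rw [Finset.mem_Icc] at h1 h2
    omega)]
  refine Finset.prod_bij (fun i _ => (i : ℕ) + 1) (fun i hi => ?_) (fun i _ j _ h => ?_)
    (fun b hb => ?_) fun i _ => rfl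
  · have h1 := i.2
    have h2 : (i : ℕ) ≠ k := fun h => Finset.ne_of_mem_erase hi (Fin.ext h)
    simp only [Finset.mem_union, Finset.mem_Icc]
    omega
  · exact Fin.ext (by simpa using h)
  · rw [Finset.mem_union, Finset.mem_Icc, Finset.mem_Icc] at hb
    refine ⟨⟨b - 1, by omega⟩, Finset.mem_erase.2 ⟨fun h => ?_, Finset.mem_univ _⟩, by simp; omega⟩
    have := Fin.mk.inj_iff.1 h
    omega

theorem prod_Ioi_eq_prod_Icc {n : ℕ} (j : Fin n) (F : ℕ → M) :
    ∏ i ∈ Finset.Ioi j, F ((i : ℕ) + 1) = ∏ l ∈ Finset.Icc ((j : ℕ) + 1 + 1) n, F l := by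
  refine Finset.prod_bij (fun i _ => (i : ℕ) + 1) (fun i hi => ?_) (fun i _ j _ h => ?_)
    (fun b hb => ?_) fun i _ => rfl
  · have h1 := i.2
    have h2 : j < i := Finset.mem_Ioi.1 hi
    rw [Fin.lt_def] at h2
    simp only [Finset.mem_Icc]
    omega
  · exact Fin.ext (by simpa using h)
  · rw [Finset.mem_Icc] at hb
    refine ⟨⟨b - 1, by omega⟩, Finset.mem_Ioi.2 ?_, by simp; omega⟩
    rw [Fin.lt_def]
    simp only
    omega

theorem prod_pairs_eq_prod_Icc (n : ℕ) (F : ℕ → ℕ → M) :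
    ∏ j : Fin n, ∏ l ∈ Finset.Ioi j, F ((j : ℕ) + 1) ((l : ℕ) + 1) =
      ∏ j ∈ Finset.Icc 1 n, ∏ l ∈ Finset.Icc (j + 1) n, F j l := by
  rw [← prod_fin_eq_prod_Icc n fun j => ∏ l ∈ Finset.Icc (j + 1) n, F j l]
  exact Finset.prod_congr rfl fun j _ => prod_Ioi_eq_prod_Icc j fun l => F ((j : ℕ) + 1) l

theorem prod_Icc_split (F : ℕ → M) {a k n : ℕ} (hk : k ≤ n) (ha : a ≤ k + 1) :
    ∏ l ∈ Finset.Icc a n, F l = (∏ l ∈ Finset.Icc a k, F l) * ∏ l ∈ Finset.Icc (k + 1) n, F l := by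
  rw [← Finset.prod_union (by
    rw [Finset.disjoint_left]
    intro j h1 h2
    rw [Finset.mem_Icc] at h1 h2
    omega)]
  congr 1
  ext j
  simp only [Finset.mem_union, Finset.mem_Icc]
  omega

end ProductRanges

/-- The product of `u j`, of `G₂ j l` for `j < l ≤ k`, and of `G₁ j l` for `j ≤ k < l ≤ n`. -/
def columnProd (n : ℕ) (u : ℕ → ℝ) (G₂ G₁ : ℕ → ℕ → ℝ) (k : ℕ) : ℝ :=
  (∏ j ∈ Finset.Icc 1 k, u j) * (∏ j ∈ Finset.Icc 1 k, ∏ l ∈ Finset.Icc (j + 1) k, G₂ j l) *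
    ∏ j ∈ Finset.Icc 1 k, ∏ l ∈ Finset.Icc (k + 1) n, G₁ j l

theorem columnProd_zero (n : ℕ) (u : ℕ → ℝ) (G₂ G₁ : ℕ → ℕ → ℝ) : columnProd n u G₂ G₁ 0 = 1 := by
  simp [columnProd]

/-- When the column grows by the row `k + 1`, each pair `(j, k + 1)` with `j ≤ k` changes its factor
from `G₁` to `G₂`, and the pairs `(k + 1, l)` with `l > k + 1` enter with factor `G₁`. Both `c` and
`Δ` have this product shape. -/
theorem columnProd_succ {n k : ℕ} (hk : k < n) (u : ℕ → ℝ) (G₂ G₁ : ℕ → ℕ → ℝ)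
    (hG : ∀ j, 1 ≤ j → j ≤ k → G₁ j (k + 1) ≠ 0) :
    columnProd n u G₂ G₁ (k + 1) = columnProd n u G₂ G₁ k *
      (u (k + 1) * (∏ j ∈ Finset.Icc 1 k, G₂ j (k + 1) / G₁ j (k + 1)) *
        ∏ l ∈ Finset.Icc (k + 2) n, G₁ (k + 1) l) := by
  have h1 : ∏ j ∈ Finset.Icc 1 (k + 1), ∏ l ∈ Finset.Icc (j + 1) (k + 1), G₂ j l =
      (∏ j ∈ Finset.Icc 1 k, ∏ l ∈ Finset.Icc (j + 1) k, G₂ j l) *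
        ∏ j ∈ Finset.Icc 1 k, G₂ j (k + 1) := by
    rw [Finset.prod_Icc_succ_top (by omega), ← Finset.prod_mul_distrib]
    rw [Finset.Icc_eq_empty (a := k + 1 + 1) (by omega), Finset.prod_empty, mul_one]
    refine Finset.prod_congr rfl fun j hj => ?_
    rw [Finset.mem_Icc] at hj
    rw [Finset.prod_Icc_succ_top (by omega)]
  have h2 : ∏ j ∈ Finset.Icc 1 k, ∏ l ∈ Finset.Icc (k + 1) n, G₁ j l =
      (∏ j ∈ Finset.Icc 1 k, G₁ j (k + 1)) *
        ∏ j ∈ Finset.Icc 1 k, ∏ l ∈ Finset.Icc (k + 2) n, G₁ j l := by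
    rw [← Finset.prod_mul_distrib]
    refine Finset.prod_congr rfl fun j _ => ?_
    rw [prod_Icc_split (G₁ j) (k := k + 1) (by omega) (by omega)]
    simp
  have h3 : ∏ j ∈ Finset.Icc 1 k, G₁ j (k + 1) ≠ 0 := by
    refine Finset.prod_ne_zero_iff.2 fun j hj => ?_
    rw [Finset.mem_Icc] at hj
    exact hG j hj.1 hj.2
  rw [columnProd, columnProd, h1, h2, Finset.prod_Icc_succ_top (by omega : 1 ≤ k + 1),
    Finset.prod_Icc_succ_top (by omega : 1 ≤ k + 1), Finset.prod_div_distrib]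
  field_simp

theorem prod_signs {M : Type*} [CommMonoid M] (f : ℤ → M) :
    ∏ δ ∈ ({1, -1} : Finset ℤ), f δ = f 1 * f (-1) :=
  Finset.prod_pair (by norm_num)

/-! ### The coefficients on columns -/

section Coefficients

variable {n : ℕ} {C : Couplings} {p : ℝ}

theorem colBPlus_succ {k : ℕ} (hk : k < n) :
    colBPlus n C p (k + 1) =
      (∏ r : Fin 4,
        (bracket (alpha n 1 C) p r (rho n C (k + 1) + C.gr r) *
          bracket (alpha n 1 C) p r (rho n C (k + 1) + C.gr' r + 1 / 2)) /
        (bracket (alpha n 1 C) p r (rho n C (k + 1)) *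
          bracket (alpha n 1 C) p r (rho n C (k + 1) + 1 / 2))) *
      ((∏ j ∈ Finset.Icc 1 k,
        (bracket (alpha n 1 C) p 0 (rho n C j + rho n C (k + 1) + 1 + C.g) /
          bracket (alpha n 1 C) p 0 (rho n C j + rho n C (k + 1) + 1)) *
        (bracket (alpha n 1 C) p 0 (rho n C j - rho n C (k + 1) + 1 - C.g) /
          bracket (alpha n 1 C) p 0 (rho n C j - rho n C (k + 1) + 1))) *
      ∏ l ∈ Finset.Icc (k + 2) n,
        (bracket (alpha n 1 C) p 0 (rho n C (k + 1) + rho n C l + C.g) /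
          bracket (alpha n 1 C) p 0 (rho n C (k + 1) + rho n C l)) *
        (bracket (alpha n 1 C) p 0 (rho n C (k + 1) - rho n C l + C.g) /
          bracket (alpha n 1 C) p 0 (rho n C (k + 1) - rho n C l))) := by
  rw [colBPlus, dif_pos ⟨by omega, by omega⟩, coeffB]
  simp only [Nat.add_sub_cancel]
  have h0 : columnFun n k ⟨k, hk⟩ = 0 := by simp [columnFun]
  congr 1
  · simp only [h0, Int.cast_zero, add_zero, Int.cast_one, one_mul, add_assoc]
  · have h1 : ∀ i : Fin n, columnFun n k i = if (i : ℕ) + 1 ≤ k then 1 else 0 := fun i => by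
      simp [columnFun]
    simp only [prod_signs, h0, h1, Int.cast_zero, Int.cast_one, Int.cast_neg, one_mul, neg_mul,
      add_zero]
    refine (prod_erase_eq_prod_Icc hk fun j =>
      bracket (alpha n 1 C) p 0 (rho n C (k + 1) + rho n C j + ((if j ≤ k then 1 else 0 : ℤ) : ℝ) +
          C.g) /
        bracket (alpha n 1 C) p 0 (rho n C (k + 1) + rho n C j + ((if j ≤ k then 1 else 0 : ℤ) : ℝ)) *
      (bracket (alpha n 1 C) p 0 (rho n C (k + 1) + -rho n C j + -((if j ≤ k then 1 else 0 : ℤ) : ℝ) +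
          C.g) /
        bracket (alpha n 1 C) p 0
          (rho n C (k + 1) + -rho n C j + -((if j ≤ k then 1 else 0 : ℤ) : ℝ)))).trans ?_
    congr 1
    · refine Finset.prod_congr rfl fun j hj => ?_
      -- For `j ≤ k` the argument `ρ_{k+1} - ρ_j - 1` has the unfavourable sign; oddness of the
      -- first bracket reverses numerator and denominator together.
      rw [if_pos (Finset.mem_Icc.1 hj).2, ← neg_div_neg_eq (bracket (alpha n 1 C) p 0
        (rho n C (k + 1) + -rho n C j + -((1 : ℤ) : ℝ) + C.g)), ← bracket_zero_neg,
        ← bracket_zero_neg]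
      push_cast
      congr 3 <;> ring
    · refine Finset.prod_congr rfl fun j hj => ?_
      rw [if_neg (by have := (Finset.mem_Icc.1 hj).1; omega)]
      simp [sub_eq_add_neg]

theorem colBMinus_succ {k : ℕ} (hk : k < n) :
    colBMinus n C p (k + 1) =
      (∏ r : Fin 4,
        (bracket (alpha n 1 C) p r (rho n C (k + 1) + 1 - C.gr r) *
          bracket (alpha n 1 C) p r (rho n C (k + 1) - C.gr' r + 1 / 2)) /
        (bracket (alpha n 1 C) p r (rho n C (k + 1) + 1) *
          bracket (alpha n 1 C) p r (rho n C (k + 1) + 1 / 2))) *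
      ((∏ j ∈ Finset.Icc 1 k,
        (bracket (alpha n 1 C) p 0 (rho n C j + rho n C (k + 1) + 2 - C.g) /
          bracket (alpha n 1 C) p 0 (rho n C j + rho n C (k + 1) + 2)) *
        (bracket (alpha n 1 C) p 0 (rho n C j - rho n C (k + 1) + C.g) /
          bracket (alpha n 1 C) p 0 (rho n C j - rho n C (k + 1)))) *
      ∏ l ∈ Finset.Icc (k + 2) n,
        (bracket (alpha n 1 C) p 0 (rho n C (k + 1) + rho n C l + 1 - C.g) /
          bracket (alpha n 1 C) p 0 (rho n C (k + 1) + rho n C l + 1)) *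
        (bracket (alpha n 1 C) p 0 (rho n C (k + 1) - rho n C l + 1 - C.g) /
          bracket (alpha n 1 C) p 0 (rho n C (k + 1) - rho n C l + 1))) := by
  rw [colBMinus, dif_pos ⟨by omega, by omega⟩, coeffB]
  simp only [Nat.add_sub_cancel]
  have h0 : columnFun n (k + 1) ⟨k, hk⟩ = 1 := by simp [columnFun]
  congr 1
  · refine Finset.prod_congr rfl fun r _ => ?_
    simp only [h0, Int.cast_one, Int.cast_neg]
    congr 3 <;> ring
  · have h1 : ∀ i : Fin n, columnFun n (k + 1) i = if (i : ℕ) + 1 ≤ k + 1 then 1 else 0 := fun i => by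
      simp [columnFun]
    simp only [prod_signs, h0, h1, Int.cast_one, Int.cast_neg, one_mul, neg_mul]
    refine (prod_erase_eq_prod_Icc hk fun j =>
      bracket (alpha n 1 C) p 0 (rho n C (k + 1) + rho n C j + 1 +
          ((if j ≤ k + 1 then 1 else 0 : ℤ) : ℝ) + -C.g) /
        bracket (alpha n 1 C) p 0 (rho n C (k + 1) + rho n C j + 1 +
          ((if j ≤ k + 1 then 1 else 0 : ℤ) : ℝ)) *
      (bracket (alpha n 1 C) p 0 (rho n C (k + 1) + -rho n C j + 1 +
          -((if j ≤ k + 1 then 1 else 0 : ℤ) : ℝ) + -C.g) /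
        bracket (alpha n 1 C) p 0
          (rho n C (k + 1) + -rho n C j + 1 + -((if j ≤ k + 1 then 1 else 0 : ℤ) : ℝ)))).trans ?_
    congr 1
    · refine Finset.prod_congr rfl fun j hj => ?_
      rw [if_pos (by have := (Finset.mem_Icc.1 hj).2; omega), ← neg_div_neg_eq (bracket (alpha n 1 C) p 0
        (rho n C (k + 1) + -rho n C j + 1 + -((1 : ℤ) : ℝ) + -C.g)), ← bracket_zero_neg,
        ← bracket_zero_neg]
      push_cast
      congr 3 <;> ring
    · refine Finset.prod_congr rfl fun j hj => ?_
      rw [if_neg (by have := (Finset.mem_Icc.1 hj).1; omega)]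
      push_cast
      congr 3 <;> ring

end Coefficients

end EllipticRacah

/-! ### Weights on columns and the range of positivity of the brackets -/

namespace EllipticRacah

open Filter Topology Polynomial

/-- The conditions on the couplings that guarantee positivity. -/
structure Admissible (n : ℕ) (C : Couplings) : Prop where
  one_le : 1 ≤ n
  g_pos : 0 < C.g
  g1_pos : 0 < C.gr 0
  g2_pos : 0 < C.gr 1
  g1'_lt : |C.gr' 0| < C.gr 0 + 1 / 2
  g2'_lt : |C.gr' 1| < C.gr 1 + 1 / 2

theorem ellFactorial_zero (α p : ℝ) (r : Fin 4) (z : ℝ) : ellFactorial α p r z 0 = 1 := by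
  simp [ellFactorial]

theorem ellFactorial_one (α p : ℝ) (r : Fin 4) (z : ℝ) :
    ellFactorial α p r z 1 = bracket α p r z := by
  simp [ellFactorial]

theorem ellFactorial_two (α p : ℝ) (r : Fin 4) (z : ℝ) :
    ellFactorial α p r z 2 = bracket α p r z * bracket α p r (z + 1) := by
  simp [ellFactorial, Finset.prod_range_succ]

section Weight

variable (n : ℕ) (C : Couplings) (p : ℝ)

/-- The one-variable factors of the weight of a column. -/
noncomputable def weightOne (j : ℕ) : ℝ :=
  ∏ r : Fin 4,
    (bracket (alpha n 1 C) p r (rho n C j + 1) * bracket (alpha n 1 C) p r (rho n C j + C.gr r) *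
      bracket (alpha n 1 C) p r (rho n C j + C.gr' r + 1 / 2)) /
    (bracket (alpha n 1 C) p r (rho n C j) * bracket (alpha n 1 C) p r (rho n C j + 1 - C.gr r) *
      bracket (alpha n 1 C) p r (rho n C j - C.gr' r + 1 / 2))

/-- The first step of the two-variable factors of the weight. -/
noncomputable def weightStep (z : ℝ) : ℝ :=
  (bracket (alpha n 1 C) p 0 (z + C.g) * bracket (alpha n 1 C) p 0 (z + 1)) /
    (bracket (alpha n 1 C) p 0 z * bracket (alpha n 1 C) p 0 (z + 1 - C.g))

variable {n C p}

/-- On a column `λ_j + λ_l` is `0`, `1` or `2` and `λ_j - λ_l` is `0` or `1` for `j < l`. A pair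
inside the column thus contributes two successive steps in `ρ_j + ρ_l` and none in the difference; a
pair straddling its end contributes one step in each. -/
theorem weight_columnFun {k : ℕ} (hk : k ≤ n) :
    weight n 1 C p (columnFun n k) = columnProd n (weightOne n C p)
      (fun j l => weightStep n C p (rho n C j + rho n C l) *
        weightStep n C p (rho n C j + rho n C l + 1))
      (fun j l => weightStep n C p (rho n C j + rho n C l) *
        weightStep n C p (rho n C j - rho n C l)) k := by
  have h1 : ∀ i : Fin n, columnFun n k i = if (i : ℕ) + 1 ≤ k then 1 else 0 := fun i => by
    simp [columnFun]
  have hone : (∏ j : Fin n, ∏ r : Fin 4,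
      (ellFactorial (alpha n 1 C) p r (rho n C ((j : ℕ) + 1) + 1) (columnFun n k j).toNat *
        ellFactorial (alpha n 1 C) p r (rho n C ((j : ℕ) + 1) + C.gr r) (columnFun n k j).toNat *
        ellFactorial (alpha n 1 C) p r (rho n C ((j : ℕ) + 1) + C.gr' r + 1 / 2)
          (columnFun n k j).toNat) /
      (ellFactorial (alpha n 1 C) p r (rho n C ((j : ℕ) + 1)) (columnFun n k j).toNat *
        ellFactorial (alpha n 1 C) p r (rho n C ((j : ℕ) + 1) + 1 - C.gr r) (columnFun n k j).toNat *
        ellFactorial (alpha n 1 C) p r (rho n C ((j : ℕ) + 1) - C.gr' r + 1 / 2)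
          (columnFun n k j).toNat)) = ∏ j ∈ Finset.Icc 1 k, weightOne n C p j := by
    have h2 : ∏ j ∈ Finset.Icc 1 n, (if j ≤ k then weightOne n C p j else 1) =
        ∏ j ∈ Finset.Icc 1 k, weightOne n C p j := by
      rw [prod_Icc_split _ hk (by omega)]
      refine (congrArg₂ (· * ·) (Finset.prod_congr rfl fun j hj => ?_)
        (Finset.prod_eq_one fun j hj => ?_)).trans (mul_one _)
      · rw [if_pos (Finset.mem_Icc.1 hj).2]
      · rw [if_neg (by have := (Finset.mem_Icc.1 hj).1; omega)]
    rw [← h2, ← prod_fin_eq_prod_Icc]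
    refine Finset.prod_congr rfl fun j _ => ?_
    rw [h1]
    split_ifs with hj
    · simp only [Int.toNat_one, ellFactorial_one, weightOne]
    · simp only [Int.toNat_zero, ellFactorial_zero, mul_one, div_one, Finset.prod_const_one]
  rw [weight, columnProd, mul_assoc, hone]
  congr 1
  set F : ℕ → ℕ → ℝ := fun j l =>
    if l ≤ k then weightStep n C p (rho n C j + rho n C l) *
        weightStep n C p (rho n C j + rho n C l + 1)
    else if j ≤ k then weightStep n C p (rho n C j + rho n C l) *
        weightStep n C p (rho n C j - rho n C l)
    else 1 with hF
  have h2 : ∏ j ∈ Finset.Icc 1 n, ∏ l ∈ Finset.Icc (j + 1) n, F j l =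
      (∏ j ∈ Finset.Icc 1 k, ∏ l ∈ Finset.Icc (j + 1) k,
        weightStep n C p (rho n C j + rho n C l) * weightStep n C p (rho n C j + rho n C l + 1)) *
      ∏ j ∈ Finset.Icc 1 k, ∏ l ∈ Finset.Icc (k + 1) n,
        weightStep n C p (rho n C j + rho n C l) * weightStep n C p (rho n C j - rho n C l) := by
    rw [prod_Icc_split _ hk (by omega), ← Finset.prod_mul_distrib]
    refine (congrArg₂ (· * ·) (Finset.prod_congr rfl fun j hj => ?_)
      (Finset.prod_eq_one fun j hj => ?_)).trans (mul_one _)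
    · rw [Finset.mem_Icc] at hj
      rw [prod_Icc_split _ hk (by omega)]
      congr 1
      · refine Finset.prod_congr rfl fun l hl => ?_
        simp only [hF, if_pos (Finset.mem_Icc.1 hl).2]
      · refine Finset.prod_congr rfl fun l hl => ?_
        have : ¬ l ≤ k := by have := (Finset.mem_Icc.1 hl).1; omega
        simp only [hF, if_neg this, if_pos hj.2]
    · rw [Finset.mem_Icc] at hj
      refine Finset.prod_eq_one fun l hl => ?_
      rw [Finset.mem_Icc] at hl
      simp only [hF, if_neg (show ¬ l ≤ k by omega), if_neg (show ¬ j ≤ k by omega)]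
  rw [← h2, ← prod_pairs_eq_prod_Icc n F]
  refine Finset.prod_congr rfl fun j _ => Finset.prod_congr rfl fun l hl => ?_
  have hjl : j < l := Finset.mem_Ioi.1 hl
  rw [Fin.lt_def] at hjl
  simp only [prod_signs, h1, hF, Int.cast_one, one_mul, Int.cast_neg, neg_mul]
  by_cases hl' : (l : ℕ) + 1 ≤ k
  · simp only [if_pos hl', if_pos (show (j : ℕ) + 1 ≤ k by omega), Int.reduceAdd, Int.reduceNeg,
      Int.reduceToNat, add_neg_cancel, Int.toNat_zero, ellFactorial_zero, ellFactorial_two, mul_one,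
      div_one, weightStep]
    rw [show rho n C ((j : ℕ) + 1) + rho n C ((l : ℕ) + 1) + C.g + 1 =
        rho n C ((j : ℕ) + 1) + rho n C ((l : ℕ) + 1) + 1 + C.g by ring,
      show rho n C ((j : ℕ) + 1) + rho n C ((l : ℕ) + 1) + 1 - C.g + 1 =
        rho n C ((j : ℕ) + 1) + rho n C ((l : ℕ) + 1) + 1 + 1 - C.g by ring, div_mul_div_comm]
    congr 1 <;> ring
  · by_cases hj' : (j : ℕ) + 1 ≤ k
    · simp only [if_neg hl', if_pos hj', add_zero, neg_zero, Int.toNat_one, ellFactorial_one,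
        weightStep, sub_eq_add_neg]
    · simp only [if_neg hl', if_neg hj', add_zero, neg_zero, Int.toNat_zero, ellFactorial_zero,
        mul_one, div_one]

end Weight

namespace Admissible

variable {n : ℕ} {C : Couplings} {p : ℝ}

theorem sub_one_mul_nonneg (h : Admissible n C) : 0 ≤ ((n : ℝ) - 1) * C.g := by
  have h1 : (1 : ℝ) ≤ n := by exact_mod_cast h.one_le
  exact mul_nonneg (by linarith) h.g_pos.le

theorem denom_gt_one (h : Admissible n C) : 1 < 1 + ((n : ℝ) - 1) * C.g + C.gr 0 + C.gr 1 := by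
  linarith [h.sub_one_mul_nonneg, h.g1_pos, h.g2_pos]

theorem alpha_eq (n : ℕ) (C : Couplings) :
    alpha n 1 C = Real.pi / (1 + ((n : ℝ) - 1) * C.g + C.gr 0 + C.gr 1) := by
  rw [alpha, Nat.cast_one]

theorem alpha_pos (h : Admissible n C) : 0 < alpha n 1 C := by
  rw [alpha_eq]
  exact div_pos Real.pi_pos (by linarith [h.denom_gt_one])

theorem alpha_lt_pi (h : Admissible n C) : alpha n 1 C < Real.pi := by
  rw [alpha_eq]
  exact div_lt_self Real.pi_pos h.denom_gt_one

theorem pi_div_alpha (h : Admissible n C) :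
    Real.pi / alpha n 1 C = 1 + ((n : ℝ) - 1) * C.g + C.gr 0 + C.gr 1 := by
  have h1 := h.denom_gt_one
  have h2 := Real.pi_pos
  rw [alpha_eq]
  field_simp

theorem alpha_mul (h : Admissible n C) :
    alpha n 1 C * (1 + ((n : ℝ) - 1) * C.g + C.gr 0 + C.gr 1) = Real.pi := by
  rw [alpha_eq, div_mul_cancel₀]
  linarith [h.denom_gt_one]

theorem rho_bounds (h : Admissible n C) {j : ℕ} (h1 : 1 ≤ j) (h2 : j ≤ n) :
    C.gr 0 ≤ rho n C j ∧ rho n C j ≤ ((n : ℝ) - 1) * C.g + C.gr 0 := by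
  have h3 : (1 : ℝ) ≤ j := by exact_mod_cast h1
  have h4 : (j : ℝ) ≤ n := by exact_mod_cast h2
  have h5 := h.g_pos
  rw [rho]
  constructor
  · nlinarith
  · nlinarith

theorem rho_pair_bounds (h : Admissible n C) {j l : ℕ} (h1 : 1 ≤ j) (hjl : j < l) (h2 : l ≤ n) :
    C.g ≤ rho n C j - rho n C l ∧ rho n C j - rho n C l ≤ ((n : ℝ) - 1) * C.g := by
  have h3 : (1 : ℝ) ≤ j := by exact_mod_cast h1
  have h4 : (l : ℝ) ≤ n := by exact_mod_cast h2
  have h6 : (j : ℝ) + 1 ≤ l := by exact_mod_cast hjl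
  have h5 := h.g_pos
  rw [rho, rho]
  constructor
  · nlinarith
  · nlinarith

theorem bracket_zero_pos' (h : Admissible n C) (hp : |p| < 1) {z : ℝ} (h0 : 0 < z)
    (h1 : z < 2 * (1 + ((n : ℝ) - 1) * C.g + C.gr 0 + C.gr 1)) :
    0 < bracket (alpha n 1 C) p 0 z :=
  bracket_zero_pos h.alpha_pos h.alpha_lt_pi hp h0 (by rwa [h.pi_div_alpha])

theorem bracket_one_pos' (h : Admissible n C) (hp : |p| < 1) {z : ℝ}
    (h0 : -(1 + ((n : ℝ) - 1) * C.g + C.gr 0 + C.gr 1) < z)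
    (h1 : z < 1 + ((n : ℝ) - 1) * C.g + C.gr 0 + C.gr 1) :
    0 < bracket (alpha n 1 C) p 1 z :=
  bracket_one_pos h.alpha_pos hp (by rwa [h.pi_div_alpha]) (by rwa [h.pi_div_alpha])

/-- Positivity of the brackets with one index, in terms of bounds on the argument. -/
theorem bracket_pos (h : Admissible n C) (hp : |p| < 1) {r : Fin 4} {z : ℝ}
    (h0 : r = 0 → 0 < z ∧ z < 2 * (1 + ((n : ℝ) - 1) * C.g + C.gr 0 + C.gr 1))
    (h1 : r = 1 → -(1 + ((n : ℝ) - 1) * C.g + C.gr 0 + C.gr 1) < z ∧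
      z < 1 + ((n : ℝ) - 1) * C.g + C.gr 0 + C.gr 1) :
    0 < bracket (alpha n 1 C) p r z := by
  fin_cases r
  · exact h.bracket_zero_pos' hp (h0 rfl).1 (h0 rfl).2
  · exact h.bracket_one_pos' hp (h1 rfl).1 (h1 rfl).2
  · exact bracket_two_three_pos hp (by simp) z
  · exact bracket_two_three_pos hp (by simp) z

/-- The brackets in one of the `ρ_j` that occur in the coefficients on columns are positive. -/
theorem one_var_pos (h : Admissible n C) (hp : |p| < 1) {j : ℕ} (h1 : 1 ≤ j) (h2 : j ≤ n)
    (r : Fin 4) :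
    0 < bracket (alpha n 1 C) p r (rho n C j) ∧
    0 < bracket (alpha n 1 C) p r (rho n C j + 1 / 2) ∧
    0 < bracket (alpha n 1 C) p r (rho n C j + 1) ∧
    0 < bracket (alpha n 1 C) p r (rho n C j + C.gr r) ∧
    0 < bracket (alpha n 1 C) p r (rho n C j + 1 - C.gr r) ∧
    0 < bracket (alpha n 1 C) p r (rho n C j + C.gr' r + 1 / 2) ∧
    0 < bracket (alpha n 1 C) p r (rho n C j - C.gr' r + 1 / 2) := by
  obtain ⟨h3, h4⟩ := h.rho_bounds h1 h2
  have h5 := h.sub_one_mul_nonneg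
  have h6 := h.g1_pos
  have h7 := h.g2_pos
  obtain ⟨h8, h9⟩ := abs_lt.1 h.g1'_lt
  obtain ⟨h10, h11⟩ := abs_lt.1 h.g2'_lt
  -- All bounds are linear in the couplings. The conditions on `g'_1` and `g'_2` enter through `ρ_j
  -- ± g'_r + 1/2`, and the remaining bounds use `ρ_j ∈ [g_1, (n - 1) g + g_1]`.
  refine ⟨?_, ?_, ?_, ?_, ?_, ?_, ?_⟩ <;> refine h.bracket_pos hp ?_ ?_ <;> rintro rfl <;>
    constructor <;> linarith

/-- The brackets in `ρ_j ± ρ_l` that occur in the coefficients on columns are positive. -/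
theorem two_var_pos (h : Admissible n C) (hp : |p| < 1) {j l : ℕ} (h1 : 1 ≤ j) (hjl : j < l)
    (h2 : l ≤ n) {z : ℝ} (hz : z = rho n C j + rho n C l ∨ z = rho n C j - rho n C l ∨
      z = rho n C j + rho n C l + 1) :
    0 < bracket (alpha n 1 C) p 0 z ∧ 0 < bracket (alpha n 1 C) p 0 (z + C.g) ∧
    0 < bracket (alpha n 1 C) p 0 (z + 1) ∧ 0 < bracket (alpha n 1 C) p 0 (z + 1 - C.g) := by
  obtain ⟨h3, h4⟩ := h.rho_pair_bounds h1 hjl h2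
  obtain ⟨h5, h6⟩ := h.rho_bounds (by omega : 1 ≤ l) h2
  obtain ⟨h7, h8⟩ := h.rho_bounds h1 (by omega : j ≤ n)
  have h9 := h.g1_pos
  have h10 := h.g2_pos
  have h11 := h.g_pos
  -- The gap `g ≤ ρ_j - ρ_l` supplies both sharp bounds: `ρ_j - ρ_l + 1 - g > 0`, and `ρ_j + ρ_l + g
  -- ≤ 2 ρ_j` for the upper end.
  rcases hz with rfl | rfl | rfl <;> refine ⟨?_, ?_, ?_, ?_⟩ <;>
    refine h.bracket_zero_pos' hp ?_ ?_ <;> linarith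

end Admissible

end EllipticRacah

/-! ### Positivity, recursions and analyticity of the off-diagonal data -/

namespace EllipticRacah

open Filter Topology Polynomial

namespace Admissible

variable {n : ℕ} {C : Couplings} {p : ℝ}

/-- Brings the arguments `ρ_j + ρ_l + 2` into the form `z + 1` with `z = ρ_j + ρ_l + 1`, as covered
by `two_var_pos`. -/
theorem add_two_eq (a b : ℝ) : a + b + 2 = a + b + 1 + 1 := by ring

theorem colBPlus_pos (h : Admissible n C) (hp : |p| < 1) {k : ℕ} (hk : k < n) :
    0 < colBPlus n C p (k + 1) := by
  rw [colBPlus_succ hk]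
  refine mul_pos (Finset.prod_pos fun r _ => ?_) (mul_pos (Finset.prod_pos fun j hj => ?_)
    (Finset.prod_pos fun l hl => ?_))
  · obtain ⟨h1, h2, h3, h4, h5, h6, h7⟩ := h.one_var_pos hp (by omega : 1 ≤ k + 1) hk r
    positivity
  · rw [Finset.mem_Icc] at hj
    obtain ⟨h1, h2, h3, h4⟩ := h.two_var_pos hp hj.1 (by omega : j < k + 1) hk (.inr (.inr rfl))
    obtain ⟨h5, h6, h7, h8⟩ := h.two_var_pos hp hj.1 (by omega : j < k + 1) hk (.inr (.inl rfl))
    positivity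
  · rw [Finset.mem_Icc] at hl
    obtain ⟨h1, h2, h3, h4⟩ := h.two_var_pos hp (by omega : 1 ≤ k + 1) (by omega : k + 1 < l) hl.2
      (.inl rfl)
    obtain ⟨h5, h6, h7, h8⟩ := h.two_var_pos hp (by omega : 1 ≤ k + 1) (by omega : k + 1 < l) hl.2
      (.inr (.inl rfl))
    positivity

theorem colBMinus_pos (h : Admissible n C) (hp : |p| < 1) {k : ℕ} (hk : k < n) :
    0 < colBMinus n C p (k + 1) := by
  rw [colBMinus_succ hk]
  refine mul_pos (Finset.prod_pos fun r _ => ?_) (mul_pos (Finset.prod_pos fun j hj => ?_)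
    (Finset.prod_pos fun l hl => ?_))
  · obtain ⟨h1, h2, h3, h4, h5, h6, h7⟩ := h.one_var_pos hp (by omega : 1 ≤ k + 1) hk r
    positivity
  · rw [Finset.mem_Icc] at hj
    rw [add_two_eq]
    obtain ⟨h1, h2, h3, h4⟩ := h.two_var_pos hp hj.1 (by omega : j < k + 1) hk (.inr (.inr rfl))
    obtain ⟨h5, h6, h7, h8⟩ := h.two_var_pos hp hj.1 (by omega : j < k + 1) hk (.inr (.inl rfl))
    positivity
  · rw [Finset.mem_Icc] at hl
    obtain ⟨h1, h2, h3, h4⟩ := h.two_var_pos hp (by omega : 1 ≤ k + 1) (by omega : k + 1 < l) hl.2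
      (.inl rfl)
    obtain ⟨h5, h6, h7, h8⟩ := h.two_var_pos hp (by omega : 1 ≤ k + 1) (by omega : k + 1 < l) hl.2
      (.inr (.inl rfl))
    positivity

theorem colC_eq_columnProd (n : ℕ) (C : Couplings) (p : ℝ) (k : ℕ) :
    colC n C p k = columnProd n
      (fun j => ∏ r : Fin 4,
        (bracket (alpha n 1 C) p r (rho n C j) * bracket (alpha n 1 C) p r (rho n C j + 1 / 2)) /
        (bracket (alpha n 1 C) p r (rho n C j + C.gr r) *
          bracket (alpha n 1 C) p r (rho n C j + C.gr' r + 1 / 2)))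
      (fun j l => (bracket (alpha n 1 C) p 0 (rho n C j + rho n C l) *
        bracket (alpha n 1 C) p 0 (rho n C j + rho n C l + 1)) /
        (bracket (alpha n 1 C) p 0 (rho n C j + rho n C l + C.g) *
          bracket (alpha n 1 C) p 0 (rho n C j + rho n C l + 1 + C.g)) *
        ((bracket (alpha n 1 C) p 0 (rho n C j - rho n C l) *
          bracket (alpha n 1 C) p 0 (rho n C j - rho n C l + 1)) /
        (bracket (alpha n 1 C) p 0 (rho n C j - rho n C l + C.g) *
          bracket (alpha n 1 C) p 0 (rho n C j - rho n C l + 1 - C.g))))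
      (fun j l => (bracket (alpha n 1 C) p 0 (rho n C j + rho n C l) *
        bracket (alpha n 1 C) p 0 (rho n C j - rho n C l)) /
        (bracket (alpha n 1 C) p 0 (rho n C j + rho n C l + C.g) *
          bracket (alpha n 1 C) p 0 (rho n C j - rho n C l + C.g))) k := by
  rw [colC, columnProd]
  simp only [Finset.prod_mul_distrib, mul_assoc]

theorem colC_zero (n : ℕ) (C : Couplings) (p : ℝ) : colC n C p 0 = 1 := by
  rw [colC_eq_columnProd, columnProd_zero]

/-- In the quotient of pair factors for `j ≤ k` the brackets in `ρ_j ± ρ_{k+1}` and `ρ_j ± ρ_{k+1} +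
g` cancel, leaving precisely the reciprocals of the factors of `B_{k+1}` shifted by one. -/
theorem colC_succ (h : Admissible n C) (hp : |p| < 1) {k : ℕ} (hk : k < n) :
    colC n C p (k + 1) = colC n C p k * (colBPlus n C p (k + 1))⁻¹ := by
  rw [colC_eq_columnProd, columnProd_succ hk, ← colC_eq_columnProd, colBPlus_succ hk]
  · congr 1
    rw [mul_assoc, mul_inv, mul_inv, ← Finset.prod_inv_distrib, ← Finset.prod_inv_distrib,
      ← Finset.prod_inv_distrib]
    congr 1
    · exact Finset.prod_congr rfl fun r _ => (inv_div _ _).symm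
    · congr 1
      · refine Finset.prod_congr rfl fun j hj => ?_
        rw [Finset.mem_Icc] at hj
        obtain ⟨h1, h2, h3, h4⟩ := h.two_var_pos hp hj.1 (by omega : j < k + 1) hk (.inl rfl)
        obtain ⟨h1', h2', h3', h4'⟩ :=
          h.two_var_pos hp hj.1 (by omega : j < k + 1) hk (.inr (.inr rfl))
        obtain ⟨h5, h6, h7, h8⟩ :=
          h.two_var_pos hp hj.1 (by omega : j < k + 1) hk (.inr (.inl rfl))
        field_simp
      · refine Finset.prod_congr rfl fun l hl => ?_
        rw [div_mul_div_comm, inv_div]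
  · intro j h1 h2
    obtain ⟨h1, h2, h3, h4⟩ := h.two_var_pos hp h1 (by omega : j < k + 1) hk (.inl rfl)
    obtain ⟨h5, h6, h7, h8⟩ := h.two_var_pos hp ‹1 ≤ j› (by omega : j < k + 1) hk (.inr (.inl rfl))
    positivity

theorem colC_eq_prod (h : Admissible n C) (hp : |p| < 1) :
    ∀ k ≤ n, colC n C p k = ∏ j ∈ Finset.Icc 1 k, (colBPlus n C p j)⁻¹
  | 0, _ => by simp [colC_zero]
  | k + 1, hk => by
    rw [h.colC_succ hp hk, h.colC_eq_prod hp k (by omega), Finset.prod_Icc_succ_top (by omega)]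

theorem colC_pos (h : Admissible n C) (hp : |p| < 1) {k : ℕ} (hk : k ≤ n) : 0 < colC n C p k := by
  rw [h.colC_eq_prod hp k hk]
  refine Finset.prod_pos fun j hj => inv_pos.2 ?_
  rw [Finset.mem_Icc] at hj
  obtain ⟨i, rfl⟩ : ∃ i, j = i + 1 := ⟨j - 1, by omega⟩
  exact h.colBPlus_pos hp (by omega)

theorem weight_zero (n : ℕ) (C : Couplings) (p : ℝ) : weight n 1 C p (columnFun n 0) = 1 := by
  rw [weight_columnFun (Nat.zero_le n), columnProd_zero]

theorem weightStep_pos (h : Admissible n C) (hp : |p| < 1) {j l : ℕ} (h1 : 1 ≤ j) (hjl : j < l)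
    (h2 : l ≤ n) {z : ℝ} (hz : z = rho n C j + rho n C l ∨ z = rho n C j - rho n C l ∨
      z = rho n C j + rho n C l + 1) : 0 < weightStep n C p z := by
  obtain ⟨h3, h4, h5, h6⟩ := h.two_var_pos hp h1 hjl h2 hz
  rw [weightStep]
  positivity

/-- Detailed balance: this is the relation that makes the tridiagonal matrix symmetric with respect
to `Δ`. It holds factor by factor after the growth formula `columnProd_succ`. -/
theorem weight_succ (h : Admissible n C) (hp : |p| < 1) {k : ℕ} (hk : k < n) :
    weight n 1 C p (columnFun n (k + 1)) =
      weight n 1 C p (columnFun n k) * (colBPlus n C p (k + 1) / colBMinus n C p (k + 1)) := by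
  rw [weight_columnFun hk, columnProd_succ hk, ← weight_columnFun hk.le, colBPlus_succ hk,
    colBMinus_succ hk]
  · rw [mul_assoc (weightOne n C p (k + 1))]
    congr 1
    rw [mul_div_mul_comm, mul_div_mul_comm, ← Finset.prod_div_distrib, ← Finset.prod_div_distrib,
      ← Finset.prod_div_distrib]
    congr 1
    · refine Finset.prod_congr rfl fun r _ => ?_
      obtain ⟨h1, h2, h3, h4, h5, h6, h7⟩ := h.one_var_pos hp (by omega : 1 ≤ k + 1) hk r
      generalize bracket (alpha n 1 C) p r (rho n C (k + 1) + 1 / 2) = x at *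
      generalize bracket (alpha n 1 C) p r (rho n C (k + 1) - C.gr' r + 1 / 2) = y at *
      generalize bracket (alpha n 1 C) p r (rho n C (k + 1) + C.gr' r + 1 / 2) = z at *
      field_simp
    · congr 1
      · refine Finset.prod_congr rfl fun j hj => ?_
        rw [Finset.mem_Icc] at hj
        obtain ⟨h1, h2, h3, h4⟩ := h.two_var_pos hp hj.1 (by omega : j < k + 1) hk (.inl rfl)
        obtain ⟨h1', h2', h3', h4'⟩ :=
          h.two_var_pos hp hj.1 (by omega : j < k + 1) hk (.inr (.inr rfl))
        obtain ⟨h5, h6, h7, h8⟩ :=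
          h.two_var_pos hp hj.1 (by omega : j < k + 1) hk (.inr (.inl rfl))
        simp only [weightStep, add_two_eq]
        field_simp
      · refine Finset.prod_congr rfl fun l hl => ?_
        rw [Finset.mem_Icc] at hl
        obtain ⟨h1, h2, h3, h4⟩ := h.two_var_pos hp (by omega : 1 ≤ k + 1) (by omega : k + 1 < l) hl.2
          (.inl rfl)
        obtain ⟨h5, h6, h7, h8⟩ := h.two_var_pos hp (by omega : 1 ≤ k + 1) (by omega : k + 1 < l) hl.2
          (.inr (.inl rfl))
        simp only [weightStep]
        field_simp
  · intro j h1 h2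
    exact (mul_pos (h.weightStep_pos hp h1 (by omega : j < k + 1) hk (.inl rfl))
      (h.weightStep_pos hp h1 (by omega : j < k + 1) hk (.inr (.inl rfl)))).ne'

theorem weight_pos (h : Admissible n C) (hp : |p| < 1) :
    ∀ k ≤ n, 0 < weight n 1 C p (columnFun n k)
  | 0, _ => by simp [weight_zero]
  | k + 1, hk => by
    rw [h.weight_succ hp hk]
    exact mul_pos (h.weight_pos hp k (by omega)) (div_pos (h.colBPlus_pos hp hk) (h.colBMinus_pos hp hk))

theorem colBPlus_analyticAt (h : Admissible n C) (hp : |p| < 1) {k : ℕ} (hk : k < n) :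
    AnalyticAt ℝ (fun p => colBPlus n C p (k + 1)) p := by
  simp only [colBPlus_succ hk]
  refine (Finset.analyticAt_fun_prod _ fun r _ => ?_).mul
    ((Finset.analyticAt_fun_prod _ fun j hj => ?_).mul (Finset.analyticAt_fun_prod _ fun l hl => ?_))
  · obtain ⟨h1, h2, h3, h4, h5, h6, h7⟩ := h.one_var_pos hp (by omega : 1 ≤ k + 1) hk r
    exact ((bracket_analyticAt hp _ _).mul (bracket_analyticAt hp _ _)).div
      ((bracket_analyticAt hp _ _).mul (bracket_analyticAt hp _ _)) (by positivity)
  · rw [Finset.mem_Icc] at hj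
    obtain ⟨h1, h2, h3, h4⟩ := h.two_var_pos hp hj.1 (by omega : j < k + 1) hk (.inr (.inr rfl))
    obtain ⟨h5, h6, h7, h8⟩ := h.two_var_pos hp hj.1 (by omega : j < k + 1) hk (.inr (.inl rfl))
    exact ((bracket_analyticAt hp _ _).div (bracket_analyticAt hp _ _) (by positivity)).mul
      ((bracket_analyticAt hp _ _).div (bracket_analyticAt hp _ _) (by positivity))
  · rw [Finset.mem_Icc] at hl
    obtain ⟨h1, h2, h3, h4⟩ := h.two_var_pos hp (by omega : 1 ≤ k + 1) (by omega : k + 1 < l) hl.2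
      (.inl rfl)
    obtain ⟨h5, h6, h7, h8⟩ := h.two_var_pos hp (by omega : 1 ≤ k + 1) (by omega : k + 1 < l) hl.2
      (.inr (.inl rfl))
    exact ((bracket_analyticAt hp _ _).div (bracket_analyticAt hp _ _) (by positivity)).mul
      ((bracket_analyticAt hp _ _).div (bracket_analyticAt hp _ _) (by positivity))

theorem colBMinus_analyticAt (h : Admissible n C) (hp : |p| < 1) {k : ℕ} (hk : k < n) :
    AnalyticAt ℝ (fun p => colBMinus n C p (k + 1)) p := by
  simp only [colBMinus_succ hk]
  refine (Finset.analyticAt_fun_prod _ fun r _ => ?_).mul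
    ((Finset.analyticAt_fun_prod _ fun j hj => ?_).mul (Finset.analyticAt_fun_prod _ fun l hl => ?_))
  · obtain ⟨h1, h2, h3, h4, h5, h6, h7⟩ := h.one_var_pos hp (by omega : 1 ≤ k + 1) hk r
    exact ((bracket_analyticAt hp _ _).mul (bracket_analyticAt hp _ _)).div
      ((bracket_analyticAt hp _ _).mul (bracket_analyticAt hp _ _)) (by positivity)
  · rw [Finset.mem_Icc] at hj
    rw [add_two_eq]
    obtain ⟨h1, h2, h3, h4⟩ := h.two_var_pos hp hj.1 (by omega : j < k + 1) hk (.inr (.inr rfl))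
    obtain ⟨h5, h6, h7, h8⟩ := h.two_var_pos hp hj.1 (by omega : j < k + 1) hk (.inr (.inl rfl))
    exact ((bracket_analyticAt hp _ _).div (bracket_analyticAt hp _ _) (by positivity)).mul
      ((bracket_analyticAt hp _ _).div (bracket_analyticAt hp _ _) (by positivity))
  · rw [Finset.mem_Icc] at hl
    obtain ⟨h1, h2, h3, h4⟩ := h.two_var_pos hp (by omega : 1 ≤ k + 1) (by omega : k + 1 < l) hl.2
      (.inl rfl)
    obtain ⟨h5, h6, h7, h8⟩ := h.two_var_pos hp (by omega : 1 ≤ k + 1) (by omega : k + 1 < l) hl.2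
      (.inr (.inl rfl))
    exact ((bracket_analyticAt hp _ _).div (bracket_analyticAt hp _ _) (by positivity)).mul
      ((bracket_analyticAt hp _ _).div (bracket_analyticAt hp _ _) (by positivity))

end Admissible

end EllipticRacah

namespace EllipticRacah

open Filter Topology Polynomial

/-! ### The diagonal coefficients -/

theorem prod_telescope_down {f : ℕ → ℝ} {a b : ℕ} (hab : a ≤ b)
    (hf : ∀ j, a ≤ j → j ≤ b → f j ≠ 0) :
    ∏ j ∈ Finset.Icc (a + 1) b, f (j - 1) / f j = f a / f b := by
  induction b, hab using Nat.le_induction with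
  | base => simp [div_self (hf a le_rfl le_rfl)]
  | succ b hb ih =>
    rw [Finset.prod_Icc_succ_top (by omega), ih fun j h1 h2 => hf j h1 (by omega),
      Nat.add_sub_cancel, div_mul_div_cancel₀ (hf b hb (by omega))]

theorem prod_telescope_up {f : ℕ → ℝ} {a b : ℕ} (hab : a ≤ b)
    (hf : ∀ j, a ≤ j → j ≤ b → f (j + 1) ≠ 0) :
    ∏ j ∈ Finset.Icc (a + 1) b, f (j + 1) / f j = f (b + 1) / f (a + 1) := by
  induction b, hab using Nat.le_induction with
  | base => simp [div_self (hf a le_rfl le_rfl)]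
  | succ b hb ih =>
    rw [Finset.prod_Icc_succ_top (by omega), ih fun j h1 h2 => hf j h1 (by omega), mul_comm,
      div_mul_div_cancel₀ (hf b hb (by omega))]

theorem rho_succ (n : ℕ) (C : Couplings) (j : ℕ) : rho n C (j + 1) = rho n C j - C.g := by
  simp only [rho, Nat.cast_add, Nat.cast_one]
  ring

theorem rho_pred (n : ℕ) (C : Couplings) {j : ℕ} (hj : 1 ≤ j) :
    rho n C (j - 1) = rho n C j + C.g := by
  obtain ⟨i, rfl⟩ : ∃ i, j = i + 1 := ⟨j - 1, by omega⟩
  rw [rho_succ, Nat.add_sub_cancel]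
  ring

theorem rho_self (n : ℕ) (C : Couplings) : rho n C n = C.gr 0 := by simp [rho]

/-- Only `g_1 + g_2` enters `α`, so the regularization moves the arguments of the brackets but not
their scale. -/
theorem alpha_shift (n m : ℕ) (C : Couplings) (s : ℝ) : alpha n m (C.shift s) = alpha n m C := by
  simp only [alpha, Couplings.shift, Matrix.cons_val_zero, Matrix.cons_val_one]
  congr 1
  ring

theorem rho_shift (n : ℕ) (C : Couplings) (s : ℝ) (j : ℕ) :
    rho n (C.shift s) j = rho n C j + s := by
  simp only [rho, Couplings.shift, Matrix.cons_val_zero]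
  ring

theorem shift_zero (C : Couplings) : C.shift 0 = C := by
  rcases C with ⟨g, gr, gr'⟩
  simp only [Couplings.shift, add_zero, sub_zero, Couplings.mk.injEq, true_and, and_true]
  ext i
  fin_cases i <;> rfl

theorem continuous_shift_gr (C : Couplings) (i : Fin 4) : Continuous fun s => (C.shift s).gr i := by
  fin_cases i
  · exact continuous_const.add continuous_id
  · exact continuous_const.sub continuous_id
  · exact continuous_const
  · exact continuous_const

section Diagonal

variable (n : ℕ) (C : Couplings) (p : ℝ) (r : Fin 4) (k : ℕ)

/-- Product of `[ρ_j + λ_j + 1/2 - g] / [ρ_j + λ_j + 1/2]` over `j ≤ k`. -/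
noncomputable def ratioUpper₁ : ℝ := ∏ j ∈ Finset.Icc 1 k,
  bracket (alpha n 1 C) p r (rho n C j + 3 / 2 - C.g) / bracket (alpha n 1 C) p r (rho n C j + 3 / 2)

/-- Product of `[ρ_j + λ_j - 1/2 + g] / [ρ_j + λ_j - 1/2]` over `j ≤ k`. -/
noncomputable def ratioLower₁ : ℝ := ∏ j ∈ Finset.Icc 1 k,
  bracket (alpha n 1 C) p r (rho n C j + 1 / 2 + C.g) / bracket (alpha n 1 C) p r (rho n C j + 1 / 2)

/-- Product of `[ρ_j + λ_j + 1/2 - g] / [ρ_j + λ_j + 1/2]` over `j > k`. -/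
noncomputable def ratioUpper₀ : ℝ := ∏ j ∈ Finset.Icc (k + 1) n,
  bracket (alpha n 1 C) p r (rho n C j + 1 / 2 - C.g) / bracket (alpha n 1 C) p r (rho n C j + 1 / 2)

/-- Product of `[ρ_j + λ_j - 1/2 + g] / [ρ_j + λ_j - 1/2]` over `j > k`. -/
noncomputable def ratioLower₀ : ℝ := ∏ j ∈ Finset.Icc (k + 1) n,
  bracket (alpha n 1 C) p r (rho n C j - 1 / 2 + C.g) / bracket (alpha n 1 C) p r (rho n C j - 1 / 2)

/-- The constant `c_r` without its factor `[g_{π_r(1)} - 1/2]_1`. -/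
noncomputable def cRest : ℝ :=
  2 / (bracket (alpha n 1 C) p 0 C.g * bracket (alpha n 1 C) p 0 (C.g - 1)) *
    (bracket (alpha n 1 C) p 0 (C.gr' (perm4 r 0)) *
      ∏ i : Fin 3, bracket (alpha n 1 C) p i.succ (C.gr (perm4 r i.succ) - 1 / 2) *
        bracket (alpha n 1 C) p i.succ (C.gr' (perm4 r i.succ)))

theorem cConst_eq :
    cConst n 1 C p r = bracket (alpha n 1 C) p 0 (C.gr (perm4 r 0) - 1 / 2) * cRest n C p r := by
  rw [cConst, cRest, Fin.prod_univ_succ]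
  ring

/-- The value `[g_2 - 1/2]_1 / [ρ_1 + 3/2]_2` after cancellation of the trigonometric factors. -/
noncomputable def reflRatio : ℝ :=
  prodFactor (alpha n 1 C) p 0 (C.gr 1 - 1 / 2) /
    (Real.sin (alpha n 1 C / 2) * prodFactor (alpha n 1 C) p 1 (rho n C 1 + 3 / 2))

/-- The coefficient `A_{(1^k)}` with its removable singularities removed. -/
noncomputable def colARegular : ℝ :=
  (bracket (alpha n 1 C) p 0 (rho n C k - 1 / 2) * cRest n C p 0 *
    (ratioUpper₁ n C p 0 k * ratioLower₁ n C p 0 k * ratioUpper₀ n C p 0 k) - cConst n 1 C p 0) +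
  (bracket (alpha n 1 C) p 1 (rho n C (k + 1) + 3 / 2) * reflRatio n C p * cRest n C p 1 *
    (ratioLower₁ n C p 1 k * ratioUpper₀ n C p 1 k * ratioLower₀ n C p 1 k) - cConst n 1 C p 1) +
  cConst n 1 C p 2 * (ratioUpper₁ n C p 2 k * ratioLower₁ n C p 2 k * ratioUpper₀ n C p 2 k *
    ratioLower₀ n C p 2 k - 1) +
  cConst n 1 C p 3 * (ratioUpper₁ n C p 3 k * ratioLower₁ n C p 3 k * ratioUpper₀ n C p 3 k *
    ratioLower₀ n C p 3 k - 1)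

variable {n C p r k}

theorem coeffARaw_columnFun (hk : k ≤ n) :
    coeffARaw n 1 C p (columnFun n k) = ∑ r : Fin 4, cConst n 1 C p r *
      (ratioUpper₁ n C p r k * ratioLower₁ n C p r k * ratioUpper₀ n C p r k *
        ratioLower₀ n C p r k - 1) := by
  rw [coeffARaw]
  refine Finset.sum_congr rfl fun r _ => ?_
  congr 2
  have h1 : ∀ i : Fin n, columnFun n k i = if (i : ℕ) + 1 ≤ k then 1 else 0 := fun i => by
    simp [columnFun]
  simp only [h1]
  refine (prod_fin_eq_prod_Icc n fun j =>
    bracket (alpha n 1 C) p r (rho n C j + ((if j ≤ k then 1 else 0 : ℤ) : ℝ) + 1 / 2 - C.g) /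
      bracket (alpha n 1 C) p r (rho n C j + ((if j ≤ k then 1 else 0 : ℤ) : ℝ) + 1 / 2) *
    (bracket (alpha n 1 C) p r (rho n C j + ((if j ≤ k then 1 else 0 : ℤ) : ℝ) - 1 / 2 + C.g) /
      bracket (alpha n 1 C) p r (rho n C j + ((if j ≤ k then 1 else 0 : ℤ) : ℝ) - 1 / 2))).trans ?_
  rw [prod_Icc_split _ hk (by omega), mul_assoc]
  simp only [ratioUpper₁, ratioLower₁, ratioUpper₀, ratioLower₀]
  rw [← Finset.prod_mul_distrib, ← Finset.prod_mul_distrib]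
  congr 1
  · refine Finset.prod_congr rfl fun j hj => ?_
    rw [if_pos (Finset.mem_Icc.1 hj).2]
    push_cast
    congr 3 <;> ring
  · refine Finset.prod_congr rfl fun j hj => ?_
    rw [if_neg (by have := (Finset.mem_Icc.1 hj).1; omega)]
    simp

/-- Since `ρ_{j-1} = ρ_j + g`, the product telescopes. For the first bracket, the surviving
denominator `[g_1 - 1/2]` is the factor contained in the constant `c_1`. -/
theorem ratioLower₀_eq (hk : k ≤ n)
    (hne : ∀ j, k ≤ j → j ≤ n → bracket (alpha n 1 C) p r (rho n C j - 1 / 2) ≠ 0) :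
    ratioLower₀ n C p r k = bracket (alpha n 1 C) p r (rho n C k - 1 / 2) /
      bracket (alpha n 1 C) p r (C.gr 0 - 1 / 2) := by
  rw [← rho_self n C, ← prod_telescope_down hk hne, ratioLower₀]
  refine Finset.prod_congr rfl fun j hj => ?_
  rw [rho_pred n C (by have := (Finset.mem_Icc.1 hj).1; omega)]
  congr 2
  ring

/-- Telescoping in the opposite direction, from `ρ_{j+1} = ρ_j - g`. For the second bracket the
surviving denominator in `ρ_1 + 3/2` is matched with a factor of `c_2` by the reflection
`bracket_refl`. -/
theorem ratioUpper₁_eq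
    (hne : ∀ j, j ≤ k → bracket (alpha n 1 C) p r (rho n C (j + 1) + 3 / 2) ≠ 0) :
    ratioUpper₁ n C p r k = bracket (alpha n 1 C) p r (rho n C (k + 1) + 3 / 2) /
      bracket (alpha n 1 C) p r (rho n C 1 + 3 / 2) := by
  have := prod_telescope_up (f := fun j => bracket (alpha n 1 C) p r (rho n C j + 3 / 2))
    (Nat.zero_le k) fun j _ hj => hne j hj
  rw [zero_add] at this
  rw [← this, ratioUpper₁]
  refine Finset.prod_congr rfl fun j hj => ?_
  rw [rho_succ]
  congr 2
  ring

/-- Where the sine or cosine vanishes, its derivative does not, by `sin ^ 2 + cos ^ 2 = 1`; the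
zeros are therefore isolated. -/
theorem eventually_bracket_ne_zero {α : ℝ} (hα : 0 < α) (hα' : α < Real.pi) (hp : |p| < 1)
    (hr : r = 0 ∨ r = 1) (z : ℝ) : ∀ᶠ s in 𝓝[≠] (0 : ℝ), bracket α p r (z + s) ≠ 0 := by
  have hd : HasDerivAt (fun s => α / 2 * (z + s)) (α / 2) 0 := by
    simpa using ((hasDerivAt_id (0 : ℝ)).const_add z).const_mul (α / 2)
  have hsin : 0 < Real.sin (α / 2) := Real.sin_pos_of_pos_of_lt_pi (by positivity) (by linarith)
  rcases hr with rfl | rfl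
  · have h1 : ∀ᶠ s in 𝓝[≠] (0 : ℝ), Real.sin (α / 2 * (z + s)) ≠ 0 := by
      by_cases h0 : Real.sin (α / 2 * (z + 0)) = 0
      · refine hd.sin.eventually_ne (mul_ne_zero (fun h => ?_) (by positivity))
        nlinarith [Real.sin_sq_add_cos_sq (α / 2 * (z + 0))]
      · exact (hd.sin.continuousAt.eventually_ne h0).filter_mono nhdsWithin_le_nhds
    filter_upwards [h1] with s hs
    rw [bracket_eq_mul hp]
    exact mul_ne_zero (div_ne_zero hs hsin.ne') (prodFactor_pos hp _ _).ne'
  · have h1 : ∀ᶠ s in 𝓝[≠] (0 : ℝ), Real.cos (α / 2 * (z + s)) ≠ 0 := by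
      by_cases h0 : Real.cos (α / 2 * (z + 0)) = 0
      · refine hd.cos.eventually_ne (mul_ne_zero (fun h => ?_) (by positivity))
        nlinarith [Real.sin_sq_add_cos_sq (α / 2 * (z + 0))]
      · exact (hd.cos.continuousAt.eventually_ne h0).filter_mono nhdsWithin_le_nhds
    filter_upwards [h1] with s hs
    rw [bracket_eq_mul hp]
    exact mul_ne_zero hs (prodFactor_pos hp _ _).ne'

end Diagonal

namespace Admissible

variable {n : ℕ} {C : Couplings} {p : ℝ}

theorem sin_half_pos (h : Admissible n C) : 0 < Real.sin (alpha n 1 C / 2) :=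
  Real.sin_pos_of_pos_of_lt_pi (by linarith [h.alpha_pos])
    (by linarith [h.alpha_pos, h.alpha_lt_pi])

/-- The reflection `[g_2 - s - 1/2]_1 = (const) [ρ_1 + s + 3/2]_2`. -/
theorem bracket_refl (h : Admissible n C) (hp : |p| < 1) (s : ℝ) :
    bracket (alpha n 1 C) p 0 ((C.shift s).gr 1 - 1 / 2) =
      bracket (alpha n 1 C) p 1 (rho n (C.shift s) 1 + 3 / 2) * reflRatio n (C.shift s) p := by
  -- The truncation condition makes the two arguments complementary, which turns the sine into a
  -- cosine; the shift cancels because `g_1 + g_2` is fixed.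
  have h1 : alpha n 1 C / 2 * ((C.shift s).gr 1 - 1 / 2) =
      Real.pi / 2 - alpha n 1 C / 2 * (rho n (C.shift s) 1 + 3 / 2) := by
    rw [← h.alpha_mul, rho_shift, rho]
    simp only [Couplings.shift, Matrix.cons_val_one, Matrix.cons_val_zero, Nat.cast_one]
    ring
  have h2 := h.sin_half_pos.ne'
  have h3 := (prodFactor_pos (α := alpha n 1 C) hp 1 (rho n (C.shift s) 1 + 3 / 2)).ne'
  rw [bracket_eq_mul hp, bracket_eq_mul hp, reflRatio, alpha_shift]
  simp only [trigFactor, Matrix.cons_val_one, Matrix.cons_val_zero]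
  rw [h1, Real.sin_pi_div_two_sub]
  generalize prodFactor (alpha n 1 C) p 1 (rho n (C.shift s) 1 + 3 / 2) = y at *
  generalize prodFactor (alpha n 1 C) p 0 ((C.shift s).gr 1 - 1 / 2) = x at *
  generalize Real.cos _ = w
  field_simp

/-- The only denominators that can vanish are `[ρ_j - 1/2]_1` for `j > k` and `[ρ_j + 3/2]_2` for `j
≤ k`. For small nonzero shifts they do not, and after telescoping the first is cancelled by `c_1`
and the second by `c_2`. -/
theorem eventually_coeffARaw_eq (h : Admissible n C) (hp : |p| < 1) {k : ℕ} (hk : k ≤ n) :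
    ∀ᶠ s in 𝓝[≠] (0 : ℝ),
      coeffARaw n 1 (C.shift s) p (columnFun n k) = colARegular n (C.shift s) p k := by
  have h1 : ∀ᶠ s in 𝓝[≠] (0 : ℝ), ∀ j ∈ Finset.Icc k n,
      bracket (alpha n 1 C) p 0 (rho n C j - 1 / 2 + s) ≠ 0 :=
    (Filter.eventually_all_finset _).2 fun j _ =>
      eventually_bracket_ne_zero h.alpha_pos h.alpha_lt_pi hp (.inl rfl) _
  have h2 : ∀ᶠ s in 𝓝[≠] (0 : ℝ), ∀ j ∈ Finset.Icc 0 k,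
      bracket (alpha n 1 C) p 1 (rho n C (j + 1) + 3 / 2 + s) ≠ 0 :=
    (Filter.eventually_all_finset _).2 fun j _ =>
      eventually_bracket_ne_zero h.alpha_pos h.alpha_lt_pi hp (.inr rfl) _
  filter_upwards [h1, h2] with s h1 h2
  have h3 : ∀ j, k ≤ j → j ≤ n →
      bracket (alpha n 1 (C.shift s)) p 0 (rho n (C.shift s) j - 1 / 2) ≠ 0 := by
    intro j hj1 hj2
    rw [alpha_shift, rho_shift, add_sub_right_comm]
    exact h1 j (Finset.mem_Icc.2 ⟨hj1, hj2⟩)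
  have h4 : ∀ j, j ≤ k →
      bracket (alpha n 1 (C.shift s)) p 1 (rho n (C.shift s) (j + 1) + 3 / 2) ≠ 0 := by
    intro j hj
    rw [alpha_shift, rho_shift, add_right_comm]
    exact h2 j (Finset.mem_Icc.2 ⟨Nat.zero_le _, hj⟩)
  -- First cancellation: the factor `[g_1 - 1/2]_1` of `c_1` absorbs the telescoped denominator.
  have h5 : bracket (alpha n 1 (C.shift s)) p 0 ((C.shift s).gr 0 - 1 / 2) *
      ratioLower₀ n (C.shift s) p 0 k = bracket (alpha n 1 (C.shift s)) p 0
        (rho n (C.shift s) k - 1 / 2) := by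
    rw [ratioLower₀_eq hk h3, mul_div_cancel₀]
    rw [← rho_self n]
    exact h3 n hk le_rfl
  -- Second cancellation: the factor `[g_2 - 1/2]_1` of `c_2` is a nonvanishing multiple of the
  -- denominator `[ρ_1 + 3/2]_2`.
  have h6 : bracket (alpha n 1 (C.shift s)) p 0 ((C.shift s).gr 1 - 1 / 2) *
      ratioUpper₁ n (C.shift s) p 1 k = bracket (alpha n 1 (C.shift s)) p 1
        (rho n (C.shift s) (k + 1) + 3 / 2) * reflRatio n (C.shift s) p := by
    have h7 := h4 0 (Nat.zero_le _)
    rw [ratioUpper₁_eq h4, alpha_shift, h.bracket_refl hp]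
    rw [alpha_shift, zero_add] at h7
    generalize bracket (alpha n 1 C) p 1 (rho n (C.shift s) 1 + 3 / 2) = x at *
    field_simp
  rw [coeffARaw_columnFun hk, colARegular, Fin.sum_univ_four, ← h5, ← h6, cConst_eq n _ p 0,
    cConst_eq n _ p 1]
  have h8 : perm4 0 0 = 0 := rfl
  have h9 : perm4 1 0 = 1 := rfl
  rw [h8, h9]
  ring

theorem continuousAt_bracket_shift (hp : |p| < 1) (r : Fin 4) {f : ℝ → ℝ} (hf : Continuous f) :
    ContinuousAt (fun s => bracket (alpha n 1 (C.shift s)) p r (f s)) 0 := by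
  simp only [alpha_shift]
  exact ((bracket_continuous hp r).comp hf).continuousAt

theorem continuous_shift_rho (n : ℕ) (C : Couplings) (j : ℕ) :
    Continuous fun s => rho n (C.shift s) j := by
  simp only [rho_shift]
  fun_prop

theorem continuousAt_prod_ratio (hp : |p| < 1) (r : Fin 4) (I : Finset ℕ) {f g : ℕ → ℝ → ℝ}
    (hf : ∀ j, Continuous (f j)) (hg : ∀ j, Continuous (g j))
    (hne : ∀ j ∈ I, bracket (alpha n 1 C) p r (g j 0) ≠ 0) :
    ContinuousAt (fun s => ∏ j ∈ I, bracket (alpha n 1 (C.shift s)) p r (f j s) /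
      bracket (alpha n 1 (C.shift s)) p r (g j s)) 0 := by
  refine tendsto_finsetProd _ fun j hj => ?_
  refine (continuousAt_bracket_shift hp r (hf j)).div (continuousAt_bracket_shift hp r (hg j)) ?_
  rw [shift_zero]
  exact hne j hj

/-- The denominators of the nonsingular ratios do not vanish. -/
theorem ratio_denominators_ne_zero (h : Admissible n C) (hp : |p| < 1) {j : ℕ} (h1 : 1 ≤ j)
    (h2 : j ≤ n) (r : Fin 4) :
    bracket (alpha n 1 C) p r (rho n C j + 1 / 2) ≠ 0 ∧
    (r ≠ 1 → bracket (alpha n 1 C) p r (rho n C j + 3 / 2) ≠ 0) ∧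
    (r ≠ 0 → bracket (alpha n 1 C) p r (rho n C j - 1 / 2) ≠ 0) := by
  obtain ⟨h3, h4⟩ := h.rho_bounds h1 h2
  have h5 := h.sub_one_mul_nonneg
  have h6 := h.g1_pos
  have h7 := h.g2_pos
  refine ⟨(h.one_var_pos hp h1 h2 r).2.1.ne', fun hr => ?_, fun hr => ?_⟩ <;>
    refine (h.bracket_pos hp ?_ ?_).ne' <;> rintro rfl
  · constructor <;> linarith
  · simp at hr
  · simp at hr
  · constructor <;> linarith

end Admissible

end EllipticRacah

/-! ### Removal of singularities and analyticity of the diagonal coefficients -/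

namespace EllipticRacah

open Filter Topology Polynomial

namespace Admissible

variable {n : ℕ} {C : Couplings} {p : ℝ}

theorem continuousAt_cRest (hp : |p| < 1) (r : Fin 4) :
    ContinuousAt (fun s => cRest n (C.shift s) p r) 0 := by
  simp only [cRest, alpha_shift]
  refine ContinuousAt.mul continuousAt_const (ContinuousAt.mul continuousAt_const ?_)
  refine tendsto_finsetProd _ fun i _ => ContinuousAt.mul ?_ continuousAt_const
  exact ((bracket_continuous hp _).comp ((continuous_shift_gr C _).sub continuous_const)).continuousAt

theorem continuousAt_cConst (hp : |p| < 1) (r : Fin 4) :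
    ContinuousAt (fun s => cConst n 1 (C.shift s) p r) 0 := by
  simp only [cConst_eq]
  exact (continuousAt_bracket_shift hp 0 ((continuous_shift_gr C _).sub continuous_const)).mul
    (continuousAt_cRest hp r)

theorem continuousAt_reflRatio (h : Admissible n C) (hp : |p| < 1) :
    ContinuousAt (fun s => reflRatio n (C.shift s) p) 0 := by
  simp only [reflRatio, alpha_shift]
  refine ContinuousAt.div ?_ (continuousAt_const.mul ?_)
    (mul_ne_zero h.sin_half_pos.ne' (prodFactor_pos hp _ _).ne')
  · exact ((prodFactor_continuous hp _).comp
      ((continuous_shift_gr C _).sub continuous_const)).continuousAt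
  · exact ((prodFactor_continuous hp _).comp
      ((continuous_shift_rho n C _).add continuous_const)).continuousAt

theorem continuousAt_ratioUpper₁ (h : Admissible n C) (hp : |p| < 1) {r : Fin 4} (hr : r ≠ 1) {k : ℕ}
    (hk : k ≤ n) : ContinuousAt (fun s => ratioUpper₁ n (C.shift s) p r k) 0 := by
  refine continuousAt_prod_ratio hp r _
    (fun j => ((continuous_shift_rho n C j).add continuous_const).sub continuous_const)
    (fun j => (continuous_shift_rho n C j).add continuous_const) fun j hj => ?_
  rw [Finset.mem_Icc] at hj
  rw [shift_zero]
  exact (h.ratio_denominators_ne_zero hp hj.1 (by omega) r).2.1 hr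

theorem continuousAt_ratioLower₁ (h : Admissible n C) (hp : |p| < 1) {r : Fin 4} {k : ℕ}
    (hk : k ≤ n) : ContinuousAt (fun s => ratioLower₁ n (C.shift s) p r k) 0 := by
  refine continuousAt_prod_ratio hp r _
    (fun j => ((continuous_shift_rho n C j).add continuous_const).add continuous_const)
    (fun j => (continuous_shift_rho n C j).add continuous_const) fun j hj => ?_
  rw [Finset.mem_Icc] at hj
  rw [shift_zero]
  exact (h.ratio_denominators_ne_zero hp hj.1 (by omega) r).1

theorem continuousAt_ratioUpper₀ (h : Admissible n C) (hp : |p| < 1) {r : Fin 4} {k : ℕ} :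
    ContinuousAt (fun s => ratioUpper₀ n (C.shift s) p r k) 0 := by
  refine continuousAt_prod_ratio hp r _
    (fun j => ((continuous_shift_rho n C j).add continuous_const).sub continuous_const)
    (fun j => (continuous_shift_rho n C j).add continuous_const) fun j hj => ?_
  rw [Finset.mem_Icc] at hj
  rw [shift_zero]
  exact (h.ratio_denominators_ne_zero hp (by omega) hj.2 r).1

theorem continuousAt_ratioLower₀ (h : Admissible n C) (hp : |p| < 1) {r : Fin 4} (hr : r ≠ 0) {k : ℕ} :
    ContinuousAt (fun s => ratioLower₀ n (C.shift s) p r k) 0 := by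
  refine continuousAt_prod_ratio hp r _
    (fun j => ((continuous_shift_rho n C j).sub continuous_const).add continuous_const)
    (fun j => (continuous_shift_rho n C j).sub continuous_const) fun j hj => ?_
  rw [Finset.mem_Icc] at hj
  rw [shift_zero]
  exact (h.ratio_denominators_ne_zero hp (by omega) hj.2 r).2.2 hr

theorem continuousAt_colARegular (h : Admissible n C) (hp : |p| < 1) {k : ℕ} (hk : k ≤ n) :
    ContinuousAt (fun s => colARegular n (C.shift s) p k) 0 := by
  have hc := fun r => continuousAt_cConst (n := n) (C := C) hp r
  have hR := fun r => continuousAt_cRest (n := n) (C := C) hp r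
  have h1 := fun {r : Fin 4} (hr : r ≠ 1) => h.continuousAt_ratioUpper₁ hp hr hk
  have h2 := fun r => h.continuousAt_ratioLower₁ hp (r := r) hk
  have h3 := fun r => h.continuousAt_ratioUpper₀ hp (r := r) (k := k)
  have h4 := fun {r : Fin 4} (hr : r ≠ 0) => h.continuousAt_ratioLower₀ hp hr (k := k)
  refine ((ContinuousAt.add ?_ ?_).add ?_).add ?_
  · exact (((continuousAt_bracket_shift hp 0
      ((continuous_shift_rho n C _).sub continuous_const)).mul (hR 0)).mul
      (((h1 (by decide)).mul (h2 0)).mul (h3 0))).sub (hc 0)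
  · exact ((((continuousAt_bracket_shift hp 1
      ((continuous_shift_rho n C _).add continuous_const)).mul (h.continuousAt_reflRatio hp)).mul
      (hR 1)).mul (((h2 1).mul (h3 1)).mul (h4 (by decide)))).sub (hc 1)
  · exact (hc 2).mul (((((h1 (by decide)).mul (h2 2)).mul (h3 2)).mul (h4 (by decide))).sub
      continuousAt_const)
  · exact (hc 3).mul (((((h1 (by decide)).mul (h2 3)).mul (h3 3)).mul (h4 (by decide))).sub
      continuousAt_const)

/-- The diagonal coefficients on columns, with the singularities removed. -/
theorem colA_eq (h : Admissible n C) (hp : |p| < 1) {k : ℕ} (hk : k ≤ n) :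
    colA n C p k = colARegular n C p k := by
  have h1 : Tendsto (fun s => colARegular n (C.shift s) p k) (𝓝[≠] 0) (𝓝 (colARegular n C p k)) := by
    have := (h.continuousAt_colARegular hp hk).tendsto
    rw [shift_zero] at this
    exact this.mono_left nhdsWithin_le_nhds
  refine Tendsto.limUnder_eq (h1.congr' ?_)
  filter_upwards [h.eventually_coeffARaw_eq hp hk] with s hs
  exact hs.symm

theorem analyticAt_prod_ratio (hp : |p| < 1) (r : Fin 4) (I : Finset ℕ) {f g : ℕ → ℝ}
    (hne : ∀ j ∈ I, bracket (alpha n 1 C) p r (g j) ≠ 0) :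
    AnalyticAt ℝ (fun p => ∏ j ∈ I, bracket (alpha n 1 C) p r (f j) /
      bracket (alpha n 1 C) p r (g j)) p :=
  Finset.analyticAt_fun_prod _ fun j hj =>
    (bracket_analyticAt hp r _).div (bracket_analyticAt hp r _) (hne j hj)

theorem analyticAt_ratioUpper₁ (h : Admissible n C) (hp : |p| < 1) {r : Fin 4} (hr : r ≠ 1) {k : ℕ}
    (hk : k ≤ n) : AnalyticAt ℝ (fun p => ratioUpper₁ n C p r k) p := by
  refine analyticAt_prod_ratio hp r _ fun j hj => ?_
  rw [Finset.mem_Icc] at hj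
  exact (h.ratio_denominators_ne_zero hp hj.1 (by omega) r).2.1 hr

theorem analyticAt_ratioLower₁ (h : Admissible n C) (hp : |p| < 1) {r : Fin 4} {k : ℕ}
    (hk : k ≤ n) : AnalyticAt ℝ (fun p => ratioLower₁ n C p r k) p := by
  refine analyticAt_prod_ratio hp r _ fun j hj => ?_
  rw [Finset.mem_Icc] at hj
  exact (h.ratio_denominators_ne_zero hp hj.1 (by omega) r).1

theorem analyticAt_ratioUpper₀ (h : Admissible n C) (hp : |p| < 1) {r : Fin 4} {k : ℕ} :
    AnalyticAt ℝ (fun p => ratioUpper₀ n C p r k) p := by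
  refine analyticAt_prod_ratio hp r _ fun j hj => ?_
  rw [Finset.mem_Icc] at hj
  exact (h.ratio_denominators_ne_zero hp (by omega) hj.2 r).1

theorem analyticAt_ratioLower₀ (h : Admissible n C) (hp : |p| < 1) {r : Fin 4} (hr : r ≠ 0) {k : ℕ} :
    AnalyticAt ℝ (fun p => ratioLower₀ n C p r k) p := by
  refine analyticAt_prod_ratio hp r _ fun j hj => ?_
  rw [Finset.mem_Icc] at hj
  exact (h.ratio_denominators_ne_zero hp (by omega) hj.2 r).2.2 hr

theorem analyticAt_reflRatio (h : Admissible n C) (hp : |p| < 1) :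
    AnalyticAt ℝ (fun p => reflRatio n C p) p :=
  (prodFactor_analyticAt hp _ _).div (analyticAt_const.mul (prodFactor_analyticAt hp _ _))
    (mul_ne_zero h.sin_half_pos.ne' (prodFactor_pos hp _ _).ne')

theorem analyticAt_cRest (hp : |p| < 1)
    (hg : bracket (alpha n 1 C) p 0 C.g * bracket (alpha n 1 C) p 0 (C.g - 1) ≠ 0) (r : Fin 4) :
    AnalyticAt ℝ (fun p => cRest n C p r) p := by
  refine (analyticAt_const.div ((bracket_analyticAt hp _ _).mul (bracket_analyticAt hp _ _)) hg).mul
    ((bracket_analyticAt hp _ _).mul (Finset.analyticAt_fun_prod _ fun i _ => ?_))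
  exact (bracket_analyticAt hp _ _).mul (bracket_analyticAt hp _ _)

theorem analyticAt_cConst (hp : |p| < 1)
    (hg : bracket (alpha n 1 C) p 0 C.g * bracket (alpha n 1 C) p 0 (C.g - 1) ≠ 0) (r : Fin 4) :
    AnalyticAt ℝ (fun p => cConst n 1 C p r) p := by
  simp only [cConst_eq]
  exact (bracket_analyticAt hp _ _).mul (analyticAt_cRest hp hg r)

theorem analyticAt_colARegular (h : Admissible n C) (hp : |p| < 1)
    (hg : bracket (alpha n 1 C) p 0 C.g * bracket (alpha n 1 C) p 0 (C.g - 1) ≠ 0) {k : ℕ}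
    (hk : k ≤ n) : AnalyticAt ℝ (fun p => colARegular n C p k) p := by
  have hc := fun r => analyticAt_cConst (n := n) (C := C) hp hg r
  have hR := fun r => analyticAt_cRest (n := n) (C := C) hp hg r
  have h1 := fun {r : Fin 4} (hr : r ≠ 1) => h.analyticAt_ratioUpper₁ hp hr hk
  have h2 := fun r => h.analyticAt_ratioLower₁ hp (r := r) hk
  have h3 := fun r => h.analyticAt_ratioUpper₀ hp (r := r) (k := k)
  have h4 := fun {r : Fin 4} (hr : r ≠ 0) => h.analyticAt_ratioLower₀ hp hr (k := k)
  have h5 := h.analyticAt_reflRatio hp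
  refine ((AnalyticAt.add ?_ ?_).add ?_).add ?_
  · exact (((bracket_analyticAt hp _ _).mul (hR 0)).mul
      (((h1 (by decide)).mul (h2 0)).mul (h3 0))).sub (hc 0)
  · exact ((((bracket_analyticAt hp _ _).mul h5).mul
      (hR 1)).mul (((h2 1).mul (h3 1)).mul (h4 (by decide)))).sub (hc 1)
  · exact (hc 2).mul (((((h1 (by decide)).mul (h2 2)).mul (h3 2)).mul (h4 (by decide))).sub
      analyticAt_const)
  · exact (hc 3).mul (((((h1 (by decide)).mul (h2 3)).mul (h3 3)).mul (h4 (by decide))).sub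
      analyticAt_const)

theorem colA_analyticAt (h : Admissible n C) (hp : |p| < 1)
    (hg : bracket (alpha n 1 C) p 0 C.g * bracket (alpha n 1 C) p 0 (C.g - 1) ≠ 0) {k : ℕ}
    (hk : k ≤ n) : AnalyticAt ℝ (fun p => colA n C p k) p := by
  refine (h.analyticAt_colARegular hp hg hk).congr ?_
  filter_upwards [(isOpen_lt continuous_abs continuous_const).mem_nhds hp] with x hx
  exact (h.colA_eq hx hk).symm

/-- The denominator of the constants `c_r` does not vanish. -/
theorem sin_g_ne_zero (h : Admissible n C) (hg_ne : C.g ≠ 1)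
    (hpole : n = 1 → Real.sin (alpha n 1 C / 2 * C.g) ≠ 0 ∧
      Real.sin (alpha n 1 C / 2 * (C.g - 1)) ≠ 0) :
    Real.sin (alpha n 1 C / 2 * C.g) ≠ 0 ∧ Real.sin (alpha n 1 C / 2 * (C.g - 1)) ≠ 0 := by
  by_cases hn : n = 1
  · exact hpole hn
  have h2 : (2 : ℝ) ≤ n := by
    have := h.one_le
    exact_mod_cast (by omega : 2 ≤ n)
  have hg := h.g_pos
  have hα := h.alpha_pos
  -- For `n ≥ 2` this gives `α (1 + g) ≤ π`, so both half-angles have absolute value below `π`; for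
  -- `n = 1` no such bound exists and the condition has to be assumed.
  have hN : C.g ≤ ((n : ℝ) - 1) * C.g := by nlinarith
  have hL := h.alpha_mul
  have h3 : alpha n 1 C * (1 + C.g) ≤ Real.pi := by
    rw [← hL]
    have := h.g1_pos
    have := h.g2_pos
    exact mul_le_mul_of_nonneg_left (by linarith) hα.le
  refine ⟨(Real.sin_pos_of_pos_of_lt_pi (by positivity) (by nlinarith)).ne', ?_⟩
  rcases lt_or_gt_of_ne hg_ne with hlt | hgt
  · have h4 : 0 < Real.sin (alpha n 1 C / 2 * (1 - C.g)) :=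
      Real.sin_pos_of_pos_of_lt_pi (mul_pos (by positivity) (by linarith)) (by nlinarith)
    rw [show alpha n 1 C / 2 * (C.g - 1) = -(alpha n 1 C / 2 * (1 - C.g)) by ring, Real.sin_neg]
    exact neg_ne_zero.2 h4.ne'
  · exact (Real.sin_pos_of_pos_of_lt_pi (mul_pos (by positivity) (by linarith)) (by nlinarith)).ne'

theorem bracket_g_ne_zero (h : Admissible n C) (hp : |p| < 1)
    (hsin : Real.sin (alpha n 1 C / 2 * C.g) ≠ 0 ∧ Real.sin (alpha n 1 C / 2 * (C.g - 1)) ≠ 0) :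
    bracket (alpha n 1 C) p 0 C.g * bracket (alpha n 1 C) p 0 (C.g - 1) ≠ 0 := by
  rw [bracket_eq_mul hp, bracket_eq_mul hp]
  exact mul_ne_zero
    (mul_ne_zero (div_ne_zero hsin.1 h.sin_half_pos.ne') (prodFactor_pos hp _ _).ne')
    (mul_ne_zero (div_ne_zero hsin.2 h.sin_half_pos.ne') (prodFactor_pos hp _ _).ne')

end Admissible

end EllipticRacah

namespace EllipticRacah

open Polynomial

/-! ### Trigonometric identities -/

section Trigonometry

open Real

/-- The constant row sum at an interior row `k`, cleared of denominators: `U`, `V`, `w`, `v` are the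
vertices with indices `k + 1`, `k`, `n + 1`, `0`. The first two terms come from the diagonal entry,
the other two from the steps up and down. -/
theorem diagonal_identity (U V w v δ S : ℝ) :
    4 * (sin δ + S) * (sin v * sin w) * (cos U * cos V) * sin (U + V) +
      4 * (sin δ - S) * (cos v * cos w) * (sin U * sin V) * sin (U + V) +
      2 * (sin (2 * U + δ) + S) * (sin (U - w) * sin (U + v)) * sin (2 * V) +
      2 * (sin (2 * V - δ) - S) * (sin (v - V) * sin (V + w)) * sin (2 * U) =
      2 * sin (δ + v - w - V + U) * (sin (2 * U) * sin (2 * V) * sin (U + V)) := by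
  have hU := sin_sq_add_cos_sq U
  have hV := sin_sq_add_cos_sq V
  simp only [sin_two_mul, cos_two_mul', sin_add, sin_sub, cos_add, cos_sub]
  generalize sin U = a, cos U = b, sin V = c, cos V = d, sin w = e, cos w = f, sin v = x,
    cos v = y, sin δ = s, cos δ = t at *
  grind

/-- The row sum at `k = 0`, where there is no step down and no division by the vertex `V` is
permitted. -/
theorem diagonal_identity_first (U w δ S : ℝ) :
    (sin δ + S) * sin w * cos U + (sin δ - S) * cos w * sin U +
      (sin (2 * U + δ) + S) * sin (U - w) = sin (δ + U - w) * sin (2 * U) := by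
  have hU := sin_sq_add_cos_sq U
  simp only [sin_two_mul, cos_two_mul', sin_add, sin_sub, cos_add]
  generalize sin U = a, cos U = b, sin w = e, cos w = f, sin δ = s, cos δ = t at *
  grind

/-- The row sum at `k = n`, where there is no step up. -/
theorem diagonal_identity_last (V v δ S : ℝ) :
    (sin δ + S) * sin v * cos V + (sin δ - S) * cos v * sin V +
      (sin (2 * V - δ) - S) * sin (v - V) = sin (δ + v - V) * sin (2 * V) := by
  have hU := sin_sq_add_cos_sq V
  simp only [sin_two_mul, cos_two_mul', sin_add, sin_sub, cos_add]
  generalize sin V = a, cos V = b, sin v = e, cos v = f, sin δ = s, cos δ = t at *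
  grind

/-- The three-term identity behind the action of the difference operator. -/
theorem brace_identity (x y z η δ S : ℝ) :
    (sin (2 * x - η + δ) + S) * sin (x - z) * sin (y + x) -
      (sin (2 * x + η - δ) - S) * sin (x + z) * sin (y - x) =
      sin (2 * x) * (-2 * cos (δ + (y - z) - η) * (sin (y - x) * sin (y + x)) +
        (sin (2 * y - η + δ) + S) * sin (y - z)) := by
  have hx := sin_sq_add_cos_sq x
  have hy := sin_sq_add_cos_sq y
  have hz := sin_sq_add_cos_sq z
  have hη := sin_sq_add_cos_sq η
  simp only [sin_two_mul, cos_two_mul', sin_add, sin_sub, cos_add, cos_sub]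
  generalize sin x = a, cos x = b, sin y = c, cos y = d, sin z = e, cos z = f, sin η = u,
    cos η = v, sin δ = s, cos δ = t at *
  grind

/-- This is `brace_identity` at `x = z` with `sin (2 z) * sin (y - z)` cancelled. It needs its own
proof since that factor may vanish at the last node. -/
theorem brace_identity_last (y z η δ S : ℝ) :
    -(sin (2 * z + η - δ) - S) = -2 * cos (δ + (y - z) - η) * sin (y + z) +
      (sin (2 * y - η + δ) + S) := by
  have h1 := sin_sub (y + z) (δ + (y - z) - η)
  have h2 := sin_add (y + z) (δ + (y - z) - η)
  rw [show y + z - (δ + (y - z) - η) = 2 * z + η - δ by ring] at h1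
  rw [show y + z + (δ + (y - z) - η) = 2 * y - η + δ by ring] at h2
  linear_combination -h1 - h2

/-- Evaluates the difference between a shifted and an unshifted interpolation product once their
common factors are removed; the right-hand side contains the denominator `sin (2 x - η)` of the step
coefficient. -/
theorem shift_identity (x y o η : ℝ) :
    sin (y - η + x) * sin (o + η - x) - sin (o + x) * sin (y - x) =
      sin (2 * x - η) * sin (o - y + η) := by
  have hx := sin_sq_add_cos_sq x
  have hη := sin_sq_add_cos_sq η
  simp only [sin_two_mul, cos_two_mul', sin_add, sin_sub, cos_add, cos_sub]
  generalize sin x = a, cos x = b, sin y = c, cos y = d, sin o = e, cos o = f, sin η = u,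
    cos η = v at *
  grind

end Trigonometry

/-! ### Sums against rows and columns of tridiagonal matrices -/

theorem tri_row_sum {R : Type*} [CommRing R] (A B D : ℕ → R) {n : ℕ} (k : Fin (n + 1)) (f : ℕ → R) :
    ∑ j : Fin (n + 1), tri A B D (n + 1) k j * f j = A k * f k +
      ((if (k : ℕ) < n then B (k + 1) * f (k + 1) else 0) +
        (if 1 ≤ (k : ℕ) then D k * f (k - 1) else 0)) := by
  have hk := k.2
  have h1 : ∀ j : Fin (n + 1), tri A B D (n + 1) k j * f j = (if (j : ℕ) = k then A k * f k else 0) +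
      ((if (j : ℕ) = k + 1 then B (k + 1) * f (k + 1) else 0) +
        if (j : ℕ) = k - 1 ∧ 1 ≤ (k : ℕ) then D k * f (k - 1) else 0) := by
    intro j
    simp only [tri, Matrix.of_apply]
    by_cases h1 : (j : ℕ) = k
    · simp only [h1, if_true]
      rw [if_neg (by omega), if_neg (by omega)]
      ring
    · by_cases h2 : (j : ℕ) = k + 1
      · rw [if_neg h1, if_pos h2, if_neg h1, if_pos h2, if_neg (by omega), h2]
        ring
      · by_cases h3 : (k : ℕ) = j + 1
        · rw [if_neg h1, if_neg h2, if_pos h3, if_neg h1, if_neg h2, if_pos (by omega),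
            show (k : ℕ) - 1 = j by omega]
          ring
        · rw [if_neg h1, if_neg h2, if_neg h3, if_neg h1, if_neg h2, if_neg (by omega)]
          ring
  rw [Finset.sum_congr rfl fun j _ => h1 j, Finset.sum_add_distrib, Finset.sum_add_distrib,
    Fin.sum_univ_eq_sum_range (fun j => if j = (k : ℕ) then A k * f k else 0),
    Fin.sum_univ_eq_sum_range (fun j => if j = (k : ℕ) + 1 then B (k + 1) * f (k + 1) else 0),
    Fin.sum_univ_eq_sum_range
      (fun j => if j = (k : ℕ) - 1 ∧ 1 ≤ (k : ℕ) then D k * f (k - 1) else 0),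
    Finset.sum_ite_eq', Finset.sum_ite_eq', if_pos (by simp; omega)]
  congr 2
  · simp
  · by_cases h : 1 ≤ (k : ℕ)
    · simp only [h, and_true, if_true, Finset.sum_ite_eq']
      rw [if_pos (Finset.mem_range.2 (by omega))]
    · simp [h]

theorem tri_col_sum {R : Type*} [CommRing R] (A B D : ℕ → R) {n : ℕ} (m : Fin (n + 1)) (f : ℕ → R) :
    ∑ j : Fin (n + 1), f j * tri A B D (n + 1) j m = A m * f m +
      ((if (m : ℕ) < n then D (m + 1) * f (m + 1) else 0) +
        (if 1 ≤ (m : ℕ) then B m * f (m - 1) else 0)) := by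
  rw [← tri_row_sum A D B m f]
  refine Finset.sum_congr rfl fun j _ => ?_
  rw [mul_comm]
  congr 1
  simp only [tri, Matrix.of_apply]
  by_cases h1 : (j : ℕ) = m
  · rw [if_pos h1.symm, if_pos h1, h1]
  · rw [if_neg (Ne.symm h1), if_neg h1]
    by_cases h2 : (j : ℕ) = m + 1
    · rw [if_pos h2, if_neg (by omega), if_pos h2]
    · by_cases h3 : (m : ℕ) = j + 1
      · rw [if_pos h3, if_neg h2, if_pos h3]
      · rw [if_neg h3, if_neg h2, if_neg h3, if_neg h2]

/-! ### Triangularization of the trigonometric difference operator -/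

/-- Interpolation functions of `cos (2 t)` with nodes `X 0, X 1, …`. -/
noncomputable def nodeProd (X : ℕ → ℝ) (m : ℕ) (t : ℝ) : ℝ :=
  ∏ i ∈ Finset.range m, Real.sin (X i + t) * Real.sin (X i - t)

section NodeProd

open Real

variable {X : ℕ → ℝ} {η : ℝ}

@[simp] theorem nodeProd_zero (X : ℕ → ℝ) (t : ℝ) : nodeProd X 0 t = 1 := by simp [nodeProd]

theorem nodeProd_succ (X : ℕ → ℝ) (m : ℕ) (t : ℝ) :
    nodeProd X (m + 1) t = nodeProd X m t * (sin (X m + t) * sin (X m - t)) := by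
  rw [nodeProd, Finset.prod_range_succ, nodeProd]

theorem nodeProd_neg (X : ℕ → ℝ) (m : ℕ) (t : ℝ) : nodeProd X m (-t) = nodeProd X m t := by
  refine Finset.prod_congr rfl fun i _ => ?_
  rw [sub_neg_eq_add, ← sub_eq_add_neg, mul_comm]

theorem nodeProd_node (X : ℕ → ℝ) {m k : ℕ} (h : k < m) : nodeProd X m (X k) = 0 :=
  Finset.prod_eq_zero (Finset.mem_range.2 h) (by simp)

/-- The nodes have spacing `η`, so shifting `t` by `η` shifts the node index: up by one in the
factors with `X i + t`, down by one in those with `X i - t`. Only end factors change, and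
multiplying by `sin (X 0 + t)` avoids a division. -/
theorem nodeProd_sub (hX : ∀ i, X (i + 1) = X i - η) (t : ℝ) : ∀ m,
    nodeProd X (m + 1) (t - η) * sin (X 0 + t) =
      nodeProd X m t * (sin (X m + t) * (sin (X m - η + t) * sin (X 0 + η - t)))
  | 0 => by
    rw [nodeProd_succ, nodeProd_zero, nodeProd_zero, show X 0 + (t - η) = X 0 - η + t by ring,
      show X 0 - (t - η) = X 0 + η - t by ring]
    ring
  | m + 1 => by
    rw [nodeProd_succ, mul_right_comm, nodeProd_sub hX t m, nodeProd_succ X m, hX m,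
      show X m - η + (t - η) = X m - η - η + t by ring,
      show X m - η - (t - η) = X m - t by ring]
    ring

theorem nodeProd_add (hX : ∀ i, X (i + 1) = X i - η) (t : ℝ) (m : ℕ) :
    nodeProd X (m + 1) (t + η) * sin (X 0 - t) =
      nodeProd X m t * (sin (X m - t) * (sin (X m - η - t) * sin (X 0 + η + t))) := by
  have h := nodeProd_sub hX (-t) m
  rw [show -t - η = -(t + η) by ring, nodeProd_neg, nodeProd_neg] at h
  simpa only [← sub_eq_add_neg, sub_neg_eq_add] using h

/-- The action of the coefficient of the step up on `nodeProd`. -/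
theorem stepUp_nodeProd (hX : ∀ i, X (i + 1) = X i - η) {B σ δ S Z x : ℝ} {m : ℕ}
    (hB : B * (sin (2 * x - η) * sin η * sin (2 * x)) =
      σ * (sin (2 * x - η + δ) + S) * (sin (x - Z) * sin (x + X 0)))
    (h1 : sin (2 * x - η) ≠ 0) (h2 : sin (X 0 + x) ≠ 0) :
    B * (nodeProd X (m + 1) (x - η) - nodeProd X (m + 1) x) * (sin η * sin (2 * x)) =
      σ * (sin (2 * x - η + δ) + S) * sin (x - Z) *
        (nodeProd X m x * sin (X m + x) * sin (X 0 - X (m + 1))) := by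
  have h3 := nodeProd_sub hX x m
  have h4 := shift_identity x (X m) (X 0) η
  rw [show X 0 - X m + η = X 0 - X (m + 1) by rw [hX]; ring] at h4
  refine mul_right_cancel₀ (mul_ne_zero h1 h2) ?_
  rw [nodeProd_succ X m x]
  rw [add_comm x (X 0)] at hB
  linear_combination (nodeProd X (m + 1) (x - η) * sin (X 0 + x) -
      nodeProd X m x * (sin (X m + x) * sin (X m - x)) * sin (X 0 + x)) * hB +
    σ * (sin (2 * x - η + δ) + S) * sin (x - Z) * sin (X 0 + x) * h3 +
    σ * (sin (2 * x - η + δ) + S) * sin (x - Z) * sin (X 0 + x) *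
      (nodeProd X m x * sin (X m + x)) * h4

/-- The action of the coefficient of the step down on `nodeProd`. -/
theorem stepDown_nodeProd (hX : ∀ i, X (i + 1) = X i - η) {D σ δ S Z x : ℝ} {m : ℕ}
    (hD : D * (sin (2 * x + η) * sin η * sin (2 * x)) =
      σ * (sin (2 * x + η - δ) - S) * (sin (X 0 - x) * sin (x + Z)))
    (h1 : sin (2 * x + η) ≠ 0) (h2 : sin (X 0 - x) ≠ 0) :
    D * (nodeProd X (m + 1) (x + η) - nodeProd X (m + 1) x) * (sin η * sin (2 * x)) =
      -(σ * (sin (2 * x + η - δ) - S) * sin (x + Z) *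
        (nodeProd X m x * sin (X m - x) * sin (X 0 - X (m + 1)))) := by
  -- The step down is the step up reflected by `x ↦ -x`, since the interpolation products are even.
  have h := stepUp_nodeProd hX (B := D) (σ := σ) (δ := δ) (S := S) (Z := Z) (x := -x) (m := m)
  have e1 : 2 * -x - η = -(2 * x + η) := by ring
  have e2 : 2 * -x - η + δ = -(2 * x + η - δ) := by ring
  have e3 : -x - Z = -(x + Z) := by ring
  have e4 : -x + X 0 = X 0 - x := by ring
  have e5 : 2 * -x = -(2 * x) := by ring
  have e6 : -x - η = -(x + η) := by ring
  rw [e2, e1, e3, e4, e5, e6, nodeProd_neg, nodeProd_neg, nodeProd_neg, ← sub_eq_add_neg,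
    ← sub_eq_add_neg] at h
  simp only [sin_neg] at h
  have h' := h (by linear_combination hD) (neg_ne_zero.2 h1) h2
  linear_combination -h'

end NodeProd

end EllipticRacah

/-! ### Eigenvalues of trigonometric difference operators on a finite lattice -/

namespace EllipticRacah

open Polynomial

/-- A tridiagonal matrix whose entries are the coefficients of a trigonometric difference operator
of Askey–Wilson type on the lattice `X 0, …, X n`. -/
structure IsTrigonometric (n : ℕ) (A B D : ℕ → ℝ) (X : ℕ → ℝ) (η σ δ S e₀ : ℝ) : Prop where
  one_le : 1 ≤ n
  node_succ : ∀ i, X (i + 1) = X i - η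
  sin_ne : Real.sin η ≠ 0
  up : ∀ k < n, B (k + 1) * (Real.sin (2 * X k - η) * Real.sin η * Real.sin (2 * X k)) =
    σ * (Real.sin (2 * X k - η + δ) + S) * (Real.sin (X k - X n) * Real.sin (X k + X 0))
  up_first : B 1 * (Real.sin (2 * X 0 - η) * Real.sin η) =
    σ * (Real.sin (2 * X 0 - η + δ) + S) * Real.sin (X 0 - X n)
  down : ∀ k, 1 ≤ k → k ≤ n →
    D k * (Real.sin (2 * X k + η) * Real.sin η * Real.sin (2 * X k)) =
    σ * (Real.sin (2 * X k + η - δ) - S) * (Real.sin (X 0 - X k) * Real.sin (X k + X n))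
  down_last : D n * (Real.sin (2 * X n + η) * Real.sin η) =
    σ * (Real.sin (2 * X n + η - δ) - S) * Real.sin (X 0 - X n)
  diag : ∀ k ≤ n, A k + ((if k < n then B (k + 1) else 0) + (if 1 ≤ k then D k else 0)) = e₀
  sin_two_ne : ∀ k, 1 ≤ k → k < n → Real.sin (2 * X k) ≠ 0
  sin_sub_ne : ∀ k < n, Real.sin (2 * X k - η) ≠ 0
  sin_add_ne : ∀ k, 1 ≤ k → k ≤ n → Real.sin (2 * X k + η) ≠ 0
  node_ne : ∀ i k, i < k → k ≤ n → Real.sin (X i + X k) ≠ 0 ∧ Real.sin (X i - X k) ≠ 0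

namespace IsTrigonometric

variable {n : ℕ} {A B D X : ℕ → ℝ} {η σ δ S e₀ : ℝ}

/-- The eigenvalues of the difference operator. -/
noncomputable def eig (n : ℕ) (X : ℕ → ℝ) (η σ δ e₀ : ℝ) (m : ℕ) : ℝ :=
  e₀ - 2 * σ * Real.cos (δ + (X m - X n)) * Real.sin (X 0 - X m) / Real.sin η

/-- The off-diagonal coefficients of the triangularized difference operator. -/
noncomputable def offDiag (n : ℕ) (X : ℕ → ℝ) (η σ δ S : ℝ) (m : ℕ) : ℝ :=
  σ * Real.sin (X 0 - X m) * (Real.sin (2 * X (m - 1) - η + δ) + S) * Real.sin (X (m - 1) - X n) /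
    Real.sin η

theorem eig_zero : eig n X η σ δ e₀ 0 = e₀ := by simp [eig]

/-- Subtracting the constant row sum turns the operator into differences of `nodeProd X (m + 1)`
between neighbouring nodes. Both differences contain `nodeProd X m` and `sin (X 0 - X (m + 1))`, and
the remaining three-term expression collapses by `brace_identity`. -/
theorem row (h : IsTrigonometric n A B D X η σ δ S e₀) (m : ℕ) {k : ℕ} (hk : k ≤ n) :
    A k * nodeProd X (m + 1) (X k) +
      ((if k < n then B (k + 1) * nodeProd X (m + 1) (X (k + 1)) else 0) +
        (if 1 ≤ k then D k * nodeProd X (m + 1) (X (k - 1)) else 0)) =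
      eig n X η σ δ e₀ (m + 1) * nodeProd X (m + 1) (X k) +
        offDiag n X η σ δ S (m + 1) * nodeProd X m (X k) := by
  have hη := h.sin_ne
  have hn := h.one_le
  have hdiag := h.diag k hk
  have hcos : δ + (X (m + 1) - X n) = δ + (X m - X n) - η := by
    rw [h.node_succ]
    ring
  have hE : eig n X η σ δ e₀ (m + 1) * Real.sin η = e₀ * Real.sin η -
      2 * σ * Real.cos (δ + (X m - X n) - η) * Real.sin (X 0 - X (m + 1)) := by
    rw [eig, sub_mul, div_mul_cancel₀ _ hη, hcos]
  have hO : offDiag n X η σ δ S (m + 1) * Real.sin η = σ * Real.sin (X 0 - X (m + 1)) *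
      (Real.sin (2 * X m - η + δ) + S) * Real.sin (X m - X n) := by
    rw [offDiag, div_mul_cancel₀ _ hη, Nat.add_sub_cancel]
  have hψ := nodeProd_succ X m (X k)
  refine mul_right_cancel₀ hη ?_
  rcases Nat.eq_zero_or_pos k with rfl | hk0
  · rw [if_pos (by omega), if_neg (by omega), nodeProd_node X (Nat.succ_pos m)]
    -- At the first node the function `nodeProd X (m + 1)` vanishes, and at its neighbour as well
    -- unless `m = 0`; the single remaining case is governed by `up_first`.
    rcases m with _ | m
    · have h1 : X 0 - X (0 + 1) = η := by rw [h.node_succ]; ring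
      have h2 : nodeProd X (0 + 1) (X (0 + 1)) = Real.sin (2 * X 0 - η) * Real.sin η := by
        rw [nodeProd_succ, nodeProd_zero, h1, h.node_succ, show X 0 + (X 0 - η) = 2 * X 0 - η by ring]
        ring
      rw [h2, nodeProd_zero]
      rw [h1] at hO
      have h3 := h.up_first
      rw [zero_add] at hO ⊢
      linear_combination Real.sin η * h3 - hO
    · rw [nodeProd_node X (Nat.succ_pos m), nodeProd_node X (show 0 + 1 < m + 1 + 1 by omega)]
      ring
  · replace hk0 : 1 ≤ k := hk0
    have hsucc : X (k + 1) = X k - η := h.node_succ k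
    have hpred : X (k - 1) = X k + η := by
      have := h.node_succ (k - 1)
      rw [Nat.sub_add_cancel hk0] at this
      linarith
    have hadd := (h.node_ne 0 k hk0 hk).1
    have hsub := (h.node_ne 0 k hk0 hk).2
    have hdown := stepDown_nodeProd h.node_succ (h.down k hk0 hk) (h.sin_add_ne k hk0 hk) hsub (m := m)
    rw [if_pos hk0] at hdiag ⊢
    rw [hpred, hsucc]
    rcases hk.lt_or_eq with hlt | rfl
    · rw [if_pos hlt] at hdiag ⊢
      have h2 := h.sin_two_ne k hk0 hlt
      have hup := stepUp_nodeProd h.node_succ (h.up k hlt) (h.sin_sub_ne k hlt) hadd (m := m)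
      have hbr := brace_identity (X k) (X m) (X n) η δ S
      refine mul_right_cancel₀ h2 ?_
      linear_combination hup + hdown - nodeProd X (m + 1) (X k) * Real.sin (2 * X k) * hE -
        nodeProd X m (X k) * Real.sin (2 * X k) * hO +
        nodeProd X (m + 1) (X k) * Real.sin η * Real.sin (2 * X k) * hdiag +
        σ * Real.sin (X 0 - X (m + 1)) * nodeProd X m (X k) * hbr +
        2 * σ * Real.cos (δ + (X m - X n) - η) * Real.sin (X 0 - X (m + 1)) *
          Real.sin (2 * X k) * hψ
    · rw [if_neg (lt_irrefl k)] at hdiag ⊢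
      -- At the last node `sin (2 * X n)` may vanish, so the argument for interior rows, which
      -- divides by it, is replaced by one based on `down_last`.
      have hbr := brace_identity_last (X m) (X k) η δ S
      have h3 := nodeProd_add h.node_succ (X k) m
      have h4 := shift_identity (-X k) (X m) (X 0) η
      rw [show X 0 - X m + η = X 0 - X (m + 1) by rw [h.node_succ]; ring,
        show 2 * -X k - η = -(2 * X k + η) by ring, Real.sin_neg, ← sub_eq_add_neg, sub_neg_eq_add,
        ← sub_eq_add_neg, sub_neg_eq_add] at h4
      have h5 := h.down_last
      have h6 : D k * (nodeProd X (m + 1) (X k + η) - nodeProd X (m + 1) (X k)) * Real.sin η =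
          -(σ * (Real.sin (2 * X k + η - δ) - S) *
            (nodeProd X m (X k) * Real.sin (X m - X k) * Real.sin (X 0 - X (m + 1)))) := by
        refine mul_right_cancel₀ (mul_ne_zero (h.sin_add_ne k hk0 le_rfl) hsub) ?_
        rw [hψ]
        linear_combination (nodeProd X (m + 1) (X k + η) * Real.sin (X 0 - X k) -
            nodeProd X m (X k) * (Real.sin (X m + X k) * Real.sin (X m - X k)) *
              Real.sin (X 0 - X k)) * h5 +
          σ * (Real.sin (2 * X k + η - δ) - S) * Real.sin (X 0 - X k) * h3 +
          σ * (Real.sin (2 * X k + η - δ) - S) * Real.sin (X 0 - X k) *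
            (nodeProd X m (X k) * Real.sin (X m - X k)) * h4
      linear_combination h6 - nodeProd X (m + 1) (X k) * hE - nodeProd X m (X k) * hO +
        nodeProd X (m + 1) (X k) * Real.sin η * hdiag +
        σ * Real.sin (X 0 - X (m + 1)) * nodeProd X m (X k) * Real.sin (X m - X k) * hbr +
        2 * σ * Real.cos (δ + (X m - X k) - η) * Real.sin (X 0 - X (m + 1)) * hψ

/-- The difference operator has the eigenvalues `eig`. -/
theorem triPoly_eq (h : IsTrigonometric n A B D X η σ δ S e₀) :
    triPoly A B D (n + 1) = ∏ m : Fin (n + 1), (Polynomial.X - C (eig n X η σ δ e₀ m)) := by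
  set Ψ : Matrix (Fin (n + 1)) (Fin (n + 1)) ℝ := Matrix.of fun k m => nodeProd X m (X k) with hΨ
  set U := tri (eig n X η σ δ e₀) (offDiag n X η σ δ S) 0 (n + 1) with hU
  -- Constant row sums handle the column `m = 0`, where the interpolation function is `1`; `row`
  -- handles the others.
  have hmul : tri A B D (n + 1) * Ψ = Ψ * U := by
    ext k m
    rw [Matrix.mul_apply, Matrix.mul_apply]
    simp only [hΨ, hU, Matrix.of_apply]
    rw [tri_row_sum A B D k fun j => nodeProd X m (X j),
      tri_col_sum _ _ _ m fun j => nodeProd X j (X k)]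
    simp only [Pi.zero_apply, zero_mul, ite_self, zero_add]
    have hk := Nat.lt_succ_iff.1 k.2
    obtain ⟨m, hm⟩ := m
    rcases m with _ | m
    · simp only [nodeProd_zero, mul_one]
      rw [h.diag k hk, eig_zero, if_neg (by omega), add_zero]
    · simp only
      rw [if_pos (show 1 ≤ m + 1 by omega), h.row m hk, Nat.add_sub_cancel]
  -- The function with index `m` vanishes at the earlier nodes, and by `node_ne` it does not vanish
  -- at its own; hence `Ψ` is invertible and the spectrum is that of the triangular matrix `U`.
  have hlow : Ψ.IsLowerTriangular := by
    intro k m hkm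
    exact nodeProd_node X hkm
  have hdet : IsUnit Ψ.det := by
    rw [Matrix.det_of_isLowerTriangular _ hlow, isUnit_iff_ne_zero, Finset.prod_ne_zero_iff]
    intro m _
    simp only [hΨ, Matrix.of_apply]
    refine Finset.prod_ne_zero_iff.2 fun i hi => ?_
    have := h.node_ne i m (Finset.mem_range.1 hi) (Nat.lt_succ_iff.1 m.2)
    exact mul_ne_zero this.1 this.2
  have hunit : IsUnit Ψ := (Matrix.isUnit_iff_isUnit_det _).2 hdet
  obtain ⟨P, hP⟩ := hunit
  have hconj : tri A B D (n + 1) = P.val * U * P.val⁻¹ := by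
    rw [hP, ← hmul, mul_assoc, Matrix.mul_nonsing_inv _ hdet, mul_one]
  have hup : U.IsUpperTriangular := by
    intro i j hij
    have hij' : (j : ℕ) < i := hij
    simp only [hU, tri, Matrix.of_apply]
    rw [if_neg (by omega), if_neg (by omega), Pi.zero_apply, ite_self]
  rw [triPoly, hconj, Matrix.charpoly_units_conj, Matrix.charpoly_of_isUpperTriangular _ hup]
  refine Finset.prod_congr rfl fun m _ => ?_
  simp [hU, tri]

end IsTrigonometric

end EllipticRacah

namespace EllipticRacah

open Real

/-! ### Off-diagonal coefficients in the trigonometric limit -/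

/-- In the multiplied form the boundary value `f a` is allowed to vanish, which does occur for sines
at the vertex with index `0`. -/
theorem prod_telescope_down_mul {f : ℕ → ℝ} {a b : ℕ} (hab : a ≤ b)
    (hf : ∀ j, a + 1 ≤ j → j ≤ b → f j ≠ 0) :
    (∏ j ∈ Finset.Icc (a + 1) b, f (j - 1) / f j) * f b = f a := by
  induction b, hab using Nat.le_induction with
  | base => simp
  | succ b hb ih =>
    rw [Finset.prod_Icc_succ_top (by omega), Nat.add_sub_cancel, mul_assoc,
      div_mul_cancel₀ _ (hf (b + 1) (by omega) le_rfl), ih fun j h1 h2 => hf j h1 (by omega)]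

theorem prod_telescope_up_mul {f : ℕ → ℝ} {a b : ℕ} (hab : a ≤ b)
    (hf : ∀ j, a + 1 ≤ j → j ≤ b → f j ≠ 0) :
    (∏ j ∈ Finset.Icc (a + 1) b, f (j + 1) / f j) * f (a + 1) = f (b + 1) := by
  induction b, hab using Nat.le_induction with
  | base => simp
  | succ b hb ih =>
    rw [Finset.prod_Icc_succ_top (by omega), mul_right_comm, ih fun j h1 h2 => hf j h1 (by omega),
      mul_div_cancel₀ _ (hf (b + 1) (by omega) le_rfl)]

theorem two_mul_sin_mul_cos (x y : ℝ) : 2 * (sin x * cos y) = sin (x + y) + sin (x - y) := by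
  rw [sin_add, sin_sub]
  ring

/-- Ratio of brackets with index one in the trigonometric limit. -/
theorem bracket_zero_ratio {α : ℝ} (hα : sin (α / 2) ≠ 0) (x y : ℝ) :
    bracket α 0 0 x / bracket α 0 0 y = sin (α / 2 * x) / sin (α / 2 * y) := by
  rw [bracket_at_zero, bracket_at_zero]
  simp only [trigFactor, Matrix.cons_val_zero]
  rw [div_div_div_cancel_right₀ hα]

theorem bracket_one_at_zero (α z : ℝ) : bracket α 0 1 z = cos (α / 2 * z) := by
  rw [bracket_at_zero]
  rfl

theorem bracket_two_at_zero (α z : ℝ) : bracket α 0 2 z = 1 := by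
  rw [bracket_at_zero]
  rfl

theorem bracket_three_at_zero (α z : ℝ) : bracket α 0 3 z = 1 := by
  rw [bracket_at_zero]
  rfl

namespace Admissible

variable {n : ℕ} {C : Couplings}

theorem sin_ne_of_bracket {α z : ℝ} (h : 0 < bracket α 0 0 z) : sin (α / 2 * z) ≠ 0 := by
  intro h0
  rw [bracket_at_zero] at h
  simp [trigFactor, h0] at h

theorem cos_ne_of_bracket {α z : ℝ} (h : 0 < bracket α 0 1 z) : cos (α / 2 * z) ≠ 0 := by
  rw [← bracket_one_at_zero]
  exact h.ne'

theorem alpha_half_mul (h : Admissible n C) :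
    alpha n 1 C / 2 * (rho n C 1 + C.gr 1 + 1) = π / 2 := by
  rw [← h.alpha_mul, rho, Nat.cast_one]
  ring

/-- The one-variable part of a step in the trigonometric limit. -/
theorem one_var_trig {α x y x' y' z w : ℝ} (hα : sin (α / 2) ≠ 0) {F : Fin 4 → ℝ}
    (h0 : F 0 = bracket α 0 0 x * bracket α 0 0 y / (bracket α 0 0 z * bracket α 0 0 w))
    (h1 : F 1 = bracket α 0 1 x' * bracket α 0 1 y' / (bracket α 0 1 z * bracket α 0 1 w))
    (h2 : F 2 = 1) (h3 : F 3 = 1) (hw : 0 < bracket α 0 0 w) (hw' : 0 < bracket α 0 1 w)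
    (hz : 0 < bracket α 0 0 z) (hz' : 0 < bracket α 0 1 z) :
    (∏ r, F r) * (sin (α / 2 * (2 * z)) * sin (α / 2 * (2 * w))) =
      4 * (sin (α / 2 * y) * cos (α / 2 * y')) * (sin (α / 2 * x) * cos (α / 2 * x')) := by
  have e1 := sin_ne_of_bracket hw
  have e2 := cos_ne_of_bracket hw'
  have e3 := sin_ne_of_bracket hz
  have e4 := cos_ne_of_bracket hz'
  rw [Fin.prod_univ_four, h0, h1, h2, h3, mul_div_mul_comm, bracket_zero_ratio hα,
    bracket_zero_ratio hα, bracket_one_at_zero, bracket_one_at_zero, bracket_one_at_zero,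
    bracket_one_at_zero, show α / 2 * (2 * z) = 2 * (α / 2 * z) by ring,
    show α / 2 * (2 * w) = 2 * (α / 2 * w) by ring, sin_two_mul, sin_two_mul]
  generalize sin (α / 2 * w) = a, cos (α / 2 * w) = b, sin (α / 2 * z) = c,
    cos (α / 2 * z) = d at *
  field_simp
  ring

/-- The coefficient of the step up in the trigonometric limit. -/
theorem colBPlus_trig (h : Admissible n C) {k : ℕ} (hk : k < n) : ∃ P Q : ℝ,
    colBPlus n C 0 (k + 1) * sin (alpha n 1 C / 2 * (2 * rho n C (k + 1) + 1)) =
      2 * sin (alpha n 1 C / 2) * (sin (alpha n 1 C / 2 * (2 * rho n C (k + 1) + 1) +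
        alpha n 1 C / 2 * (C.gr' 0 + C.gr' 1)) + sin (alpha n 1 C / 2 * (C.gr' 0 - C.gr' 1))) *
          (P * Q) ∧
    P * sin (alpha n 1 C / 2 * (rho n C k + rho n C (k + 1) + 1)) =
      sin (alpha n 1 C / 2 * (rho n C 0 + rho n C (k + 1) + 1)) ∧ (k = 0 → P = 1) ∧
    Q * sin (alpha n 1 C / 2 * C.g) = sin (alpha n 1 C / 2 * ((n - k) * C.g)) := by
  have hα := h.sin_half_pos.ne'
  have hp : |(0 : ℝ)| < 1 := by simp
  have hone := h.one_var_pos hp (by omega : 1 ≤ k + 1) hk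
  rw [colBPlus_succ hk, Finset.prod_mul_distrib, Finset.prod_mul_distrib]
  simp only [bracket_zero_ratio hα]
  have h1 := one_var_trig hα (F := fun r => (bracket (alpha n 1 C) 0 r (rho n C (k + 1) + C.gr r) *
    bracket (alpha n 1 C) 0 r (rho n C (k + 1) + C.gr' r + 1 / 2)) /
    (bracket (alpha n 1 C) 0 r (rho n C (k + 1)) *
      bracket (alpha n 1 C) 0 r (rho n C (k + 1) + 1 / 2))) rfl rfl
    (by simp only [bracket_two_at_zero]; norm_num) (by simp only [bracket_three_at_zero]; norm_num)
    (hone 0).2.1 (hone 1).2.1 (hone 0).1 (hone 1).1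
  -- Two of the four pair products are absorbed by one-variable factors: `hP2` joins `cos (ρ_{k+1} +
  -- g_2)` to produce the factor `sin (α / 2)`, and `hP3` joins `sin (ρ_{k+1} + g_1)` to produce the
  -- denominator `sin (2 ρ_{k+1})`, all arguments scaled by `α / 2`.
  have hP2 := prod_telescope_up_mul
    (f := fun j => sin (alpha n 1 C / 2 * (rho n C j - rho n C (k + 1) + 1))) (Nat.zero_le k)
    fun j h1 h2 => sin_ne_of_bracket
      (h.two_var_pos hp h1 (by omega : j < k + 1) hk (.inr (.inl rfl))).2.2.1
  have hP3 := prod_telescope_down_mul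
    (f := fun l => sin (alpha n 1 C / 2 * (rho n C (k + 1) + rho n C l))) (hk : k + 1 ≤ n)
    fun l h1 h2 => sin_ne_of_bracket
      (h.two_var_pos hp (by omega : 1 ≤ k + 1) (by omega : k + 1 < l) h2 (.inl rfl)).1
  refine ⟨∏ j ∈ Finset.Icc 1 k, sin (alpha n 1 C / 2 * (rho n C j + rho n C (k + 1) + 1 + C.g)) /
      sin (alpha n 1 C / 2 * (rho n C j + rho n C (k + 1) + 1)),
    ∏ l ∈ Finset.Icc (k + 2) n, sin (alpha n 1 C / 2 * (rho n C (k + 1) - rho n C l + C.g)) /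
      sin (alpha n 1 C / 2 * (rho n C (k + 1) - rho n C l)), ?_, ?_, ?_, ?_⟩
  · have e2 : ∏ j ∈ Finset.Icc 1 k, sin (alpha n 1 C / 2 * (rho n C j - rho n C (k + 1) + 1 - C.g)) /
        sin (alpha n 1 C / 2 * (rho n C j - rho n C (k + 1) + 1)) =
        ∏ j ∈ Finset.Icc (0 + 1) k,
          sin (alpha n 1 C / 2 * (rho n C (j + 1) - rho n C (k + 1) + 1)) /
          sin (alpha n 1 C / 2 * (rho n C j - rho n C (k + 1) + 1)) := by
      refine Finset.prod_congr rfl fun j _ => ?_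
      rw [rho_succ n C j]
      congr 3
      ring
    have e3 : ∏ l ∈ Finset.Icc (k + 2) n, sin (alpha n 1 C / 2 * (rho n C (k + 1) + rho n C l + C.g)) /
        sin (alpha n 1 C / 2 * (rho n C (k + 1) + rho n C l)) =
        ∏ l ∈ Finset.Icc (k + 1 + 1) n,
          sin (alpha n 1 C / 2 * (rho n C (k + 1) + rho n C (l - 1))) /
          sin (alpha n 1 C / 2 * (rho n C (k + 1) + rho n C l)) := by
      refine Finset.prod_congr rfl fun l hl => ?_
      rw [rho_pred n C (by have := (Finset.mem_Icc.1 hl).1; omega)]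
      congr 3
      ring
    -- The truncation condition converts the cosine into the sine that starts the telescoping
    -- product.
    have e4 : cos (alpha n 1 C / 2 * (rho n C (k + 1) + C.gr 1)) =
        sin (alpha n 1 C / 2 * (rho n C (0 + 1) - rho n C (k + 1) + 1)) := by
      rw [← cos_pi_div_two_sub, ← h.alpha_half_mul]
      congr 1
      ring
    have e5 : rho n C (k + 1) + C.gr 0 = rho n C (k + 1) + rho n C n := by rw [rho_self]
    have e6 := two_mul_sin_mul_cos (alpha n 1 C / 2 * (rho n C (k + 1) + C.gr' 0 + 1 / 2))
      (alpha n 1 C / 2 * (rho n C (k + 1) + C.gr' 1 + 1 / 2))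
    have e7 : sin (alpha n 1 C / 2 * (2 * rho n C (k + 1))) ≠ 0 := by
      rw [show alpha n 1 C / 2 * (2 * rho n C (k + 1)) = 2 * (alpha n 1 C / 2 * rho n C (k + 1)) by
        ring, sin_two_mul]
      exact mul_ne_zero (mul_ne_zero two_ne_zero (sin_ne_of_bracket (hone 0).1))
        (cos_ne_of_bracket (hone 1).1)
    rw [e2, e3]
    simp only [sub_self, zero_add, mul_one, e5, ← two_mul] at hP2 hP3 h1 e4 ⊢
    rw [show 2 * (rho n C (k + 1) + 1 / 2) = 2 * rho n C (k + 1) + 1 by ring] at h1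
    rw [show alpha n 1 C / 2 * (rho n C (k + 1) + C.gr' 0 + 1 / 2) +
        alpha n 1 C / 2 * (rho n C (k + 1) + C.gr' 1 + 1 / 2) =
        alpha n 1 C / 2 * (2 * rho n C (k + 1) + 1) + alpha n 1 C / 2 * (C.gr' 0 + C.gr' 1) by ring,
      show alpha n 1 C / 2 * (rho n C (k + 1) + C.gr' 0 + 1 / 2) -
        alpha n 1 C / 2 * (rho n C (k + 1) + C.gr' 1 + 1 / 2) =
        alpha n 1 C / 2 * (C.gr' 0 - C.gr' 1) by ring] at e6
    rw [← e6]
    rw [← e4] at hP2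
    refine mul_right_cancel₀ e7 ?_
    generalize (∏ r : Fin 4, (bracket (alpha n 1 C) 0 r (rho n C (k + 1) + C.gr r) *
      bracket (alpha n 1 C) 0 r (rho n C (k + 1) + C.gr' r + 1 / 2)) /
      (bracket (alpha n 1 C) 0 r (rho n C (k + 1)) *
      bracket (alpha n 1 C) 0 r (rho n C (k + 1) + 1 / 2))) = a1 at *
    generalize (∏ j ∈ Finset.Icc 1 k, sin (alpha n 1 C / 2 * (rho n C (j + 1) - rho n C (k + 1) + 1)) /
          sin (alpha n 1 C / 2 * (rho n C j - rho n C (k + 1) + 1))) = a2 at *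
    generalize (∏ l ∈ Finset.Icc (k + 1 + 1) n,
          sin (alpha n 1 C / 2 * (rho n C (k + 1) + rho n C (l - 1))) /
          sin (alpha n 1 C / 2 * (rho n C (k + 1) + rho n C l))) = a3 at *
    generalize (∏ j ∈ Finset.Icc 1 k, sin (alpha n 1 C / 2 * (rho n C j + rho n C (k + 1) + 1 + C.g)) /
      sin (alpha n 1 C / 2 * (rho n C j + rho n C (k + 1) + 1))) = P
    generalize (∏ l ∈ Finset.Icc (k + 2) n, sin (alpha n 1 C / 2 * (rho n C (k + 1) - rho n C l + C.g)) /
      sin (alpha n 1 C / 2 * (rho n C (k + 1) - rho n C l))) = Q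
    generalize sin (alpha n 1 C / 2 * (rho n C (k + 1) + rho n C n)) = x1 at *
    generalize cos (alpha n 1 C / 2 * (rho n C (k + 1) + C.gr 1)) = x2 at *
    generalize sin (alpha n 1 C / 2 * (rho n C (k + 1) + C.gr' 0 + 1 / 2)) = x3 at *
    generalize cos (alpha n 1 C / 2 * (rho n C (k + 1) + C.gr' 1 + 1 / 2)) = x4 at *
    linear_combination P * a2 * a3 * Q * h1 + 4 * P * Q * x3 * x4 * a2 * x2 * hP3 +
      4 * P * Q * x3 * x4 * sin (alpha n 1 C / 2 * (2 * rho n C (k + 1))) * hP2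
  · rw [← prod_telescope_down_mul
      (f := fun j => sin (alpha n 1 C / 2 * (rho n C j + rho n C (k + 1) + 1))) (Nat.zero_le k)
      fun j h1 h2 => sin_ne_of_bracket
        (h.two_var_pos hp h1 (by omega : j < k + 1) hk (.inl rfl)).2.2.1]
    congr 1
    refine Finset.prod_congr rfl fun j hj => ?_
    rw [rho_pred n C (Finset.mem_Icc.1 hj).1]
    congr 3
    ring
  · rintro rfl
    simp
  · have h2 := prod_telescope_up_mul
      (f := fun l => sin (alpha n 1 C / 2 * (rho n C (k + 1) - rho n C l))) (hk : k + 1 ≤ n)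
      fun l h1 h2 => sin_ne_of_bracket
        (h.two_var_pos hp (by omega : 1 ≤ k + 1) (by omega : k + 1 < l) h2 (.inr (.inl rfl))).1
    have e1 : rho n C (k + 1) - rho n C (n + 1) = (n - k) * C.g := by
      simp only [rho]
      push_cast
      ring
    rw [rho_succ n C (k + 1), sub_sub_cancel, e1] at h2
    rw [← h2]
    congr 1
    refine Finset.prod_congr rfl fun l hl => ?_
    rw [rho_succ n C l]
    congr 3
    ring

/-- The coefficient of the step down in the trigonometric limit. -/
theorem colBMinus_trig (h : Admissible n C) {k : ℕ} (hk : k < n) : ∃ P Q : ℝ,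
    colBMinus n C 0 (k + 1) * sin (alpha n 1 C / 2 * (2 * rho n C (k + 1) + 1)) =
      2 * sin (alpha n 1 C / 2) * (sin (alpha n 1 C / 2 * (2 * rho n C (k + 1) + 1) -
        alpha n 1 C / 2 * (C.gr' 0 + C.gr' 1)) - sin (alpha n 1 C / 2 * (C.gr' 0 - C.gr' 1))) *
          (P * Q) ∧
    P * sin (alpha n 1 C / 2 * C.g) = sin (alpha n 1 C / 2 * ((k + 1) * C.g)) ∧
    Q * sin (alpha n 1 C / 2 * (rho n C (k + 1) + rho n C (k + 2) + 1)) =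
      sin (alpha n 1 C / 2 * (rho n C (k + 1) + rho n C (n + 1) + 1)) ∧ (k + 1 = n → Q = 1) := by
  have hα := h.sin_half_pos.ne'
  have hp : |(0 : ℝ)| < 1 := by simp
  have hone := h.one_var_pos hp (by omega : 1 ≤ k + 1) hk
  rw [colBMinus_succ hk, Finset.prod_mul_distrib, Finset.prod_mul_distrib]
  simp only [bracket_zero_ratio hα]
  have h1 := one_var_trig hα (F := fun r => (bracket (alpha n 1 C) 0 r (rho n C (k + 1) + 1 - C.gr r) *
    bracket (alpha n 1 C) 0 r (rho n C (k + 1) - C.gr' r + 1 / 2)) /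
    (bracket (alpha n 1 C) 0 r (rho n C (k + 1) + 1) *
      bracket (alpha n 1 C) 0 r (rho n C (k + 1) + 1 / 2))) rfl rfl
    (by simp only [bracket_two_at_zero]; norm_num) (by simp only [bracket_three_at_zero]; norm_num)
    (hone 0).2.1 (hone 1).2.1 (hone 0).2.2.1 (hone 1).2.2.1
  -- Compared with the step up the roles are exchanged: the product in sums absorbs the cosine with
  -- `g_2` and yields `sin (2 ρ_{k+1} + 2)`, the one in differences absorbs the sine with `g_1` and
  -- yields `sin (α / 2)`, again up to the scale `α / 2`.
  have hQ1 := prod_telescope_up_mul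
    (f := fun j => sin (alpha n 1 C / 2 * (rho n C j + rho n C (k + 1) + 2))) (Nat.zero_le k)
    fun j h1 h2 => by
      simp only [add_two_eq]
      exact sin_ne_of_bracket (h.two_var_pos hp h1 (by omega : j < k + 1) hk (.inr (.inr rfl))).2.2.1
  have hQ4 := prod_telescope_down_mul
    (f := fun l => sin (alpha n 1 C / 2 * (rho n C (k + 1) - rho n C l + 1))) (hk : k + 1 ≤ n)
    fun l h1 h2 => sin_ne_of_bracket
      (h.two_var_pos hp (by omega : 1 ≤ k + 1) (by omega : k + 1 < l) h2 (.inr (.inl rfl))).2.2.1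
  refine ⟨∏ j ∈ Finset.Icc 1 k, sin (alpha n 1 C / 2 * (rho n C j - rho n C (k + 1) + C.g)) /
      sin (alpha n 1 C / 2 * (rho n C j - rho n C (k + 1))),
    ∏ l ∈ Finset.Icc (k + 2) n, sin (alpha n 1 C / 2 * (rho n C (k + 1) + rho n C l + 1 - C.g)) /
      sin (alpha n 1 C / 2 * (rho n C (k + 1) + rho n C l + 1)), ?_, ?_, ?_, ?_⟩
  · have e2 : ∏ j ∈ Finset.Icc 1 k, sin (alpha n 1 C / 2 * (rho n C j + rho n C (k + 1) + 2 - C.g)) /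
        sin (alpha n 1 C / 2 * (rho n C j + rho n C (k + 1) + 2)) =
        ∏ j ∈ Finset.Icc (0 + 1) k,
          sin (alpha n 1 C / 2 * (rho n C (j + 1) + rho n C (k + 1) + 2)) /
          sin (alpha n 1 C / 2 * (rho n C j + rho n C (k + 1) + 2)) := by
      refine Finset.prod_congr rfl fun j _ => ?_
      rw [rho_succ n C j]
      congr 3
      ring
    have e3 : ∏ l ∈ Finset.Icc (k + 2) n, sin (alpha n 1 C / 2 * (rho n C (k + 1) - rho n C l + 1 - C.g)) /
        sin (alpha n 1 C / 2 * (rho n C (k + 1) - rho n C l + 1)) =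
        ∏ l ∈ Finset.Icc (k + 1 + 1) n,
          sin (alpha n 1 C / 2 * (rho n C (k + 1) - rho n C (l - 1) + 1)) /
          sin (alpha n 1 C / 2 * (rho n C (k + 1) - rho n C l + 1)) := by
      refine Finset.prod_congr rfl fun l hl => ?_
      rw [rho_pred n C (by have := (Finset.mem_Icc.1 hl).1; omega)]
      congr 3
      ring
    have e4 : cos (alpha n 1 C / 2 * (rho n C (k + 1) + 1 - C.gr 1)) =
        sin (alpha n 1 C / 2 * (rho n C (0 + 1) + rho n C (k + 1) + 2)) := by
      rw [← sin_add_pi_div_two, ← h.alpha_half_mul]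
      congr 1
      ring
    have e5 : rho n C (k + 1) + 1 - C.gr 0 = rho n C (k + 1) - rho n C n + 1 := by
      rw [rho_self]
      ring
    have e6 := two_mul_sin_mul_cos (alpha n 1 C / 2 * (rho n C (k + 1) - C.gr' 0 + 1 / 2))
      (alpha n 1 C / 2 * (rho n C (k + 1) - C.gr' 1 + 1 / 2))
    have e7 : sin (alpha n 1 C / 2 * (2 * rho n C (k + 1) + 2)) ≠ 0 := by
      rw [show alpha n 1 C / 2 * (2 * rho n C (k + 1) + 2) =
        2 * (alpha n 1 C / 2 * (rho n C (k + 1) + 1)) by ring, sin_two_mul]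
      exact mul_ne_zero (mul_ne_zero two_ne_zero (sin_ne_of_bracket (hone 0).2.2.1))
        (cos_ne_of_bracket (hone 1).2.2.1)
    rw [e2, e3]
    simp only [sub_self, zero_add, mul_one, e5, ← two_mul] at hQ1 hQ4 h1 e4 ⊢
    rw [show 2 * (rho n C (k + 1) + 1 / 2) = 2 * rho n C (k + 1) + 1 by ring,
      show 2 * (rho n C (k + 1) + 1) = 2 * rho n C (k + 1) + 2 by ring] at h1
    rw [show alpha n 1 C / 2 * (rho n C (k + 1) - C.gr' 0 + 1 / 2) +
        alpha n 1 C / 2 * (rho n C (k + 1) - C.gr' 1 + 1 / 2) =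
        alpha n 1 C / 2 * (2 * rho n C (k + 1) + 1) - alpha n 1 C / 2 * (C.gr' 0 + C.gr' 1) by ring,
      show alpha n 1 C / 2 * (rho n C (k + 1) - C.gr' 0 + 1 / 2) -
        alpha n 1 C / 2 * (rho n C (k + 1) - C.gr' 1 + 1 / 2) =
        -(alpha n 1 C / 2 * (C.gr' 0 - C.gr' 1)) by ring, sin_neg, ← sub_eq_add_neg] at e6
    rw [← e6]
    rw [← e4] at hQ1
    refine mul_right_cancel₀ e7 ?_
    generalize (∏ r : Fin 4, (bracket (alpha n 1 C) 0 r (rho n C (k + 1) + 1 - C.gr r) *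
      bracket (alpha n 1 C) 0 r (rho n C (k + 1) - C.gr' r + 1 / 2)) /
      (bracket (alpha n 1 C) 0 r (rho n C (k + 1) + 1) *
      bracket (alpha n 1 C) 0 r (rho n C (k + 1) + 1 / 2))) = a1 at *
    generalize (∏ j ∈ Finset.Icc 1 k, sin (alpha n 1 C / 2 * (rho n C (j + 1) + rho n C (k + 1) + 2)) /
          sin (alpha n 1 C / 2 * (rho n C j + rho n C (k + 1) + 2))) = a2 at *
    generalize (∏ l ∈ Finset.Icc (k + 1 + 1) n,
          sin (alpha n 1 C / 2 * (rho n C (k + 1) - rho n C (l - 1) + 1)) /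
          sin (alpha n 1 C / 2 * (rho n C (k + 1) - rho n C l + 1))) = a3 at *
    generalize (∏ j ∈ Finset.Icc 1 k, sin (alpha n 1 C / 2 * (rho n C j - rho n C (k + 1) + C.g)) /
      sin (alpha n 1 C / 2 * (rho n C j - rho n C (k + 1)))) = P
    generalize (∏ l ∈ Finset.Icc (k + 2) n, sin (alpha n 1 C / 2 * (rho n C (k + 1) + rho n C l + 1 - C.g)) /
      sin (alpha n 1 C / 2 * (rho n C (k + 1) + rho n C l + 1))) = Q
    generalize sin (alpha n 1 C / 2 * (rho n C (k + 1) - rho n C n + 1)) = x1 at *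
    generalize cos (alpha n 1 C / 2 * (rho n C (k + 1) + 1 - C.gr 1)) = x2 at *
    generalize sin (alpha n 1 C / 2 * (rho n C (k + 1) - C.gr' 0 + 1 / 2)) = x3 at *
    generalize cos (alpha n 1 C / 2 * (rho n C (k + 1) - C.gr' 1 + 1 / 2)) = x4 at *
    linear_combination P * a2 * a3 * Q * h1 + 4 * P * Q * x3 * x4 * a2 * x2 * hQ4 +
      4 * P * Q * x3 * x4 * sin (alpha n 1 C / 2) * hQ1
  · have h2 := prod_telescope_down_mul
      (f := fun j => sin (alpha n 1 C / 2 * (rho n C j - rho n C (k + 1)))) (Nat.zero_le k)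
      fun j h1 h2 => sin_ne_of_bracket
        (h.two_var_pos hp h1 (by omega : j < k + 1) hk (.inr (.inl rfl))).1
    have e1 : rho n C 0 - rho n C (k + 1) = (k + 1) * C.g := by
      simp only [rho]
      push_cast
      ring
    rw [rho_succ n C k, sub_sub_cancel, ← rho_succ n C k, e1] at h2
    rw [← h2]
    congr 1
    refine Finset.prod_congr rfl fun j hj => ?_
    rw [rho_pred n C (Finset.mem_Icc.1 hj).1]
    congr 3
    ring
  · rw [← prod_telescope_up_mul
      (f := fun l => sin (alpha n 1 C / 2 * (rho n C (k + 1) + rho n C l + 1))) (hk : k + 1 ≤ n)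
      fun l h1 h2 => sin_ne_of_bracket
        (h.two_var_pos hp (by omega : 1 ≤ k + 1) (by omega : k + 1 < l) h2 (.inl rfl)).2.2.1]
    congr 1
    refine Finset.prod_congr rfl fun l hl => ?_
    rw [rho_succ n C l]
    congr 3
    ring
  · rintro rfl
    simp

end Admissible

end EllipticRacah

namespace EllipticRacah

open Real

/-! ### Diagonal coefficients in the trigonometric limit -/

/-- Moving `t` between the factors changes the product by an amount independent of `U`; the cosine
analogue has the same correction. This splits the diagonal coefficient into a constant and a
`k`-dependent part. -/
theorem sin_sub_mul_sin_add (U η t : ℝ) :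
    sin (U + η - t) * sin (U + t) = sin (U + η) * sin U + sin (η - t) * sin t := by
  have hU := sin_sq_add_cos_sq U
  have ht := sin_sq_add_cos_sq t
  simp only [sin_add, sin_sub, cos_add]
  generalize sin U = a, cos U = b, sin t = c, cos t = d, sin η = e, cos η = f at *
  grind

theorem cos_sub_mul_cos_add (U η t : ℝ) :
    cos (U + η - t) * cos (U + t) = cos (U + η) * cos U + sin (η - t) * sin t := by
  have hU := sin_sq_add_cos_sq U
  have ht := sin_sq_add_cos_sq t
  simp only [sin_add, sin_sub, cos_add, cos_sub]
  generalize sin U = a, cos U = b, sin t = c, cos t = d, sin η = e, cos η = f at *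
  grind

/-- The shifted vertices `(α / 2) (ρ_j + 1 / 2)`. -/
noncomputable def vertex (n : ℕ) (C : Couplings) (j : ℕ) : ℝ := alpha n 1 C / 2 * (rho n C j + 1 / 2)

theorem vertex_succ (n : ℕ) (C : Couplings) (j : ℕ) :
    vertex n C (j + 1) = vertex n C j - alpha n 1 C / 2 * C.g := by
  rw [vertex, vertex, rho_succ]
  ring

theorem vertex_eq (n : ℕ) (C : Couplings) (j : ℕ) :
    vertex n C j = vertex n C 0 - j * (alpha n 1 C / 2 * C.g) := by
  simp only [vertex, rho]
  push_cast
  ring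

namespace Admissible

variable {n : ℕ} {C : Couplings}

theorem vertex_ne_zero (h : Admissible n C) {j : ℕ} (h1 : 1 ≤ j) (h2 : j ≤ n) :
    sin (vertex n C j) ≠ 0 ∧ cos (vertex n C j) ≠ 0 :=
  ⟨sin_ne_of_bracket (h.one_var_pos (by simp) h1 h2 0).2.1,
    cos_ne_of_bracket (h.one_var_pos (by simp) h1 h2 1).2.1⟩

/-- The ratios in the diagonal coefficients in the trigonometric limit. -/
theorem ratio_trig (h : Admissible n C) {k : ℕ} (hk : k ≤ n) (r : Fin 4) :
    ratioLower₁ n C 0 r k * bracket (alpha n 1 C) 0 r (rho n C k + 1 / 2) =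
      bracket (alpha n 1 C) 0 r (rho n C 0 + 1 / 2) ∧
    ratioUpper₀ n C 0 r k * bracket (alpha n 1 C) 0 r (rho n C (k + 1) + 1 / 2) =
      bracket (alpha n 1 C) 0 r (rho n C (n + 1) + 1 / 2) ∧
    (r ≠ 1 → ratioUpper₁ n C 0 r k * bracket (alpha n 1 C) 0 r (rho n C 1 + 3 / 2) =
      bracket (alpha n 1 C) 0 r (rho n C (k + 1) + 3 / 2)) ∧
    (r ≠ 0 → ratioLower₀ n C 0 r k * bracket (alpha n 1 C) 0 r (C.gr 0 - 1 / 2) =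
      bracket (alpha n 1 C) 0 r (rho n C k - 1 / 2)) := by
  have hne := fun {j : ℕ} (h1 : 1 ≤ j) (h2 : j ≤ n) =>
    h.ratio_denominators_ne_zero (p := 0) (by simp) h1 h2 r
  refine ⟨?_, ?_, fun hr => ?_, fun hr => ?_⟩
  · rw [← prod_telescope_down_mul (f := fun j => bracket (alpha n 1 C) 0 r (rho n C j + 1 / 2))
      (Nat.zero_le k) fun j h1 h2 => (hne h1 (h2.trans hk)).1, ratioLower₁]
    congr 1
    refine Finset.prod_congr rfl fun j hj => ?_
    rw [rho_pred n C (Finset.mem_Icc.1 hj).1]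
    congr 2
    ring
  · rw [← prod_telescope_up_mul (f := fun j => bracket (alpha n 1 C) 0 r (rho n C j + 1 / 2))
      hk fun j h1 h2 => (hne (by omega) h2).1, ratioUpper₀]
    congr 1
    refine Finset.prod_congr rfl fun j hj => ?_
    rw [rho_succ]
    congr 2
    ring
  · rw [← prod_telescope_up_mul (f := fun j => bracket (alpha n 1 C) 0 r (rho n C j + 3 / 2))
      (Nat.zero_le k) fun j h1 h2 => (hne h1 (h2.trans hk)).2.1 hr, ratioUpper₁]
    congr 1
    refine Finset.prod_congr rfl fun j hj => ?_
    rw [rho_succ]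
    congr 2
    ring
  · rw [← rho_self n C,
      ← prod_telescope_down_mul (f := fun j => bracket (alpha n 1 C) 0 r (rho n C j - 1 / 2))
      hk fun j h1 h2 => (hne (by omega) h2).2.2 hr, ratioLower₀]
    congr 1
    refine Finset.prod_congr rfl fun j hj => ?_
    rw [rho_pred n C (by have := (Finset.mem_Icc.1 hj).1; omega)]
    congr 2
    ring

theorem ratio_eq_one_of_trivial {r : Fin 4} (hr : ∀ z, bracket (alpha n 1 C) 0 r z = 1) (k : ℕ) :
    ratioUpper₁ n C 0 r k * ratioLower₁ n C 0 r k * ratioUpper₀ n C 0 r k *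
      ratioLower₀ n C 0 r k = 1 := by
  simp [ratioUpper₁, ratioLower₁, ratioUpper₀, ratioLower₀, hr]

/-- The diagonal coefficient in the trigonometric limit. -/
theorem colA_trig (h : Admissible n C)
    (hsin : sin (alpha n 1 C / 2 * C.g) ≠ 0 ∧ sin (alpha n 1 C / 2 * (C.g - 1)) ≠ 0)
    {k : ℕ} (hk : k ≤ n) : ∃ P Q P' Q' : ℝ,
    colA n C 0 k * sin (alpha n 1 C / 2 * C.g) =
      -2 * sin (alpha n 1 C / 2 * (C.gr' 0 + C.gr' 1)) *
          sin (n * (alpha n 1 C / 2 * C.g) + alpha n 1 C / 2) +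
        sin (alpha n 1 C / 2) *
          ((sin (alpha n 1 C / 2 * (C.gr' 0 + C.gr' 1)) +
              sin (alpha n 1 C / 2 * (C.gr' 0 - C.gr' 1))) * (P * Q) +
            (sin (alpha n 1 C / 2 * (C.gr' 0 + C.gr' 1)) -
              sin (alpha n 1 C / 2 * (C.gr' 0 - C.gr' 1))) * (P' * Q')) ∧
    (P * sin (vertex n C k) = sin (vertex n C 0) ∧ P' * cos (vertex n C k) = cos (vertex n C 0)) ∧
    (Q * sin (vertex n C (k + 1)) = sin (vertex n C (n + 1)) ∧
      Q' * cos (vertex n C (k + 1)) = cos (vertex n C (n + 1))) ∧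
    (k = 0 → P = 1 ∧ P' = 1) ∧ (k = n → Q = 1 ∧ Q' = 1) := by
  have hα := h.sin_half_pos.ne'
  obtain ⟨hP, hQ, hU, -⟩ := h.ratio_trig hk 0
  obtain ⟨hP', hQ', -, hL⟩ := h.ratio_trig hk 1
  have hU := hU (by decide)
  have hL := hL (by decide)
  have hrefl : alpha n 1 C / 2 * (C.gr 1 - 1 / 2) =
      π / 2 - alpha n 1 C / 2 * (rho n C 1 + 3 / 2) := by
    rw [← h.alpha_half_mul]
    ring
  rw [h.colA_eq (by simp) hk, colARegular, ratio_eq_one_of_trivial (bracket_two_at_zero _),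
    ratio_eq_one_of_trivial (bracket_three_at_zero _), sub_self, mul_zero, add_zero, mul_zero,
    add_zero, cConst_eq, cConst_eq, cRest, cRest, reflRatio, prodFactor_zero, prodFactor_zero]
  have e0 : perm4 0 0 = 0 := rfl
  have e1 : perm4 0 1 = 1 := rfl
  have e2 : perm4 1 0 = 1 := rfl
  have e3 : perm4 1 1 = 0 := rfl
  have b0 : ∀ z, bracket (alpha n 1 C) 0 0 z = sin (alpha n 1 C / 2 * z) / sin (alpha n 1 C / 2) :=
    fun z => by rw [bracket_at_zero]; rfl
  have s0 : (Fin.succ 0 : Fin 4) = 1 := rfl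
  have s1 : (Fin.succ 1 : Fin 4) = 2 := rfl
  have s2 : (Fin.succ 2 : Fin 4) = 3 := rfl
  simp only [Fin.prod_univ_three, s0, s1, s2, e0, e1, e2, e3, b0, bracket_one_at_zero,
    bracket_two_at_zero, bracket_three_at_zero, mul_one, hrefl, sin_pi_div_two_sub,
    cos_pi_div_two_sub] at hP hQ hU hP' hQ' hL ⊢
  rw [mul_div_assoc', div_left_inj' hα] at hP hQ hU
  refine ⟨ratioLower₁ n C 0 0 k, ratioUpper₀ n C 0 0 k, ratioLower₁ n C 0 1 k,
    ratioUpper₀ n C 0 1 k, ?_, ⟨?_, hP'⟩, ⟨?_, hQ'⟩, ?_, ?_⟩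
  · have t1 := two_mul_sin_mul_cos (alpha n 1 C / 2 * C.gr' 0) (alpha n 1 C / 2 * C.gr' 1)
    have t2 := two_mul_sin_mul_cos (alpha n 1 C / 2 * C.gr' 1) (alpha n 1 C / 2 * C.gr' 0)
    rw [← mul_add, ← mul_sub] at t1 t2
    rw [add_comm (C.gr' 1), ← neg_sub (C.gr' 0) (C.gr' 1), mul_neg, sin_neg, ← sub_eq_add_neg] at t2
    -- `u1`, `u2` treat the products depending on `k`, and `w1`, `w2` the subtracted constants
    -- `c_r`. Their main terms telescope to the same product at the vertices `0` and `n + 1` and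
    -- cancel; what remains is divisible by `sin (α / 2 * (g - 1))`, removing that factor from the
    -- denominator of `c_r`.
    have u1 := sin_sub_mul_sin_add (vertex n C (k + 1)) (alpha n 1 C / 2 * C.g) (alpha n 1 C / 2)
    have u2 := cos_sub_mul_cos_add (vertex n C (k + 1)) (alpha n 1 C / 2 * C.g) (alpha n 1 C / 2)
    have w1 := sin_sub_mul_sin_add (vertex n C (n + 1))
      ((n + 1) * (alpha n 1 C / 2 * C.g)) (alpha n 1 C / 2 * C.g - alpha n 1 C / 2)
    have w2 := cos_sub_mul_cos_add (vertex n C (n + 1))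
      ((n + 1) * (alpha n 1 C / 2 * C.g)) (alpha n 1 C / 2 * C.g - alpha n 1 C / 2)
    have a1 : vertex n C (k + 1) + alpha n 1 C / 2 * C.g = vertex n C k := by
      rw [vertex_succ, sub_add_cancel]
    have a2 : vertex n C (n + 1) + (n + 1) * (alpha n 1 C / 2 * C.g) = vertex n C 0 := by
      rw [vertex_eq n C (n + 1)]
      push_cast
      ring
    have a3 : vertex n C k - alpha n 1 C / 2 = alpha n 1 C / 2 * (rho n C k - 1 / 2) := by
      rw [vertex]
      ring
    have a4 : vertex n C (k + 1) + alpha n 1 C / 2 = alpha n 1 C / 2 * (rho n C (k + 1) + 3 / 2) := by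
      rw [vertex]
      ring
    have a5 : alpha n 1 C / 2 * C.g - alpha n 1 C / 2 = alpha n 1 C / 2 * (C.g - 1) := by ring
    have a6 : vertex n C 0 - alpha n 1 C / 2 * (C.g - 1) = alpha n 1 C / 2 * (rho n C 1 + 3 / 2) := by
      rw [vertex, rho_succ]
      ring
    have a7 : vertex n C (n + 1) + alpha n 1 C / 2 * (C.g - 1) =
        alpha n 1 C / 2 * (C.gr 0 - 1 / 2) := by
      rw [vertex, rho_succ, rho_self]
      ring
    have a8 : (n + 1) * (alpha n 1 C / 2 * C.g) - alpha n 1 C / 2 * (C.g - 1) =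
        n * (alpha n 1 C / 2 * C.g) + alpha n 1 C / 2 := by ring
    rw [a1, a3, a4, a5] at u1 u2
    rw [a2, a5, a6, a7, a8] at w1 w2
    change _ * sin (vertex n C k) = sin (vertex n C 0) at hP
    change _ * cos (vertex n C k) = cos (vertex n C 0) at hP'
    change _ * sin (vertex n C (k + 1)) = sin (vertex n C (n + 1)) at hQ
    change _ * cos (vertex n C (k + 1)) = cos (vertex n C (n + 1)) at hQ'
    obtain ⟨hg, hg'⟩ := hsin
    refine mul_right_cancel₀ hg' ?_
    have t3 : 2 * sin (alpha n 1 C / 2 * (C.gr' 0 + C.gr' 1)) =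
        2 * (sin (alpha n 1 C / 2 * C.gr' 0) * cos (alpha n 1 C / 2 * C.gr' 1)) +
        2 * (sin (alpha n 1 C / 2 * C.gr' 1) * cos (alpha n 1 C / 2 * C.gr' 0)) := by
      linear_combination -t1 - t2
    rw [← t1, ← t2, div_mul_div_comm, mul_one_div]
    clear t1 t2 a1 a2 a3 a4 a5 a6 a7 a8 hrefl b0 s0 s1 s2 e0 e1 e2 e3
    generalize sin (alpha n 1 C / 2) = H, sin (alpha n 1 C / 2 * C.g) = G,
      sin (alpha n 1 C / 2 * (C.g - 1)) = K at *
    have hc : ∀ w x y, w / H * (2 / (G * K / (H * H)) * (x / H * y)) * G * K = 2 * (w * x * y) := by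
      intro w x y
      field_simp
    generalize sin (alpha n 1 C / 2 * (rho n C k - 1 / 2)) = b1,
      cos (alpha n 1 C / 2 * (rho n C k - 1 / 2)) = b2,
      sin (alpha n 1 C / 2 * (rho n C (k + 1) + 3 / 2)) = b3,
      cos (alpha n 1 C / 2 * (rho n C (k + 1) + 3 / 2)) = b4,
      sin (alpha n 1 C / 2 * (rho n C 1 + 3 / 2)) = b5,
      cos (alpha n 1 C / 2 * (rho n C 1 + 3 / 2)) = b6,
      sin (alpha n 1 C / 2 * (C.gr 0 - 1 / 2)) = b7,
      cos (alpha n 1 C / 2 * (C.gr 0 - 1 / 2)) = b8,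
      sin (vertex n C k) = d1, cos (vertex n C k) = d2, sin (vertex n C (k + 1)) = d3,
      cos (vertex n C (k + 1)) = d4, sin (vertex n C 0) = d5, cos (vertex n C 0) = d6,
      sin (vertex n C (n + 1)) = d7, cos (vertex n C (n + 1)) = d8,
      sin (alpha n 1 C / 2 * C.gr' 0) = x1, cos (alpha n 1 C / 2 * C.gr' 1) = y1,
      sin (alpha n 1 C / 2 * C.gr' 1) = x2, cos (alpha n 1 C / 2 * C.gr' 0) = y2,
      ratioUpper₁ n C 0 0 k = p1, ratioLower₁ n C 0 0 k = p2, ratioUpper₀ n C 0 0 k = p3,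
      ratioLower₁ n C 0 1 k = q1, ratioUpper₀ n C 0 1 k = q2, ratioLower₀ n C 0 1 k = q3,
      sin (alpha n 1 C / 2 * (C.gr' 0 + C.gr' 1)) = sd,
      sin (n * (alpha n 1 C / 2 * C.g) + alpha n 1 C / 2) = sN at *
    linear_combination p1 * p2 * p3 * hc b1 x1 (b5 * y1) - hc b7 x1 (b5 * y1) +
      q1 * q2 * q3 * hc b4 x2 (b8 * y2) - hc b6 x2 (b8 * y2) +
      2 * x1 * y1 * p2 * p3 * b1 * hU + 2 * x1 * y1 * p2 * p3 * u1 - 2 * x1 * y1 * w1 +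
      2 * x1 * y1 * (p3 * d3) * hP + 2 * x1 * y1 * d5 * hQ +
      2 * x2 * y2 * q1 * q2 * b4 * hL + 2 * x2 * y2 * q1 * q2 * u2 - 2 * x2 * y2 * w2 +
      2 * x2 * y2 * (q2 * d4) * hP' + 2 * x2 * y2 * d6 * hQ' + sN * K * t3
  · exact hP
  · exact hQ
  · rintro rfl
    simp [ratioLower₁]
  · rintro rfl
    simp [ratioUpper₀]

end Admissible

end EllipticRacah

namespace EllipticRacah

open Real

/-! ### The spectrum in the trigonometric limit -/

theorem lattice_sub (n : ℕ) (C : Couplings) (i k : ℕ) :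
    vertex n C i - vertex n C k = (k - i) * (alpha n 1 C / 2 * C.g) := by
  rw [vertex_eq n C i, vertex_eq n C k]
  ring

/-- Computes the increment of the eigenvalue `eig` from one index to the next. -/
theorem cos_mul_sin_step (x y η : ℝ) :
    cos (x - η) * sin (y + η) - cos x * sin y = cos (x - y - η) * sin η := by
  have hx := sin_sq_add_cos_sq x
  have hη := sin_sq_add_cos_sq η
  simp only [sin_add, sin_sub, cos_sub]
  generalize sin x = a, cos x = b, sin y = c, cos y = d, sin η = e, cos η = f at *
  grind

/-- The trigonometric eigenvalues `2 ∑_j cos (α (ρ̂_j + λ_j))` at the columns. -/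
noncomputable def trigValue (n : ℕ) (C : Couplings) (m : ℕ) : ℝ :=
  2 * ∑ i ∈ Finset.range n, cos (alpha n 1 C * (rhoHat n C (i + 1) + if i < m then 1 else 0))

theorem trigValue_succ {n m : ℕ} (C : Couplings) (hm : m < n) :
    trigValue n C (m + 1) = trigValue n C m +
      2 * (cos (alpha n 1 C * (rhoHat n C (m + 1) + 1)) - cos (alpha n 1 C * rhoHat n C (m + 1))) := by
  rw [trigValue, trigValue, ← mul_add]
  congr 1
  rw [← Finset.add_sum_erase _ _ (Finset.mem_range.2 hm),
    ← Finset.add_sum_erase _ (fun i =>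
      cos (alpha n 1 C * (rhoHat n C (i + 1) + if i < m then 1 else 0))) (Finset.mem_range.2 hm),
    Finset.sum_congr rfl fun i hi => ?_]
  · rw [if_pos (Nat.lt_succ_self m), if_neg (lt_irrefl m), add_zero]
    ring
  · have := (Finset.mem_erase.1 hi).1
    congr 3
    exact if_congr (by omega) rfl rfl

namespace Admissible

variable {n : ℕ} {C : Couplings}

/-- The truncation condition eliminates `g_1 + g_2` in favour of a quarter turn, leaving the
arithmetic progression in `g` centred at the middle index. -/
theorem alpha_mul_rhoHat (h : Admissible n C) (j : ℕ) :
    alpha n 1 C * rhoHat n C j = (alpha n 1 C / 2 * (C.gr' 0 + C.gr' 1) - alpha n 1 C / 2 +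
      (n + 1 - 2 * j) * (alpha n 1 C / 2 * C.g)) + π / 2 := by
  rw [← h.alpha_mul, rhoHat]
  ring

/-- Passing from `m` to `m + 1` changes one cosine, by `-2 sin (α (ρ̂_{m+1} + 1/2)) sin (α / 2)`.
The bounds on `g'_1` and `g'_2` place the first angle in `(0, π)`. -/
theorem trigValue_succ_lt (h : Admissible n C) {m : ℕ} (hm : m < n) :
    trigValue n C (m + 1) < trigValue n C m := by
  have hα := h.alpha_pos
  have h1 : cos (alpha n 1 C * (rhoHat n C (m + 1) + 1)) - cos (alpha n 1 C * rhoHat n C (m + 1)) =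
      -2 * sin (alpha n 1 C * (rhoHat n C (m + 1) + 1 / 2)) * sin (alpha n 1 C / 2) := by
    rw [cos_sub_cos]
    congr 3
    · ring
    · ring
  have h2 : (0 : ℝ) ≤ (n : ℝ) - ((m + 1 : ℕ) : ℝ) := by
    have : ((m + 1 : ℕ) : ℝ) ≤ n := by exact_mod_cast hm
    linarith
  have h3 : ((n : ℝ) - ((m + 1 : ℕ) : ℝ)) * C.g ≤ (n - 1) * C.g := by
    refine mul_le_mul_of_nonneg_right ?_ h.g_pos.le
    push_cast
    linarith [(Nat.cast_nonneg m : (0 : ℝ) ≤ m)]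
  have h4 := mul_nonneg h2 h.g_pos.le
  obtain ⟨h5, h6⟩ := abs_lt.1 h.g1'_lt
  obtain ⟨h7, h8⟩ := abs_lt.1 h.g2'_lt
  have h9 : 0 < sin (alpha n 1 C * (rhoHat n C (m + 1) + 1 / 2)) := by
    refine sin_pos_of_pos_of_lt_pi (mul_pos hα ?_) ?_
    · rw [rhoHat]
      linarith
    · rw [← h.alpha_mul]
      refine mul_lt_mul_of_pos_left ?_ hα
      rw [rhoHat]
      linarith
  have h10 := mul_pos h9 h.sin_half_pos
  rw [trigValue_succ C hm, h1]
  linarith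

theorem trigValue_strictAnti (h : Admissible n C) :
    StrictAnti fun l : Fin (n + 1) => trigValue n C l :=
  Fin.strictAnti_iff_succ_lt.2 fun i => h.trigValue_succ_lt i.2

theorem trigValue_zero (h : Admissible n C) : trigValue n C 0 * sin (alpha n 1 C / 2 * C.g) =
    -2 * sin (alpha n 1 C / 2 * (C.gr' 0 + C.gr' 1) - alpha n 1 C / 2) *
      sin (n * (alpha n 1 C / 2 * C.g)) := by
  set y := alpha n 1 C / 2 * (C.gr' 0 + C.gr' 1) - alpha n 1 C / 2 with hy
  set η := alpha n 1 C / 2 * C.g with hη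
  -- Multiplication by `sin η` makes the sum telescope; the upper limit is freed from `n` so that
  -- induction is possible.
  have h1 : ∀ N : ℕ, 2 * (∑ i ∈ Finset.range N, cos (alpha n 1 C * rhoHat n C (i + 1))) * sin η =
      cos (y + n * η) - cos (y + (n - 2 * N) * η) := by
    intro N
    induction N with
    | zero => simp
    | succ N ih =>
      rw [Finset.sum_range_succ, mul_add, add_mul, ih, h.alpha_mul_rhoHat, cos_add_pi_div_two,
        ← hη, ← hy]
      have h2 := cos_sub_cos (y + (n - 2 * N) * η) (y + (n - 2 * (N + 1 : ℕ)) * η)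
      rw [show (y + (n - 2 * N) * η - (y + (n - 2 * (N + 1 : ℕ)) * η)) / 2 = η by push_cast; ring,
        show (y + (n - 2 * N) * η + (y + (n - 2 * (N + 1 : ℕ)) * η)) / 2 =
          y + (n + 1 - 2 * (N + 1 : ℕ)) * η by push_cast; ring] at h2
      linear_combination -h2
  have h3 := h1 n
  rw [cos_sub_cos, show (y + n * η + (y + (n - 2 * n) * η)) / 2 = y by ring,
    show (y + n * η - (y + (n - 2 * n) * η)) / 2 = n * η by ring] at h3
  rw [trigValue, ← h3]
  simp

/-- The eigenvalues of the difference operator are the values `2 ∑_j cos (α (ρ̂_j + λ_j))`. -/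
theorem eig_eq_trigValue (h : Admissible n C) (hsin : sin (alpha n 1 C / 2 * C.g) ≠ 0) :
    ∀ m ≤ n, IsTrigonometric.eig n (fun k => vertex n C k - alpha n 1 C / 2 * C.g / 2)
      (alpha n 1 C / 2 * C.g) (2 * sin (alpha n 1 C / 2)) (alpha n 1 C / 2 * (C.gr' 0 + C.gr' 1))
      (trigValue n C 0) m = trigValue n C m := by
  intro m
  induction m with
  | zero => simp [IsTrigonometric.eig]
  | succ m ih =>
    intro hm
    rw [trigValue_succ C hm, ← ih (by omega), cos_sub_cos]
    simp only [IsTrigonometric.eig, sub_sub_sub_cancel_right, lattice_sub]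
    rw [show (alpha n 1 C * (rhoHat n C (m + 1) + 1) + alpha n 1 C * rhoHat n C (m + 1)) / 2 =
      alpha n 1 C * rhoHat n C (m + 1) + alpha n 1 C / 2 by ring,
      show (alpha n 1 C * (rhoHat n C (m + 1) + 1) - alpha n 1 C * rhoHat n C (m + 1)) / 2 =
      alpha n 1 C / 2 by ring, h.alpha_mul_rhoHat, add_right_comm, sin_add_pi_div_two]
    have h1 := cos_mul_sin_step (alpha n 1 C / 2 * (C.gr' 0 + C.gr' 1) +
      (n - m) * (alpha n 1 C / 2 * C.g)) (m * (alpha n 1 C / 2 * C.g)) (alpha n 1 C / 2 * C.g)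
    set η := alpha n 1 C / 2 * C.g with hη
    rw [show alpha n 1 C / 2 * (C.gr' 0 + C.gr' 1) - alpha n 1 C / 2 +
        (n + 1 - 2 * (m + 1 : ℕ)) * η + alpha n 1 C / 2 =
        alpha n 1 C / 2 * (C.gr' 0 + C.gr' 1) + (n - m) * η - m * η - η by push_cast; ring]
    rw [show alpha n 1 C / 2 * (C.gr' 0 + C.gr' 1) + (n - (m + 1 : ℕ)) * η =
        alpha n 1 C / 2 * (C.gr' 0 + C.gr' 1) + (n - m) * η - η by push_cast; ring,
      show ((m + 1 : ℕ) - (0 : ℕ) : ℝ) * η = m * η + η by push_cast; ring,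
      show ((m : ℕ) - (0 : ℕ) : ℝ) * η = m * η by push_cast; ring]
    generalize cos (alpha n 1 C / 2 * (C.gr' 0 + C.gr' 1) + (n - m) * η - η) = c₁,
      cos (alpha n 1 C / 2 * (C.gr' 0 + C.gr' 1) + (n - m) * η) = c₂,
      cos (alpha n 1 C / 2 * (C.gr' 0 + C.gr' 1) + (n - m) * η - m * η - η) = c₃,
      sin (m * η + η) = s₁, sin (m * η) = s₂, sin η = s, sin (alpha n 1 C / 2) = t at *
    field_simp
    linear_combination -4 * t * h1

/-- The rows of the tridiagonal matrix have constant sum in the trigonometric limit. -/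
theorem diagonal_sum (h : Admissible n C)
    (hsin : sin (alpha n 1 C / 2 * C.g) ≠ 0 ∧ sin (alpha n 1 C / 2 * (C.g - 1)) ≠ 0)
    {k : ℕ} (hk : k ≤ n) :
    colA n C 0 k + ((if k < n then colBPlus n C 0 (k + 1) else 0) +
      (if 1 ≤ k then colBMinus n C 0 k else 0)) = trigValue n C 0 := by
  refine mul_right_cancel₀ hsin.1 ?_
  rw [h.trigValue_zero]
  obtain ⟨L, U, L', U', hA, ⟨hL, hL'⟩, ⟨hU, hU'⟩, hL0, hU0⟩ := h.colA_trig hsin hk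
  have hB := fun hk => h.colBPlus_trig (k := k) hk
  have hD := fun hk => h.colBMinus_trig (k := k - 1) hk
  set η := alpha n 1 C / 2 * C.g with hη
  set δ := alpha n 1 C / 2 * (C.gr' 0 + C.gr' 1) with hδ
  set S := sin (alpha n 1 C / 2 * (C.gr' 0 - C.gr' 1)) with hS
  set t := alpha n 1 C / 2 with ht
  -- Separates the constant part of `colA_trig`; the rest, `2 sin t sin (δ + n η)`, is what the
  -- diagonal identities produce.
  have hfin : -2 * sin (δ - t) * sin (n * η) =
      -2 * sin δ * sin (n * η + t) + 2 * sin t * sin (δ + n * η) := by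
    simp only [sin_sub, sin_add]
    ring
  have z1 : ∀ j, t * (2 * rho n C j + 1) = 2 * vertex n C j := fun j => by
    rw [vertex]
    ring
  have z2 : ∀ i j, t * (rho n C i + rho n C j + 1) = vertex n C i + vertex n C j := fun i j => by
    rw [vertex, vertex]
    ring
  have z3 : ∀ i j, t * ((i - j) * C.g) = (i - j) * η := fun i j => by ring
  have z4 : ((n - k : ℝ)) * η = vertex n C (k + 1) - vertex n C (n + 1) := by
    rw [lattice_sub]
    push_cast
    ring
  have z5 : t * (k * C.g) = vertex n C 0 - vertex n C k := by
    rw [lattice_sub]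
    push_cast
    ring
  have y1 : ∀ j, 1 ≤ j → j ≤ n → sin (2 * vertex n C j) ≠ 0 := by
    intro j h1 h2
    rw [sin_two_mul]
    obtain ⟨h3, h4⟩ := h.vertex_ne_zero h1 h2
    exact mul_ne_zero (mul_ne_zero two_ne_zero h3) h4
  simp only [z1, z2, z3, z4] at hB hD
  rw [hfin, add_mul, hA]
  have h2U := sin_two_mul (vertex n C (k + 1))
  have h2V := sin_two_mul (vertex n C k)
  rcases Nat.eq_zero_or_pos k with rfl | hk0
  · obtain ⟨P, Q, hB, -, hP, hQ⟩ := hB h.one_le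
    have hid := diagonal_identity_first (vertex n C (0 + 1)) (vertex n C (n + 1)) δ S
    rw [hP rfl] at hB
    rw [add_sub_assoc, ← z4, Nat.cast_zero, sub_zero] at hid
    rw [← z4, Nat.cast_zero, sub_zero] at hQ
    rw [(hL0 rfl).1, (hL0 rfl).2, if_pos (show 0 < n from h.one_le), if_neg (by omega)]
    refine mul_right_cancel₀ (y1 (0 + 1) le_rfl h.one_le) ?_
    linear_combination 2 * sin t * hid +
      2 * sin t * (sin δ + S) * cos (vertex n C (0 + 1)) * hU +
      2 * sin t * (sin δ - S) * sin (vertex n C (0 + 1)) * hU' + sin η * hB +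
      2 * sin t * (sin (2 * vertex n C (0 + 1) + δ) + S) * hQ +
      sin t * ((sin δ + S) * U + (sin δ - S) * U') * h2U
  replace hk0 : 1 ≤ k := hk0
  obtain ⟨P', Q', hD, hP', hQ', hQ0⟩ := hD (by omega)
  rw [show k - 1 + 2 = k + 1 by omega, Nat.sub_add_cancel hk0] at hQ'
  rw [Nat.sub_add_cancel hk0] at hD hQ0
  rw [Nat.cast_sub hk0, Nat.cast_one, sub_add_cancel, z5] at hP'
  rw [if_pos hk0]
  rcases hk.lt_or_eq with hlt | rfl
  · obtain ⟨P, Q, hB', hP, -, hQ⟩ := hB hlt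
    rw [if_pos hlt]
    have hid := diagonal_identity (vertex n C (k + 1)) (vertex n C k) (vertex n C (n + 1))
      (vertex n C 0) δ S
    rw [show δ + vertex n C 0 - vertex n C (n + 1) - vertex n C k + vertex n C (k + 1) =
      δ + n * η by rw [vertex_eq n C k, vertex_eq n C (k + 1), vertex_eq n C (n + 1)]; push_cast; ring]
      at hid
    have hne : sin (vertex n C (k + 1) + vertex n C k) ≠ 0 := by
      rw [add_comm, ← z2]
      exact sin_ne_of_bracket
        (h.two_var_pos (by simp) hk0 (Nat.lt_succ_self k) hlt (.inl rfl)).2.2.1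
    rw [add_comm (vertex n C k) (vertex n C (k + 1)), add_comm (vertex n C 0)] at hP
    rw [add_comm (vertex n C k) (vertex n C (k + 1))] at hQ'
    refine mul_right_cancel₀ (mul_ne_zero (mul_ne_zero (y1 (k + 1) (by omega) hlt) (y1 k hk0 hk)) hne) ?_
    set u := vertex n C (k + 1) with hu
    set v := vertex n C k with hv
    set o := vertex n C 0 with ho
    linear_combination sin t * hid +
      sin t * ((sin δ + S) * (L * U) + (sin δ - S) * (L' * U')) * sin (u + v) *
        (sin (2 * v) * h2U + 2 * sin u * cos u * h2V) +
      4 * sin t * (sin δ + S) * cos u * cos v * sin (u + v) * (U * sin u * hL + sin o * hU) +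
      4 * sin t * (sin δ - S) * sin u * sin v * sin (u + v) * (U' * cos u * hL' + cos o * hU') +
      sin η * sin (2 * v) * sin (u + v) * hB' +
      2 * sin t * (sin (2 * u + δ) + S) * sin (2 * v) * (Q * sin η * hP + sin (u + o) * hQ) +
      sin η * sin (2 * u) * sin (u + v) * hD +
      2 * sin t * (sin (2 * v - δ) - S) * sin (2 * u) * (Q' * sin (u + v) * hP' + sin (o - v) * hQ')
  · have hid := diagonal_identity_last (vertex k C k) (vertex k C 0) δ S
    have z6 : vertex k C 0 - vertex k C k = k * η := by
      rw [← z5]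
      ring
    rw [hQ0 rfl] at hD
    rw [z6] at hP'
    rw [add_sub_assoc, z6] at hid
    rw [(hU0 rfl).1, (hU0 rfl).2, if_neg (lt_irrefl k)]
    refine mul_right_cancel₀ (y1 k hk0 le_rfl) ?_
    set v := vertex k C k with hv
    set o := vertex k C 0 with ho
    linear_combination 2 * sin t * hid +
      sin t * ((sin δ + S) * L + (sin δ - S) * L') * h2V +
      2 * sin t * (sin δ + S) * cos v * hL + 2 * sin t * (sin δ - S) * sin v * hL' +
      sin η * hD + 2 * sin t * (sin (2 * v - δ) - S) * hP'

/-- The coefficients in the trigonometric limit. -/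
theorem isTrigonometric (h : Admissible n C)
    (hsin : sin (alpha n 1 C / 2 * C.g) ≠ 0 ∧ sin (alpha n 1 C / 2 * (C.g - 1)) ≠ 0) :
    IsTrigonometric n (colA n C 0) (colBPlus n C 0) (colBMinus n C 0)
      (fun k => vertex n C k - alpha n 1 C / 2 * C.g / 2)
      (alpha n 1 C / 2 * C.g) (2 * sin (alpha n 1 C / 2)) (alpha n 1 C / 2 * (C.gr' 0 + C.gr' 1))
      (sin (alpha n 1 C / 2 * (C.gr' 0 - C.gr' 1))) (trigValue n C 0) := by
  have x1 : ∀ k, 2 * (vertex n C k - alpha n 1 C / 2 * C.g / 2) - alpha n 1 C / 2 * C.g =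
      alpha n 1 C / 2 * (2 * rho n C (k + 1) + 1) := fun k => by
    rw [vertex, rho_succ]
    ring
  have x2 : ∀ k, 2 * (vertex n C k - alpha n 1 C / 2 * C.g / 2) =
      alpha n 1 C / 2 * (rho n C k + rho n C (k + 1) + 1) := fun k => by
    rw [vertex, rho_succ]
    ring
  have x3 : ∀ k, 2 * (vertex n C k - alpha n 1 C / 2 * C.g / 2) + alpha n 1 C / 2 * C.g =
      alpha n 1 C / 2 * (2 * rho n C k + 1) := fun k => by
    rw [vertex]
    ring
  have x4 : ∀ i k, vertex n C i - alpha n 1 C / 2 * C.g / 2 -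
      (vertex n C k - alpha n 1 C / 2 * C.g / 2) = alpha n 1 C / 2 * ((k - i) * C.g) := fun i k => by
    rw [sub_sub_sub_cancel_right, lattice_sub]
    ring
  have x5 : ∀ i k, vertex n C i - alpha n 1 C / 2 * C.g / 2 +
      (vertex n C k - alpha n 1 C / 2 * C.g / 2) =
      alpha n 1 C / 2 * (rho n C i + rho n C (k + 1) + 1) := fun i k => by
    rw [vertex, vertex, rho_succ]
    ring
  have hp : |(0 : ℝ)| < 1 := by simp
  have y1 : ∀ k, 1 ≤ k → k ≤ n → sin (alpha n 1 C / 2 * (2 * rho n C k + 1)) ≠ 0 := by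
    intro k h1 h2
    rw [show alpha n 1 C / 2 * (2 * rho n C k + 1) = 2 * vertex n C k by rw [vertex]; ring,
      sin_two_mul]
    obtain ⟨h3, h4⟩ := h.vertex_ne_zero h1 h2
    exact mul_ne_zero (mul_ne_zero two_ne_zero h3) h4
  refine ⟨h.one_le, fun i => ?_, hsin.1, fun k hk => ?_, ?_, fun k h1 hk => ?_, ?_, fun k hk => ?_,
    fun k h1 hk => ?_, fun k hk => ?_, fun k h1 hk => ?_, fun i k hik hk => ?_⟩
  · simp only [vertex_succ]
    ring
  · obtain ⟨P, Q, hB, hP, -, hQ⟩ := h.colBPlus_trig hk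
    simp only [x1, x4, x5]
    rw [x2]
    rw [add_comm (rho n C k) (rho n C (0 + 1)), show rho n C (0 + 1) + rho n C k =
      rho n C 0 + rho n C (k + 1) by rw [rho_succ, rho_succ]; ring]
    linear_combination sin (alpha n 1 C / 2 * C.g) *
        sin (alpha n 1 C / 2 * (rho n C k + rho n C (k + 1) + 1)) * hB +
      2 * sin (alpha n 1 C / 2) * (sin (alpha n 1 C / 2 * (2 * rho n C (k + 1) + 1) +
        alpha n 1 C / 2 * (C.gr' 0 + C.gr' 1)) + sin (alpha n 1 C / 2 * (C.gr' 0 - C.gr' 1))) *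
        (sin (alpha n 1 C / 2 * ((n - k) * C.g)) * hP +
          P * sin (alpha n 1 C / 2 * (rho n C k + rho n C (k + 1) + 1)) * hQ)
  · obtain ⟨P, Q, hB, -, hP, hQ⟩ := h.colBPlus_trig h.one_le
    simp only [x1, x4]
    rw [hP rfl] at hB
    linear_combination sin (alpha n 1 C / 2 * C.g) * hB +
      2 * sin (alpha n 1 C / 2) * (sin (alpha n 1 C / 2 * (2 * rho n C (0 + 1) + 1) +
        alpha n 1 C / 2 * (C.gr' 0 + C.gr' 1)) + sin (alpha n 1 C / 2 * (C.gr' 0 - C.gr' 1))) * hQ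
  · obtain ⟨k, rfl⟩ : ∃ i, k = i + 1 := ⟨k - 1, by omega⟩
    obtain ⟨P, Q, hB, hP, hQ, -⟩ := h.colBMinus_trig hk
    simp only [x3, x4, x5]
    rw [x2]
    rw [Nat.cast_zero, sub_zero, Nat.cast_succ]
    linear_combination sin (alpha n 1 C / 2 * C.g) *
        sin (alpha n 1 C / 2 * (rho n C (k + 1) + rho n C (k + 1 + 1) + 1)) * hB +
      2 * sin (alpha n 1 C / 2) * (sin (alpha n 1 C / 2 * (2 * rho n C (k + 1) + 1) -
        alpha n 1 C / 2 * (C.gr' 0 + C.gr' 1)) - sin (alpha n 1 C / 2 * (C.gr' 0 - C.gr' 1))) *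
        (sin (alpha n 1 C / 2 * ((k + 1) * C.g)) * hQ +
          Q * sin (alpha n 1 C / 2 * (rho n C (k + 1) + rho n C (k + 1 + 1) + 1)) * hP)
  · obtain ⟨k, hk⟩ : ∃ i, n = i + 1 := ⟨n - 1, by have := h.one_le; omega⟩
    obtain ⟨P, Q, hB, hP, -, hQ⟩ := h.colBMinus_trig (k := k) (by omega)
    simp only [x3, x4]
    rw [hQ hk.symm] at hB
    rw [← Nat.cast_succ, Nat.succ_eq_add_one, ← hk] at hP
    rw [← hk] at hB
    rw [Nat.cast_zero, sub_zero]
    linear_combination sin (alpha n 1 C / 2 * C.g) * hB +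
      2 * sin (alpha n 1 C / 2) * (sin (alpha n 1 C / 2 * (2 * rho n C n + 1) -
        alpha n 1 C / 2 * (C.gr' 0 + C.gr' 1)) - sin (alpha n 1 C / 2 * (C.gr' 0 - C.gr' 1))) * hP
  · exact h.diagonal_sum hsin hk
  · rw [x2]
    exact sin_ne_of_bracket (h.two_var_pos hp h1 (Nat.lt_succ_self k) hk (.inl rfl)).2.2.1
  · rw [x1]
    exact y1 _ (by omega) hk
  · rw [x3]
    exact y1 _ h1 hk
  · have hik' : (i : ℝ) + 1 ≤ k := by exact_mod_cast hik
    have hk' : (k : ℝ) ≤ n := by exact_mod_cast hk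
    have h1 := h.g_pos
    have h2 := h.g1_pos
    have h3 := h.g2_pos
    have h4 : (0 : ℝ) ≤ i := Nat.cast_nonneg i
    simp only [x4, x5]
    constructor
    · refine sin_ne_of_bracket (h.bracket_zero_pos' hp ?_ ?_)
      · simp only [rho]
        push_cast
        nlinarith
      · simp only [rho]
        push_cast
        nlinarith
    -- For `n ≥ 2` one has `(k - i) g ≤ n g ≤ 2 (n - 1) g`, which lies below the zero at `2 π / α`;
    -- for `n = 1` only the sine of `α g / 2` occurs, nonzero by assumption.
    · by_cases hn : n = 1
      · obtain rfl : i = 0 := by omega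
        obtain rfl : k = 1 := by omega
        simpa using hsin.1
      · have hn' : (2 : ℝ) ≤ n := by
          have := h.one_le
          exact_mod_cast (by omega : 2 ≤ n)
        refine sin_ne_of_bracket (h.bracket_zero_pos' hp (mul_pos (by linarith) h1) ?_)
        nlinarith

end Admissible

end EllipticRacah

namespace EllipticRacah

open Polynomial

/-! ### The Hamiltonian on columns -/

theorem column_injective (n : ℕ) : Function.Injective fun k : Fin (n + 1) => column n k := by
  have key : ∀ k l : Fin (n + 1), k < l → columnFun n k ≠ columnFun n l := by
    intro k l hkl he
    have hk : (k : ℕ) < n := by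
      have h1 : (k : ℕ) < l := hkl
      omega
    have h2 := congrFun he ⟨k, hk⟩
    have h1 : (k : ℕ) < l := hkl
    simp [columnFun, h1] at h2
  intro k l hkl
  have h : columnFun n k = columnFun n l := congrArg Subtype.val hkl
  rcases lt_trichotomy k l with h1 | h1 | h1
  · exact absurd h (key k l h1)
  · exact h1
  · exact absurd h.symm (key l k h1)

theorem column_surjective (n : ℕ) : Function.Surjective fun k : Fin (n + 1) => column n k := by
  classical
  rintro ⟨lam, hlam⟩
  obtain ⟨hb, ha⟩ := mem_boundedPartitions.1 hlam
  -- The height of the column is the first position with a vanishing entry, where position `n`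
  -- counts vacuously.
  have hex : ∃ k, ∀ h : k < n, lam ⟨k, h⟩ = 0 := ⟨n, fun h => absurd h (lt_irrefl n)⟩
  have hle : Nat.find hex ≤ n := Nat.find_min' hex fun h => absurd h (lt_irrefl n)
  refine ⟨⟨Nat.find hex, Nat.lt_succ_of_le hle⟩, Subtype.ext (funext fun j => ?_)⟩
  change columnFun n (Nat.find hex) j = lam j
  unfold columnFun
  obtain ⟨h0, h1⟩ := hb j
  split_ifs with hj
  · have h2 := Nat.find_min hex hj
    push Not at h2
    obtain ⟨_, h2⟩ := h2
    have h3 : lam j ≠ 0 := h2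
    push_cast at h1
    omega
  · have hjn := j.2
    have h2 := Nat.find_spec hex (by omega)
    have h3 : lam j ≤ lam ⟨Nat.find hex, by omega⟩ := ha (Fin.mk_le_of_le_val (by omega))
    omega

/-- The columns exhaust the partitions with parts at most one. -/
noncomputable def columnEquiv (n : ℕ) : Fin (n + 1) ≃ BPart n 1 :=
  Equiv.ofBijective _ ⟨column_injective n, column_surjective n⟩

@[simp] theorem columnEquiv_apply (n : ℕ) (k : Fin (n + 1)) : columnEquiv n k = column n k := rfl

theorem columnFun_add_single {n k : ℕ} {j : Fin n} (hj : (j : ℕ) = k) :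
    columnFun n k + (1 : ℤ) • Pi.single j 1 = columnFun n (k + 1) := by
  funext i
  by_cases h : i = j
  · subst h
    simp [columnFun, hj]
  · have h' : (i : ℕ) ≠ k := fun h1 => h (Fin.ext (h1.trans hj.symm))
    simp only [columnFun, Pi.add_apply, Pi.smul_apply, Pi.single_eq_of_ne h, smul_zero, add_zero]
    exact if_congr (by omega) rfl rfl

theorem columnFun_sub_single {n k : ℕ} {j : Fin n} (hj : (j : ℕ) + 1 = k) :
    columnFun n k + (-1 : ℤ) • Pi.single j 1 = columnFun n (k - 1) := by
  obtain rfl : k = (j : ℕ) + 1 := hj.symm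
  rw [← columnFun_add_single (k := j) rfl, add_assoc, ← add_smul, Nat.add_sub_cancel]
  simp

/-- Adding one inside the column breaks the bound `1`, and adding it further down than the first
zero breaks monotonicity. -/
theorem columnFun_add_mem {n k : ℕ} (j : Fin n)
    (h : columnFun n k + (1 : ℤ) • Pi.single j 1 ∈ boundedPartitions n 1) : (j : ℕ) = k := by
  obtain ⟨hb, ha⟩ := mem_boundedPartitions.1 h
  have h1 : ¬ (j : ℕ) < k := by
    intro h1
    have := (hb j).2
    simp [columnFun, h1] at this
  by_contra h2
  have hjn := j.2
  have h3 : (⟨k, by omega⟩ : Fin n) ≤ j := Fin.mk_le_of_le_val (by omega)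
  have h4 : (⟨k, by omega⟩ : Fin n) ≠ j := fun h4 => h2 (congrArg Fin.val h4).symm
  have := ha h3
  simp [columnFun, h1, Pi.single_eq_of_ne h4] at this

theorem columnFun_sub_mem {n k : ℕ} (hk : k ≤ n) (j : Fin n)
    (h : columnFun n k + (-1 : ℤ) • Pi.single j 1 ∈ boundedPartitions n 1) : (j : ℕ) + 1 = k := by
  obtain ⟨hb, ha⟩ := mem_boundedPartitions.1 h
  have h1 : (j : ℕ) < k := by
    by_contra h1
    have := (hb j).1
    simp [columnFun, h1] at this
  by_contra h2
  have hjn := j.2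
  have h3 : j ≤ (⟨k - 1, by omega⟩ : Fin n) := Fin.le_def.2 (by simp; omega)
  have h4 : (⟨k - 1, by omega⟩ : Fin n) ≠ j := fun h4 => h2 (by
    have := congrArg Fin.val h4
    simp at this
    omega)
  have := ha h3
  simp [columnFun, h1, Pi.single_eq_of_ne h4, show k - 1 < k by omega] at this

variable {n : ℕ} {C : Couplings} {p : ℝ}

/-- The action of the Hamiltonian on functions of a column. -/
theorem hamiltonian_column (f : BPart n 1 → ℂ) {k : ℕ} (hk : k ≤ n) :
    hamiltonian n 1 C p f (column n k) = (colA n C p k : ℂ) * f (column n k) +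
      ((if k < n then (colBPlus n C p (k + 1) : ℂ) * f (column n (k + 1)) else 0) +
        (if 1 ≤ k then (colBMinus n C p k : ℂ) * f (column n (k - 1)) else 0)) := by
  have hsum : ∀ j : Fin n, (∑ ε ∈ ({1, -1} : Finset ℤ),
      if h : (column n k).1 + ε • Pi.single j 1 ∈ boundedPartitions n 1 then
        (coeffB n 1 C p (column n k).1 ε j : ℂ) * f ⟨(column n k).1 + ε • Pi.single j 1, h⟩
      else 0) =
      (if (j : ℕ) = k then (colBPlus n C p (k + 1) : ℂ) * f (column n (k + 1)) else 0) +
        if (j : ℕ) + 1 = k then (colBMinus n C p k : ℂ) * f (column n (k - 1)) else 0 := by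
    intro j
    have hj := j.2
    rw [Finset.sum_pair (by decide)]
    congr 1
    · by_cases h1 : (j : ℕ) = k
      · have h2 : (column n k).1 + (1 : ℤ) • Pi.single j 1 = columnFun n (k + 1) :=
          columnFun_add_single h1
        rw [if_pos h1, dif_pos (h2 ▸ columnFun_mem n (k + 1))]
        congr 1
        · rw [colBPlus, dif_pos ⟨by omega, by omega⟩]
          have h3 : (⟨k + 1 - 1, by omega⟩ : Fin n) = j := Fin.ext (by simp [h1])
          rw [h3, Nat.add_sub_cancel]
          rfl
        · exact congrArg f (Subtype.ext h2)
      · rw [if_neg h1]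
        exact dif_neg fun h => h1 (columnFun_add_mem j h)
    · by_cases h1 : (j : ℕ) + 1 = k
      · have h2 : (column n k).1 + (-1 : ℤ) • Pi.single j 1 = columnFun n (k - 1) :=
          columnFun_sub_single h1
        rw [if_pos h1, dif_pos (h2 ▸ columnFun_mem n (k - 1))]
        congr 1
        · rw [colBMinus, dif_pos ⟨by omega, by omega⟩]
          have h3 : (⟨k - 1, by omega⟩ : Fin n) = j := Fin.ext (by simp; omega)
          rw [h3]
          rfl
        · exact congrArg f (Subtype.ext h2)
      · rw [if_neg h1]
        exact dif_neg fun h => h1 (columnFun_sub_mem hk j h)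
  change (coeffA n 1 C p (column n k).1 : ℂ) * f (column n k) + _ = _
  rw [Finset.sum_congr rfl fun j _ => hsum j, Finset.sum_add_distrib]
  congr 2
  · rw [Fin.sum_univ_eq_sum_range
      (fun j => if j = k then (colBPlus n C p (k + 1) : ℂ) * f (column n (k + 1)) else 0),
      Finset.sum_ite_eq']
    exact if_congr Finset.mem_range rfl rfl
  · rw [Fin.sum_univ_eq_sum_range
      (fun j => if j + 1 = k then (colBMinus n C p k : ℂ) * f (column n (k - 1)) else 0)]
    split_ifs with h
    · rw [Finset.sum_eq_single (k - 1)]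
      · rw [if_pos (by omega)]
      · intro b _ hb
        rw [if_neg (by omega)]
      · intro hb
        rw [Finset.mem_range] at hb
        omega
    · refine Finset.sum_eq_zero fun i _ => if_neg (by omega)

theorem colPoly_eq_triPoly (n : ℕ) (C : Couplings) (p : ℝ) (k : ℕ) :
    colPoly n C p k = triPoly (colA n C p) (colBPlus n C p) (colBMinus n C p) k := rfl

theorem map_tri (A B D : ℕ → ℝ) (k : ℕ) : (tri A B D k).map Complex.ofRealHom =
    tri (fun i => (A i : ℂ)) (fun i => (B i : ℂ)) (fun i => (D i : ℂ)) k := by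
  ext i j
  simp only [Matrix.map_apply, tri, Matrix.of_apply, Complex.ofRealHom_eq_coe]
  split_ifs <;> simp

/-- In the standard basis, reindexed by column height, the matrix of `H` is the complexified
tridiagonal matrix itself. -/
theorem hamiltonian_charpoly (n : ℕ) (C : Couplings) (p : ℝ) :
    (hamiltonian n 1 C p).charpoly = (colPoly n C p (n + 1)).map Complex.ofRealHom := by
  rw [← LinearMap.charpoly_toMatrix _ ((Pi.basisFun ℂ (BPart n 1)).reindex (columnEquiv n).symm),
    colPoly_eq_triPoly, triPoly, ← Matrix.charpoly_map, map_tri]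
  congr 1
  ext k l
  rw [LinearMap.toMatrix_apply, Module.Basis.repr_reindex_apply, Module.Basis.reindex_apply,
    Pi.basisFun_repr, Pi.basisFun_apply, Equiv.symm_symm, columnEquiv_apply, columnEquiv_apply,
    hamiltonian_column _ (Nat.lt_succ_iff.1 k.2)]
  have h1 := tri_row_sum (fun i => (colA n C p i : ℂ)) (fun i => (colBPlus n C p i : ℂ))
    (fun i => (colBMinus n C p i : ℂ)) k
    fun j => (Pi.single (column n l) 1 : BPart n 1 → ℂ) (column n j)
  refine h1.symm.trans ?_
  rw [Finset.sum_eq_single l]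
  · rw [Pi.single_eq_same, mul_one]
  · intro j _ hj
    rw [Pi.single_eq_of_ne fun h => hj (column_injective n h), mul_zero]
  · simp

end EllipticRacah

namespace EllipticRacah

open Polynomial Filter Topology

/-! ### The eigenvalues -/

theorem roots_prod_X_sub_C_fin {ι R : Type*} [Fintype ι] [CommRing R] [IsDomain R] (f : ι → R) :
    (∏ i, (X - C (f i))).roots = Finset.univ.val.map f := by
  have h : ∏ i, (X - C (f i)) = ((Finset.univ.val.map f).map fun a => X - C a).prod := by
    rw [Multiset.map_map]
    rfl
  rw [h, roots_multiset_prod_X_sub_C]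

theorem injective_of_prod_X_sub_C_eq {ι R : Type*} [Fintype ι] [CommRing R] [IsDomain R] {f g : ι → R}
    (h : ∏ i, (X - C (f i)) = ∏ i, (X - C (g i))) (hg : Function.Injective g) :
    Function.Injective f := by
  have h1 := congrArg roots h
  rw [roots_prod_X_sub_C_fin, roots_prod_X_sub_C_fin] at h1
  have h2 : (Finset.univ.val.map f).Nodup := h1 ▸ Finset.univ.nodup.map hg
  intro i j hij
  exact Multiset.inj_on_of_nodup_map h2 i (Finset.mem_univ i) j (Finset.mem_univ j) hij

theorem trigValue_eq_sum (n : ℕ) (C : Couplings) (k : ℕ) :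
    trigValue n C k = 2 * ∑ j : Fin n,
      Real.cos (alpha n 1 C * (rhoHat n C ((j : ℕ) + 1) + ((column n k).1 j : ℝ))) := by
  rw [trigValue, ← Fin.sum_univ_eq_sum_range
    (fun i => Real.cos (alpha n 1 C * (rhoHat n C (i + 1) + if i < k then 1 else 0)))]
  congr 1
  refine Finset.sum_congr rfl fun j _ => ?_
  congr 3
  change _ = ((columnFun n k j : ℤ) : ℝ)
  rw [columnFun]
  split_ifs <;> simp

namespace Admissible

variable {n : ℕ} {C : Couplings} {p : ℝ}

theorem mul_pos_of_le (h : Admissible n C) (hp : |p| < 1) (j : ℕ) (h1 : 1 ≤ j) (h2 : j ≤ n) :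
    0 < colBPlus n C p j * colBMinus n C p j := by
  obtain ⟨i, rfl⟩ : ∃ i, j = i + 1 := ⟨j - 1, by omega⟩
  exact mul_pos (h.colBPlus_pos hp h2) (h.colBMinus_pos hp h2)

theorem exists_roots (h : Admissible n C) (hp : |p| < 1) :
    ∃ r : Fin (n + 1) → ℝ, StrictAnti r ∧
      colPoly n C p (n + 1) = ∏ i, (Polynomial.X - Polynomial.C (r i)) :=
  triPoly_exists_roots (h.mul_pos_of_le hp)

/-- The sorted eigenvalues. -/
noncomputable def sortedRoot (h : Admissible n C) (i : Fin (n + 1)) (p : ℝ) : ℝ := by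
  classical exact if hp : |p| < 1 then (h.exists_roots hp).choose i else 0

theorem sortedRoot_spec (h : Admissible n C) (hp : |p| < 1) :
    (StrictAnti fun i => h.sortedRoot i p) ∧
      colPoly n C p (n + 1) = ∏ i, (Polynomial.X - Polynomial.C (h.sortedRoot i p)) := by
  have h1 : (fun i => h.sortedRoot i p) = (h.exists_roots hp).choose := by
    funext i
    rw [sortedRoot, dif_pos hp]
  have h2 := (h.exists_roots hp).choose_spec
  rw [← h1] at h2
  exact h2

theorem colPoly_analyticAt (h : Admissible n C) (hp : |p| < 1)
    (hg : bracket (alpha n 1 C) p 0 C.g * bracket (alpha n 1 C) p 0 (C.g - 1) ≠ 0) (x : ℝ) :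
    AnalyticAt ℝ (fun z : ℝ × ℝ => (colPoly n C z.1 (n + 1)).eval z.2) (p, x) := by
  refine (analyticAt_eval_triPoly (A := fun k q => colA n C q k) (B := fun k q => colBPlus n C q k)
    (D := fun k q => colBMinus n C q k) (fun k hk => h.colA_analyticAt hp hg hk)
    (fun k h1 h2 => ?_) n le_rfl).2
  obtain ⟨i, rfl⟩ : ∃ i, k = i + 1 := ⟨k - 1, by omega⟩
  exact (h.colBPlus_analyticAt hp h2).mul (h.colBMinus_analyticAt hp h2)

/-- The characteristic polynomial in the trigonometric limit. -/
theorem colPoly_zero (h : Admissible n C)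
    (hsin : Real.sin (alpha n 1 C / 2 * C.g) ≠ 0 ∧ Real.sin (alpha n 1 C / 2 * (C.g - 1)) ≠ 0) :
    colPoly n C 0 (n + 1) =
      ∏ m : Fin (n + 1), (Polynomial.X - Polynomial.C (trigValue n C m)) := by
  rw [colPoly_eq_triPoly, (h.isTrigonometric hsin).triPoly_eq]
  refine Finset.prod_congr rfl fun m _ => ?_
  rw [h.eig_eq_trigValue hsin.1 m (Nat.lt_succ_iff.1 m.2)]

/-- Both lists are strictly decreasing and consist of roots of the same polynomial, so they agree
entry by entry. -/
theorem sortedRoot_zero (h : Admissible n C)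
    (hsin : Real.sin (alpha n 1 C / 2 * C.g) ≠ 0 ∧ Real.sin (alpha n 1 C / 2 * (C.g - 1)) ≠ 0)
    (i : Fin (n + 1)) : h.sortedRoot i 0 = trigValue n C i := by
  obtain ⟨h1, h2⟩ := h.sortedRoot_spec (p := 0) (by simp)
  refine congrFun (strictAnti_unique_of_subset h1 h.trigValue_strictAnti fun i => ?_) i
  have h3 := congrArg (Polynomial.eval (h.sortedRoot i 0)) (h2.symm.trans (h.colPoly_zero hsin))
  rw [Polynomial.eval_prod, Polynomial.eval_prod,
    Finset.prod_eq_zero (Finset.mem_univ i) (by simp)] at h3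
  obtain ⟨j, -, hj⟩ := Finset.prod_eq_zero_iff.1 h3.symm
  exact ⟨j, by simpa [sub_eq_zero] using hj⟩

/-- The family is obtained by sorting the roots in decreasing order and labelling them by column
height. Simplicity makes the sorted roots analytic, and at `p = 0` the prescribed values are already
decreasing. -/
theorem exists_eigenvalueFamily (h : Admissible n C)
    (hsin : Real.sin (alpha n 1 C / 2 * C.g) ≠ 0 ∧ Real.sin (alpha n 1 C / 2 * (C.g - 1)) ≠ 0) :
    ∃ E : BPart n 1 → ℝ → ℝ, IsEigenvalueFamily n 1 C E := by
  refine ⟨fun ν => h.sortedRoot ((columnEquiv n).symm ν), fun ν p hp => ?_, fun p hp => ?_,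
    fun ν => ?_⟩
  · have hp' : |p| < 1 := abs_lt.2 hp
    refine analyticAt_roots (P := fun q => colPoly n C q (n + 1))
      (h.colPoly_analyticAt hp' (h.bracket_g_ne_zero hp' hsin)) ?_ _
    filter_upwards [(isOpen_lt continuous_abs continuous_const).mem_nhds hp'] with q hq
    exact h.sortedRoot_spec hq
  · rw [hamiltonian_charpoly, (h.sortedRoot_spec (abs_lt.2 hp)).2, Polynomial.map_prod]
    refine Fintype.prod_equiv (columnEquiv n) _ _ fun i => ?_
    simp only [Polynomial.map_sub, Polynomial.map_X, Polynomial.map_C, Equiv.symm_apply_apply,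
      Complex.ofRealHom_eq_coe]
  · obtain ⟨k, rfl⟩ := (columnEquiv n).surjective ν
    simp only [Equiv.symm_apply_apply]
    rw [h.sortedRoot_zero hsin, trigValue_eq_sum]
    rfl

end Admissible

namespace IsEigenvalueFamily

variable {n : ℕ} {C : Couplings} {p : ℝ} {E : BPart n 1 → ℝ → ℝ}

theorem colPoly_eq (hE : IsEigenvalueFamily n 1 C E) (hp : p ∈ Set.Ioo (-1 : ℝ) 1) :
    colPoly n C p (n + 1) =
      ∏ l : Fin (n + 1), (Polynomial.X - Polynomial.C (E (column n l) p)) := by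
  refine Polynomial.map_injective Complex.ofRealHom Complex.ofReal_injective ?_
  rw [← hamiltonian_charpoly, hE.charpoly_eq p hp, Polynomial.map_prod]
  refine (Fintype.prod_equiv (columnEquiv n) _ _ fun i => ?_).symm
  simp only [Polynomial.map_sub, Polynomial.map_X, Polynomial.map_C, Complex.ofRealHom_eq_coe,
    columnEquiv_apply]

theorem injective (hE : IsEigenvalueFamily n 1 C E) (h : Admissible n C)
    (hp : p ∈ Set.Ioo (-1 : ℝ) 1) : Function.Injective fun l : Fin (n + 1) => E (column n l) p := by
  obtain ⟨h1, h2⟩ := h.sortedRoot_spec (abs_lt.2 hp)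
  exact injective_of_prod_X_sub_C_eq ((hE.colPoly_eq hp).symm.trans h2) h1.injective

/-- The order is known at `p = 0`. If two branches were in the wrong order at another `p`, the
intermediate value theorem would give a point where they meet, against simplicity of the spectrum.
-/
theorem strictAnti (hE : IsEigenvalueFamily n 1 C E) (h : Admissible n C)
    (hp : p ∈ Set.Ioo (-1 : ℝ) 1) : StrictAnti fun l : Fin (n + 1) => E (column n l) p := by
  intro i j hij
  by_contra hle
  have h0 : (0 : ℝ) ∈ Set.Ioo (-1 : ℝ) 1 := by simp
  have h1 : E (column n j) 0 < E (column n i) 0 := by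
    rw [hE.at_zero, hE.at_zero, ← trigValue_eq_sum, ← trigValue_eq_sum]
    exact h.trigValue_strictAnti hij
  obtain ⟨q, hq, hq'⟩ := isPreconnected_Ioo.intermediate_value₂ h0 hp
    (hE.analytic (column n j)).continuousOn (hE.analytic (column n i)).continuousOn h1.le
    (not_lt.1 hle)
  exact hij.ne' (hE.injective h hq hq')

end IsEigenvalueFamily

end EllipticRacah

namespace EllipticRacah

open Polynomial

/-! ### The eigenfunctions -/

theorem eval_derivative_prod_X_sub_C {ι R : Type*} [Fintype ι] [DecidableEq ι] [CommRing R]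
    (f : ι → R) (i : ι) :
    (derivative (∏ j, (X - C (f j)))).eval (f i) = ∏ j ∈ Finset.univ.erase i, (f i - f j) := by
  rw [derivative_prod_finset, eval_finsetSum, Finset.sum_eq_single i]
  · rw [eval_mul, eval_prod]
    simp
  · intro j _ hj
    rw [eval_mul, eval_prod, Finset.prod_eq_zero (Finset.mem_erase.2 ⟨hj.symm, Finset.mem_univ i⟩),
      zero_mul]
    simp
  · simp

/-- The polynomials of a Jacobi matrix satisfy the dual orthogonality relations. -/
theorem sum_triPoly_div_norm {n : ℕ} {A B D w : ℕ → ℝ} {x : Fin (n + 1) → ℝ} (hw0 : w 0 = 1)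
    (hwpos : ∀ k ≤ n, 0 < w k) (hw : ∀ k < n, w (k + 1) * (B (k + 1) * D (k + 1)) = w k)
    (hx : Function.Injective x) (hroot : ∀ i, (triPoly A B D (n + 1)).eval (x i) = 0)
    (k : Fin (n + 1)) :
    ∑ l, (triPoly A B D k).eval (x l) /
      (∑ i ∈ Finset.range (n + 1), w i * (triPoly A B D i).eval (x l) ^ 2) =
      if k = 0 then 1 else 0 := by
  set N : Fin (n + 1) → ℝ := fun l =>
    ∑ i ∈ Finset.range (n + 1), w i * (triPoly A B D i).eval (x l) ^ 2 with hN
  set M : Matrix (Fin (n + 1)) (Fin (n + 1)) ℝ :=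
    Matrix.of fun l k => (triPoly A B D k).eval (x l) with hM
  -- Christoffel–Darboux says that the rows of `M` are orthogonal with weights `w` and norms `N`.
  -- For square matrices this one-sided inverse is two-sided, and column `0` of the reversed product
  -- is the claim.
  have h1 : (M * Matrix.diagonal fun k : Fin (n + 1) => w k) * (M.transpose * Matrix.diagonal fun l => (N l)⁻¹) =
      1 := by
    ext l m
    rw [Matrix.mul_apply]
    simp only [Matrix.mul_diagonal, Matrix.transpose_apply, hM, Matrix.of_apply]
    have h2 : ∑ k : Fin (n + 1), (triPoly A B D k).eval (x l) * w k *
        ((triPoly A B D k).eval (x m) * (N m)⁻¹) = (∑ i ∈ Finset.range (n + 1),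
          w i * ((triPoly A B D i).eval (x l) * (triPoly A B D i).eval (x m))) * (N m)⁻¹ := by
      rw [← Fin.sum_univ_eq_sum_range
        (fun i => w i * ((triPoly A B D i).eval (x l) * (triPoly A B D i).eval (x m))),
        Finset.sum_mul]
      exact Finset.sum_congr rfl fun i _ => by ring
    rw [h2]
    by_cases hlm : l = m
    · subst hlm
      rw [Matrix.one_apply_eq, ← mul_inv_cancel₀ (sum_weight_pos (A := A) (B := B) (D := D) hw0 hwpos
        (x l)).ne']
      congr 1
      exact Finset.sum_congr rfl fun i _ => by ring
    · rw [Matrix.one_apply_ne hlm]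
      have h3 := christoffel_darboux (A := A) hw0 hw (x l) (x m) n le_rfl
      rw [hroot, hroot, zero_mul, mul_zero, sub_zero, mul_zero] at h3
      rw [(mul_eq_zero.1 h3).resolve_left (sub_ne_zero.2 fun h => hlm (hx h)), zero_mul]
  have h2 := congrArg (fun A : Matrix (Fin (n + 1)) (Fin (n + 1)) ℝ => A k 0) (mul_eq_one_comm.1 h1)
  rw [Matrix.mul_apply, Matrix.one_apply] at h2
  rw [← h2]
  refine Finset.sum_congr rfl fun l _ => ?_
  simp only [Matrix.mul_diagonal, Matrix.transpose_apply, hM, Matrix.of_apply]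
  simp [hw0, hN, div_eq_mul_inv]

namespace Admissible

variable {n : ℕ} {C : Couplings} {p : ℝ}

theorem colWeight_zero (n : ℕ) (C : Couplings) (p : ℝ) :
    colC n C p 0 ^ 2 * weight n 1 C p (columnFun n 0) = 1 := by
  rw [colC_zero, weight_zero]
  norm_num

theorem colWeight_pos (h : Admissible n C) (hp : |p| < 1) (k : ℕ) (hk : k ≤ n) :
    0 < colC n C p k ^ 2 * weight n 1 C p (columnFun n k) :=
  mul_pos (pow_pos (h.colC_pos hp hk) 2) (h.weight_pos hp k hk)

/-- Shows that `c_k ^ 2 Δ_k` are the Christoffel–Darboux weights of the tridiagonal matrix: the two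
factors `1 / B_{k+1}` from `c` combine with the ratio of the weights. -/
theorem colWeight_succ (h : Admissible n C) (hp : |p| < 1) (k : ℕ) (hk : k < n) :
    colC n C p (k + 1) ^ 2 * weight n 1 C p (columnFun n (k + 1)) *
      (colBPlus n C p (k + 1) * colBMinus n C p (k + 1)) =
      colC n C p k ^ 2 * weight n 1 C p (columnFun n k) := by
  have h1 := (h.colBPlus_pos hp hk).ne'
  have h2 := (h.colBMinus_pos hp hk).ne'
  rw [h.colC_succ hp hk, h.weight_succ hp hk]
  field_simp

theorem colN_eq (n : ℕ) (C : Couplings) (p x : ℝ) : colN n C p x = ∑ k ∈ Finset.range (n + 1),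
    colC n C p k ^ 2 * weight n 1 C p (columnFun n k) *
      (triPoly (colA n C p) (colBPlus n C p) (colBMinus n C p) k).eval x ^ 2 :=
  Finset.sum_congr rfl fun k _ => by
    rw [colPoly_eq_triPoly]
    ring

theorem colN_pos (h : Admissible n C) (hp : |p| < 1) (x : ℝ) : 0 < colN n C p x := by
  rw [colN_eq]
  exact sum_weight_pos (w := fun k => colC n C p k ^ 2 * weight n 1 C p (columnFun n k))
    (colWeight_zero n C p) (h.colWeight_pos hp) x

/-- In the confluent Christoffel–Darboux formula the second term drops out at a root, and the
derivative of the factored characteristic polynomial there is the product of root differences. -/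
theorem colN_root (h : Admissible n C) (hp : |p| < 1) {x : Fin (n + 1) → ℝ}
    (hx : colPoly n C p (n + 1) = ∏ l, (X - Polynomial.C (x l))) (l : Fin (n + 1)) :
    colN n C p (x l) = colC n C p n ^ 2 * weight n 1 C p (columnFun n n) *
      (colPoly n C p n).eval (x l) * ∏ j ∈ Finset.univ.erase l, (x l - x j) := by
  rw [colN_eq, christoffel_darboux_confluent
    (w := fun k => colC n C p k ^ 2 * weight n 1 C p (columnFun n k)) (colWeight_zero n C p)
    (h.colWeight_succ hp) _ n le_rfl, ← colPoly_eq_triPoly, ← colPoly_eq_triPoly, hx,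
    eval_derivative_prod_X_sub_C, eval_prod, Finset.prod_eq_zero (Finset.mem_univ l) (by simp)]
  ring

end Admissible

/-- The eigenfunctions in terms of the polynomials, with value `1` at the origin. -/
noncomputable def columnVec (n : ℕ) (C : Couplings) (p x : ℝ) : BPart n 1 → ℂ := fun ν =>
  ((colC n C p ((columnEquiv n).symm ν) * (colPoly n C p ((columnEquiv n).symm ν)).eval x : ℝ) : ℂ)

theorem columnVec_column (n : ℕ) (C : Couplings) (p x : ℝ) {k : ℕ} (hk : k ≤ n) :
    columnVec n C p x (column n k) = ((colC n C p k * (colPoly n C p k).eval x : ℝ) : ℂ) := by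
  have h : (columnEquiv n).symm (column n k) = ⟨k, Nat.lt_succ_of_le hk⟩ :=
    (columnEquiv n).symm_apply_apply ⟨k, Nat.lt_succ_of_le hk⟩
  rw [columnVec, h]

theorem ext_column {n : ℕ} {β : Type*} {f g : BPart n 1 → β}
    (h : ∀ k ≤ n, f (column n k) = g (column n k)) : f = g := by
  funext ν
  obtain ⟨k, rfl⟩ := (columnEquiv n).surjective ν
  exact h k (Nat.lt_succ_iff.1 k.2)

theorem chi_column (n k : ℕ) (hk : k ≤ n) : chi n 1 (column n k) = if k = 0 then 1 else 0 := by
  have h1 : (column n k).1 = 0 ↔ k = 0 := by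
    constructor
    · intro h
      by_contra h0
      have h2 : columnFun n k ⟨0, by omega⟩ = 0 := congrFun h _
      simp [columnFun, Nat.pos_of_ne_zero h0] at h2
    · rintro rfl
      funext j
      simp [column, columnFun]
  rw [chi]
  exact if_congr h1 rfl rfl

namespace Admissible

variable {n : ℕ} {C : Couplings} {p : ℝ}

theorem hamiltonian_columnVec (h : Admissible n C) (hp : |p| < 1) {x : ℝ}
    (hx : (colPoly n C p (n + 1)).eval x = 0) :
    hamiltonian n 1 C p (columnVec n C p x) = (x : ℂ) • columnVec n C p x := by
  refine ext_column fun k hk => ?_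
  have h1 := eval_triPoly_row (A := colA n C p) (B := colBPlus n C p) (D := colBMinus n C p)
    (c := colC n C p) hx (fun k hk => by
      rw [h.colC_succ hp hk, inv_mul_cancel_right₀ (h.colBPlus_pos hp hk).ne']) k hk
  rw [hamiltonian_column _ hk, Pi.smul_apply, smul_eq_mul, columnVec_column _ _ _ _ hk,
    ← Complex.ofReal_mul x, colPoly_eq_triPoly, ← h1]
  push_cast
  congr 2
  · split_ifs with h2
    · rw [columnVec_column _ _ _ _ h2, colPoly_eq_triPoly]
      push_cast
      rfl
    · simp
  · split_ifs with h2
    · rw [columnVec_column _ _ _ _ (by omega), colPoly_eq_triPoly]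
      push_cast
      rfl
    · simp

/-- Dual orthogonality against `P_0 = 1` expands the unit vector at the empty column in the
eigenvectors; the coefficients are reciprocal norms because every `columnVec` has value `1` there.
-/
theorem chi_eq_sum (h : Admissible n C) (hp : |p| < 1) {x : Fin (n + 1) → ℝ}
    (hx : Function.Injective x) (hroot : ∀ l, (colPoly n C p (n + 1)).eval (x l) = 0) :
    chi n 1 = ∑ l, ((colN n C p (x l) : ℂ))⁻¹ • columnVec n C p (x l) := by
  refine ext_column fun k hk => ?_
  have h1 := sum_triPoly_div_norm
    (w := fun k => colC n C p k ^ 2 * weight n 1 C p (columnFun n k)) (colWeight_zero n C p)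
    (h.colWeight_pos hp) (h.colWeight_succ hp) hx hroot ⟨k, Nat.lt_succ_of_le hk⟩
  simp only [← colN_eq] at h1
  have h2 : ∑ l, (colN n C p (x l))⁻¹ * (colC n C p k * (colPoly n C p k).eval (x l)) =
      if k = 0 then 1 else 0 := by
    have h3 : ∑ l, (colN n C p (x l))⁻¹ * (colC n C p k * (colPoly n C p k).eval (x l)) =
        colC n C p k * ∑ l, (colPoly n C p k).eval (x l) / colN n C p (x l) := by
      rw [Finset.mul_sum]
      exact Finset.sum_congr rfl fun l _ => by ring
    rw [h3]
    refine (congrArg (colC n C p k * ·) h1).trans ?_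
    by_cases hk0 : k = 0
    · subst hk0
      simp [colC_zero]
    · rw [if_neg hk0, if_neg fun h => hk0 (congrArg Fin.val h), mul_zero]
  rw [chi_column n k hk, Finset.sum_apply]
  simp only [Pi.smul_apply, smul_eq_mul, columnVec_column _ _ _ _ hk]
  have h3 := congrArg (fun y : ℝ => (y : ℂ)) h2
  simp only [Complex.ofReal_sum, Complex.ofReal_mul, Complex.ofReal_inv] at h3
  push_cast at h3 ⊢
  rw [h3]
  split_ifs <;> simp

/-- The spectral projections of `χ`. -/
theorem eigenfunction_column (h : Admissible n C) (hp : p ∈ Set.Ioo (-1 : ℝ) 1)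
    {E : BPart n 1 → ℝ → ℝ} (hE : IsEigenvalueFamily n 1 C E) (l : Fin (n + 1)) :
    eigenfunction n 1 C E p (column n l) =
      ((colN n C p (E (column n l) p) : ℂ))⁻¹ • columnVec n C p (E (column n l) p) := by
  classical
  have hroot : ∀ m : Fin (n + 1), (colPoly n C p (n + 1)).eval (E (column n m) p) = 0 := by
    intro m
    rw [hE.colPoly_eq hp, eval_prod]
    exact Finset.prod_eq_zero (Finset.mem_univ m) (by simp)
  rw [eigenfunction, h.chi_eq_sum (abs_lt.2 hp) (hE.injective h hp) hroot, map_sum,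
    Finset.sum_eq_single l]
  -- On an eigenvector the polynomial in `H` acts through its value at the eigenvalue; the Lagrange
  -- polynomial is `1` at its own eigenvalue and, in the next case, `0` at the others.
  · rw [map_smul, Module.End.aeval_apply_of_mem_apply_eq_smul
      (h.hamiltonian_columnVec (abs_lt.2 hp) (hroot l)), eval_prod, Finset.prod_eq_one, one_smul]
    intro μ hμ
    obtain ⟨m, rfl⟩ := (columnEquiv n).surjective μ
    have h1 : m ≠ l := fun h => Finset.ne_of_mem_erase hμ (by rw [h]; rfl)
    have h2 : E (column n l) p - E (column n m) p ≠ 0 :=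
      sub_ne_zero.2 fun h3 => h1 (hE.injective h hp h3).symm
    rw [eval_mul, eval_C, eval_sub, eval_X, eval_C, columnEquiv_apply, ← Complex.ofReal_sub,
      inv_mul_cancel₀ (Complex.ofReal_ne_zero.2 h2)]
  · intro m _ hm
    rw [map_smul, Module.End.aeval_apply_of_mem_apply_eq_smul
      (h.hamiltonian_columnVec (abs_lt.2 hp) (hroot m)), eval_prod,
      Finset.prod_eq_zero (i := column n m), zero_smul, smul_zero]
    · exact Finset.mem_erase.2 ⟨fun h1 => hm (column_injective n h1), Finset.mem_univ _⟩
    · simp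
  · simp

/-- Orthogonality of the eigenfunctions. -/
theorem innerDelta_columnVec (h : Admissible n C) (hp : |p| < 1) {x y : ℝ}
    (hx : (colPoly n C p (n + 1)).eval x = 0) (hy : (colPoly n C p (n + 1)).eval y = 0) :
    innerDelta n 1 C p (columnVec n C p x) (columnVec n C p y) =
      if x = y then (colN n C p y : ℂ) else 0 := by
  have h1 : innerDelta n 1 C p (columnVec n C p x) (columnVec n C p y) =
      ((∑ k ∈ Finset.range (n + 1), colC n C p k ^ 2 * weight n 1 C p (columnFun n k) *
        ((colPoly n C p k).eval x * (colPoly n C p k).eval y) : ℝ) : ℂ) := by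
    rw [innerDelta, ← Fin.sum_univ_eq_sum_range
      (fun k => colC n C p k ^ 2 * weight n 1 C p (columnFun n k) *
        ((colPoly n C p k).eval x * (colPoly n C p k).eval y)), Complex.ofReal_sum]
    refine (Fintype.sum_equiv (columnEquiv n) _ _ fun k => ?_).symm
    rw [columnEquiv_apply, columnVec_column _ _ _ _ (Nat.lt_succ_iff.1 k.2),
      columnVec_column _ _ _ _ (Nat.lt_succ_iff.1 k.2), Complex.conj_ofReal]
    push_cast
    have : (column n k).1 = columnFun n k := rfl
    rw [this]
    ring
  rw [h1]
  split_ifs with hxy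
  · subst hxy
    rw [colN]
    congr 1
    exact Finset.sum_congr rfl fun k _ => by ring
  · have h2 := christoffel_darboux (A := colA n C p)
      (w := fun k => colC n C p k ^ 2 * weight n 1 C p (columnFun n k)) (colWeight_zero n C p)
      (h.colWeight_succ hp) x y n le_rfl
    simp only [← colPoly_eq_triPoly] at h2
    rw [hx, hy, zero_mul, mul_zero, sub_zero, mul_zero] at h2
    rw [(mul_eq_zero.1 h2).resolve_left (sub_ne_zero.2 hxy), Complex.ofReal_zero]

end Admissible

end EllipticRacah

/-! ### The diagonalization theorem -/

theorem mainTheorem4 (n : ℕ) (hn : 1 ≤ n) (C : EllipticRacah.Couplings)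
    (hg : 0 < C.g) (hg1 : 0 < C.gr 0) (hg2 : 0 < C.gr 1)
    (hg1' : |C.gr' 0| < C.gr 0 + 1 / 2) (hg2' : |C.gr' 1| < C.gr 1 + 1 / 2)
    (hg_ne : C.g ≠ 1)
    (hpole : n = 1 → Real.sin (EllipticRacah.alpha n 1 C / 2 * C.g) ≠ 0 ∧
      Real.sin (EllipticRacah.alpha n 1 C / 2 * (C.g - 1)) ≠ 0) :
    (∃ E : EllipticRacah.BPart n 1 → ℝ → ℝ, EllipticRacah.IsEigenvalueFamily n 1 C E) ∧
    ∀ E : EllipticRacah.BPart n 1 → ℝ → ℝ, EllipticRacah.IsEigenvalueFamily n 1 C E →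
      ∀ p ∈ Set.Ioo (-1 : ℝ) 1,
        -- the eigenvalues are the simple roots of the tridiagonal determinant, in this order
        (StrictAnti fun l : Fin (n + 1) => E (EllipticRacah.column n l) p) ∧
        EllipticRacah.colPoly n C p (n + 1) =
          ∏ l : Fin (n + 1),
            (Polynomial.X - Polynomial.C (E (EllipticRacah.column n l) p)) ∧
        -- the two expressions for the coefficients `c`
        (∀ k ≤ n, 0 < EllipticRacah.colC n C p k ∧
          EllipticRacah.colC n C p k =
            ∏ j ∈ Finset.Icc 1 k, (EllipticRacah.colBPlus n C p j)⁻¹) ∧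
        -- the two expressions for the norms `N`
        (∀ l : Fin (n + 1),
          0 < EllipticRacah.colN n C p (E (EllipticRacah.column n l) p) ∧
          EllipticRacah.colN n C p (E (EllipticRacah.column n l) p) =
            EllipticRacah.colC n C p n ^ 2 *
              EllipticRacah.weight n 1 C p (EllipticRacah.columnFun n n) *
              (EllipticRacah.colPoly n C p n).eval (E (EllipticRacah.column n l) p) *
              ∏ j ∈ Finset.univ.erase l,
                (E (EllipticRacah.column n l) p - E (EllipticRacah.column n j) p)) ∧
        -- the eigenfunctions
        (∀ k l : Fin (n + 1),
          EllipticRacah.eigenfunction n 1 C E p (EllipticRacah.column n l)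
              (EllipticRacah.column n k) =
            ((EllipticRacah.colC n C p k /
                EllipticRacah.colN n C p (E (EllipticRacah.column n l) p) *
              (EllipticRacah.colPoly n C p k).eval (E (EllipticRacah.column n l) p) : ℝ) : ℂ)) ∧
        (∀ l : Fin (n + 1),
          EllipticRacah.hamiltonian n 1 C p
              (EllipticRacah.eigenfunction n 1 C E p (EllipticRacah.column n l)) =
            (E (EllipticRacah.column n l) p : ℂ) •
              EllipticRacah.eigenfunction n 1 C E p (EllipticRacah.column n l)) ∧
        (∀ k l : Fin (n + 1),
          EllipticRacah.innerDelta n 1 C p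
              (EllipticRacah.eigenfunction n 1 C E p (EllipticRacah.column n k))
              (EllipticRacah.eigenfunction n 1 C E p (EllipticRacah.column n l)) =
            if k = l then
              EllipticRacah.eigenfunction n 1 C E p (EllipticRacah.column n l)
                (EllipticRacah.column n 0)
            else 0) := by
  have h : EllipticRacah.Admissible n C := ⟨hn, hg, hg1, hg2, hg1', hg2'⟩
  refine ⟨h.exists_eigenvalueFamily (h.sin_g_ne_zero hg_ne hpole), fun E hE p hp => ?_⟩
  have hp' : |p| < 1 := abs_lt.2 hp
  have hroot : ∀ l : Fin (n + 1),
      (EllipticRacah.colPoly n C p (n + 1)).eval (E (EllipticRacah.column n l) p) = 0 := by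
    intro l
    rw [hE.colPoly_eq hp, Polynomial.eval_prod]
    exact Finset.prod_eq_zero (Finset.mem_univ l) (by simp)
  refine ⟨hE.strictAnti h hp, hE.colPoly_eq hp,
    fun k hk => ⟨h.colC_pos hp' hk, h.colC_eq_prod hp' k hk⟩,
    fun l => ⟨h.colN_pos hp' _,
      h.colN_root hp' (x := fun l => E (EllipticRacah.column n l) p) (hE.colPoly_eq hp) l⟩,
    fun k l => ?_, fun l => ?_, fun k l => ?_⟩
  · rw [h.eigenfunction_column hp hE, Pi.smul_apply,
      EllipticRacah.columnVec_column _ _ _ _ (Nat.lt_succ_iff.1 k.2), smul_eq_mul]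
    push_cast
    ring
  · rw [h.eigenfunction_column hp hE, map_smul, h.hamiltonian_columnVec hp' (hroot l), smul_comm]
  · have hN := (h.colN_pos hp' (E (EllipticRacah.column n l) p)).ne'
    have h1 : EllipticRacah.innerDelta n 1 C p
        (EllipticRacah.eigenfunction n 1 C E p (EllipticRacah.column n k))
        (EllipticRacah.eigenfunction n 1 C E p (EllipticRacah.column n l)) =
        (EllipticRacah.colN n C p (E (EllipticRacah.column n k) p) : ℂ)⁻¹ *
          (EllipticRacah.colN n C p (E (EllipticRacah.column n l) p) : ℂ)⁻¹ *
          EllipticRacah.innerDelta n 1 C p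
            (EllipticRacah.columnVec n C p (E (EllipticRacah.column n k) p))
            (EllipticRacah.columnVec n C p (E (EllipticRacah.column n l) p)) := by
      rw [h.eigenfunction_column hp hE, h.eigenfunction_column hp hE, EllipticRacah.innerDelta,
        EllipticRacah.innerDelta, Finset.mul_sum]
      refine Finset.sum_congr rfl fun ν _ => ?_
      rw [Pi.smul_apply, Pi.smul_apply, smul_eq_mul, smul_eq_mul, map_mul, map_inv₀,
        Complex.conj_ofReal]
      ring
    rw [h1, h.innerDelta_columnVec hp' (hroot k) (hroot l)]
    by_cases hkl : k = l
    · subst hkl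
      -- Two factors `1 / N` against the squared norm `N` leave `1 / N`, which is also the value at
      -- the empty column, as `c_0 = 1` and `P_0 = 1`.
      rw [if_pos rfl, if_pos rfl, h.eigenfunction_column hp hE, Pi.smul_apply,
        EllipticRacah.columnVec_column _ _ _ _ (Nat.zero_le n), smul_eq_mul,
        EllipticRacah.Admissible.colC_zero, EllipticRacah.colPoly_eq_triPoly, EllipticRacah.triPoly_zero,
        mul_assoc, inv_mul_cancel₀ (Complex.ofReal_ne_zero.2 hN)]
      simp
    · rw [if_neg fun h2 => hkl (hE.injective h hp h2), if_neg hkl, mul_zero]
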